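/- Let $n\ge 2$ and $k=n-1$. Let $R(T)=\mathbb Z[e^{\pm a_1},\dots,e^{\pm a_n}]$, $b_i=1-e^{-a_i}$, $c(\lambda)=1-e^{\lambda}$, and let $R(T)^\Delta$ be the localization of $R(T)$ at the elements $c(a_i-a_j)$, $i\ne j$. Let $\tilde W=X^\vee\rtimes S_n$ with $X^\vee=\bigoplus_i\mathbb Z\varepsilon_i$ be the extended affine Weyl group of $GL_n$, with simple reflections $s_i$ ($i\in\mathbb Z/n\mathbb Z$; $s_0=t_{\varepsilon_1-\varepsilon_n}s_\theta$, where $s_\theta$ exchanges $1$ and $n$) and $\tau=t_{\varepsilon_1}s_1\cdots s_{n-1}$, and let $\tilde W^0$ be the set of affine Grassmannian elements, $\tilde W^0=\{w : \ell(ws_i)>\ell(w)\ \text{for } i\neq 0\}$. Put $\alpha_i=a_i-a_{i+1}$ for $1\le i\le n-1$ and $\alpha_0=a_n-a_1$. In the smash product $\mathbb K^\Delta$ of $R(T)^\Delta$ and $\mathbb Z[\tilde W]$ (level-zero action: $X^\vee$ acts trivially) put $T_i=c(\alpha_i)^{-1}(s_i-1)$, $D_i=T_i+1$, and $T_w=\tau^jT_{i_1}\cdots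 T_{i_l}$, $D_w=\tau^jD_{i_1}\cdots D_{i_l}$ for a reduced expression $w=\tau^js_{i_1}\cdots s_{i_l}$. Let $\mathbb K\subset\mathbb K^\Delta$ be the subring generated by $R(T)$, all $T_i$ and $\tau^{\pm1}$, and let $\mathbb L\subset\mathbb K$ be the centralizer of $R(T)$ (the $K$-theoretic Peterson subalgebra, which is the algebraic model of $K^T_*(\mathrm{Gr}_{GL_n})$). For a commutative ring $A$, let $\hat\Lambda_A$ be the ring of formal sums $f_0+f_1+\cdots$ with $f_d$ a symmetric function of degree $d$ in $y=(y_1,y_2,\dots)$ over $A$. $\mathbb K^\Delta$ acts on $\hat\Lambda_{R(T)^\Delta}$: $S_n$ permutes the $b_i$ in the coefficients and $t_{\varepsilon_i}$ multiplies by $\Omega(b_i|y)=\prod_j(1-b_iy_j)^{-1}$. Let $\hat\Lambda_{(n)}=\mathbb K\cdot 1$, and for $w\in\tilde W^0$ let $g^{(k)}_w(y|b)=T_w(1)$ and $\tilde g^{(k)}_w(y|b)=D_w(1)$. Let $\iota$ be the involution $i\mapsto -i$ of $\mathbb Z/n\mathbb Z$, let $w\mapsto w^*$ be the automorphism of $\tilde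 W$ with $s_i^*=s_{-i}$ and $\tau^*=\tau^{-1}$, and let $\iota$ also denote the involution $f\otimes w\mapsto \iota(f)\otimes w^*$ of $\mathbb K^\Delta$, where $\iota(e^{a_i})=e^{-a_{n+1-i}}$ on coefficients. Let $\Lambda$ be the ring of symmetric functions in $y$ over $\mathbb Z$, and $\Lambda[[b]]=\Lambda[[b_1,\dots,b_n]]$. Then: 1. There is a unique ring automorphism $\tilde\omega$ of $\Lambda$ with $\tilde\omega(h_l)=\sum_{r=0}^{l-1}\binom{l-1}{r}e_{r+1}$ for all $l\ge1$, and a unique ring automorphism $\hat\iota$ of $\Lambda[[b]]$ that extends $\tilde\omega$, satisfies $\hat\iota(b_i)=\ominus b_{n+1-i}$ for $1\le i\le n$, where $\ominus v=-v/(1-v)$, and does not decrease the order in $b$. Moreover $\hat\iota^2=\mathrm{id}$. 2. The map $x\mapsto x\cdot1$ is a ring isomorphism $\mathbb L\cong\hat\Lambda_{(n)}$. Every element of $\hat\Lambda_{(n)}$ has its coefficients in $R(T)$ and, when these are expanded in the $b_i$ (by $e^{-a_i}=1-b_i$), lies in $\Lambda[[b]]$. The involution $\iota$ maps $\mathbb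 L$ to itself and the isomorphism transports it to $\hat\iota$: $\hat\iota(x\cdot1)=\iota(x)\cdot1$ for all $x\in\mathbb L$. 3. For every $w\in\tilde W^0$ we have $w^*\in\tilde W^0$ and $$\hat\iota\bigl(\tilde g^{(k)}_w(y|b)\bigr)=\tilde g^{(k)}_{w^*}(y|b),\qquad \hat\iota\bigl(g^{(k)}_w(y|b)\bigr)=g^{(k)}_{w^*}(y|b).$$ -/

import Mathlib

open scoped BigOperators

noncomputable section

namespace KDoubleSchur

/-! ## The extended affine Weyl group of `GL_n`

The usual indices `1, …, n` are shifted to `0, …, n - 1 : Fin n`, and the nodes of the affine Dynkin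
diagram `ℤ / n` are also `Fin n` (with its cyclic arithmetic), so `α_i = a_{i-1} - a_i` for every
node `i`, including `α_0 = a_{n-1} - a_0`. -/

section Weyl

variable (n : ℕ)

/-- `W̃ = X^∨ ⋊ S_n`; the cocharacter lattice `X^∨ = ⊕ ℤ ε_i` is written multiplicatively and
`u ∈ S_n` acts by `u (ε_i) = ε_{u i}`. -/
abbrev ExtWeyl : Type :=
  (Fin n → Multiplicative ℤ) ⋊[mulAutArrow] Equiv.Perm (Fin n)

variable {n}

/-- The translation `t_μ`, `μ = ∑ μ_i ε_i`. -/
def transl (μ : Fin n → ℤ) : ExtWeyl n := SemidirectProduct.inl fun i => Multiplicative.ofAdd (μ i)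

/-- The inclusion `S_n ⊂ W̃`. -/
def perm (u : Equiv.Perm (Fin n)) : ExtWeyl n := SemidirectProduct.inr u

variable [NeZero n]

/-- The simple reflections: `s_i = (i-1 i)` for `i ≠ 0`, and `s_0 = t_{θ^∨} s_θ` with
`θ^∨ = ε_0 - ε_{n-1}` and `s_θ = (n-1 0)`. -/
def simpleRefl (i : Fin n) : ExtWeyl n :=
  transl (if i = 0 then Pi.single 0 1 - Pi.single (-1) 1 else 0) * perm (Equiv.swap (i - 1) i)

/-- The generator `τ = t_{ε_0} u_1` of the fundamental group, `u_1 = (i ↦ i + 1)`. -/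
def tau : ExtWeyl n := transl (Pi.single 0 1) * perm (Equiv.addRight 1)

/-- The element `τ^j s_{i_1} ⋯ s_{i_l}`. -/
def word (j : ℤ) (l : List (Fin n)) : ExtWeyl n := tau ^ j * (l.map simpleRefl).prod

/-- Length on `W̃ = ⟨τ⟩ ⋉ Ŵ`: the Coxeter length of the `Ŵ`-component. -/
def len (w : ExtWeyl n) : ℕ := sInf {k | ∃ j l, word j l = w ∧ l.length = k}

/-- Affine Grassmannian elements: `w s_i > w` for all `i ∈ I`. -/
def IsGrassmannian (w : ExtWeyl n) : Prop := ∀ i : Fin n, i ≠ 0 → len w < len (w * simpleRefl i)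

end Weyl

theorem extWeyl_ext {n : ℕ} {x y : ExtWeyl n} (h : ∀ i, x.left i = y.left i)
    (h' : ∀ i, x.right i = y.right i) : x = y :=
  SemidirectProduct.ext (funext h) (Equiv.ext h')

section Lemmas

variable {n : ℕ}

@[simp] theorem perm_left (u : Equiv.Perm (Fin n)) : (perm u).left = 1 := rfl
@[simp] theorem perm_right (u : Equiv.Perm (Fin n)) : (perm u).right = u := rfl
@[simp] theorem transl_left (μ : Fin n → ℤ) (i : Fin n) :
    (transl μ).left i = Multiplicative.ofAdd (μ i) := rfl
@[simp] theorem transl_right (μ : Fin n → ℤ) : (transl μ).right = 1 := rfl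

@[simp] theorem mul_left_apply (x y : ExtWeyl n) (i : Fin n) :
    (x * y).left i = x.left i * y.left (x.right⁻¹ i) := rfl

variable [NeZero n]

theorem simpleRefl_mul_self (i : Fin n) : (simpleRefl i : ExtWeyl n) * simpleRefl i = 1 := by
  apply extWeyl_ext
  · intro j
    apply Multiplicative.toAdd.injective
    by_cases h0 : i = 0
    · subst h0
      simp [simpleRefl, Pi.single_apply, Equiv.swap_apply_def]
      grind
    · simp [simpleRefl, h0]
  · intro j
    simp [simpleRefl]

theorem tau_mul_simpleRefl (i : Fin n) :
    (tau : ExtWeyl n) * simpleRefl i = simpleRefl (i + 1) * tau := by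
  apply extWeyl_ext
  · intro j
    apply Multiplicative.toAdd.injective
    have e1 : (Equiv.addRight (1 : Fin n))⁻¹ j = j - 1 := by
      rw [Equiv.Perm.inv_eq_iff_eq]; simp
    simp only [tau, simpleRefl, mul_left_apply, transl_left, perm_left, transl_right, e1,
      SemidirectProduct.mul_right, perm_right, inv_one, one_mul, Equiv.Perm.coe_one, id, toAdd_mul,
      toAdd_ofAdd, Pi.one_apply, mul_one, Equiv.swap_inv, add_sub_cancel_right]
    by_cases h0 : i = 0
    · subst h0
      by_cases h1 : (1 : Fin n) = 0
      · have : ∀ x : Fin n, x = 0 := fun x => by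
          have := congrArg (x * ·) h1
          simpa using this
        simp [this]
      · simp [h1, Pi.single_apply, Equiv.swap_apply_def, sub_eq_iff_eq_add]
        grind
    · by_cases h1 : i + 1 = 0
      · have : i = -1 := by rw [← add_eq_zero_iff_eq_neg]; exact h1
        subst this
        simp [h0, Pi.single_apply, Equiv.swap_apply_def]
        grind
      · simp [h0, h1, Pi.single_apply, Equiv.swap_apply_def]
        grind
  · intro j
    simp [tau, simpleRefl, Equiv.swap_apply_def, eq_sub_iff_add_eq]
    grind

theorem word_mul_simpleRefl (j : ℤ) (l : List (Fin n)) (i : Fin n) :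
    word j l * simpleRefl i = word j (l ++ [i]) := by
  simp [word, mul_assoc]

theorem word_mul_tau (j : ℤ) (l : List (Fin n)) :
    word j l * tau = word (j + 1) (l.map (· - 1)) := by
  have : (l.map simpleRefl).prod * (tau : ExtWeyl n) =
      tau * ((l.map (· - 1)).map simpleRefl).prod := by
    induction l with
    | nil => simp
    | cons a l ih =>
      simp only [List.map_cons, List.prod_cons, mul_assoc] at ih ⊢
      rw [ih, ← mul_assoc, ← mul_assoc, tau_mul_simpleRefl, sub_add_cancel]
  rw [word, word, mul_assoc, this, zpow_add_one, mul_assoc]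

theorem word_mul_tau_inv (j : ℤ) (l : List (Fin n)) :
    word j l * tau⁻¹ = word (j - 1) (l.map (· + 1)) := by
  rw [mul_inv_eq_iff_eq_mul, word_mul_tau]
  simp [Function.comp_def]

/-- `W̃` is generated by `τ` and the simple reflections. -/
theorem exists_word (w : ExtWeyl n) : ∃ j l, word j l = w := by
  let G : Subgroup (ExtWeyl n) := Subgroup.closure ({tau} ∪ Set.range simpleRefl)
  have hs : ∀ i : Fin n, simpleRefl i ∈ G := fun i => Subgroup.subset_closure (Or.inr ⟨i, rfl⟩)
  have ht : tau ∈ G := Subgroup.subset_closure (Or.inl rfl)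
  have hperm : ∀ u : Equiv.Perm (Fin n), perm u ∈ G := by
    obtain ⟨m, rfl⟩ : ∃ m, n = m + 1 := ⟨n - 1, by have := NeZero.pos n; omega⟩
    have key : Submonoid.closure (Set.range fun i : Fin m => Equiv.swap i.castSucc i.succ) ≤
        (G.comap (SemidirectProduct.inr : Equiv.Perm (Fin (m + 1)) →* ExtWeyl (m + 1))).toSubmonoid := by
      rw [Submonoid.closure_le]
      rintro _ ⟨i, rfl⟩
      have h := hs i.succ
      have e : i.succ - 1 = i.castSucc := by
        rw [sub_eq_iff_eq_add]; simp
      rw [simpleRefl, if_neg (Fin.succ_ne_zero i), e] at h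
      have e2 : (transl (0 : Fin (m + 1) → ℤ)) = 1 := extWeyl_ext (fun _ => rfl) (fun _ => rfl)
      rw [e2, one_mul] at h
      exact h
    rw [Equiv.Perm.mclosure_swap_castSucc_succ] at key
    exact fun u => key trivial
  have hbase : transl (Pi.single 0 1) ∈ G := by
    have := G.mul_mem ht (G.inv_mem (hperm (Equiv.addRight 1)))
    rwa [tau, mul_inv_cancel_right] at this
  have hsingle : ∀ (i : Fin n) (c : ℤ), transl (Pi.single i c) ∈ G := by
    intro i c
    have h1 : transl (Pi.single 0 c) ∈ G := by
      have := G.zpow_mem hbase c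
      have e : (transl (Pi.single (0 : Fin n) (1 : ℤ))) ^ c = transl (Pi.single 0 c) := by
        rw [transl, transl, ← map_zpow]
        congr 1
        funext k
        by_cases hk : k = 0
        · subst hk; simp [← ofAdd_zsmul]
        · simp [hk]
      rwa [e] at this
    have h2 := G.mul_mem (G.mul_mem (hperm (Equiv.swap 0 i)) h1) (G.inv_mem (hperm (Equiv.swap 0 i)))
    have e : perm (Equiv.swap 0 i) * transl (Pi.single 0 c) * (perm (Equiv.swap 0 i))⁻¹ =
        transl (Pi.single i c) := by
      apply extWeyl_ext
      · intro k
        have e3 : (perm (Equiv.swap 0 i) : ExtWeyl n)⁻¹ = perm (Equiv.swap 0 i)⁻¹ :=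
          (map_inv SemidirectProduct.inr _).symm
        rw [e3]
        simp only [mul_left_apply, perm_left, Pi.one_apply, perm_right, transl_left, one_mul,
          mul_one, Equiv.swap_inv, Pi.single_apply, Equiv.swap_apply_def]
        congr 1
        grind
      · intro k
        have e3 : (perm (Equiv.swap 0 i) : ExtWeyl n)⁻¹ = perm (Equiv.swap 0 i)⁻¹ :=
          (map_inv SemidirectProduct.inr _).symm
        rw [e3]
        simp
    rwa [e] at h2
  have htop : G = ⊤ := by
    rw [eq_top_iff]
    intro x _
    have hx : x = SemidirectProduct.inl x.left * perm x.right :=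
      (SemidirectProduct.inl_left_mul_inr_right x).symm
    rw [hx]
    refine G.mul_mem ?_ (hperm _)
    have : x.left = ∏ i, Pi.mulSingle i (x.left i) := (Finset.univ_prod_mulSingle x.left).symm
    rw [this]
    refine (G.comap (SemidirectProduct.inl : (Fin n → Multiplicative ℤ) →* ExtWeyl n)).prod_mem
      fun i _ => ?_
    rw [Subgroup.mem_comap]
    convert hsingle i (Multiplicative.toAdd (x.left i)) using 1
    refine congrArg SemidirectProduct.inl (funext fun k => ?_)
    by_cases hk : k = i
    · subst hk; simp
    · simp [hk]
  have hw : w ∈ G := htop ▸ Subgroup.mem_top w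
  induction hw using Subgroup.closure_induction_right with
  | one => exact ⟨0, [], by simp [word]⟩
  | mul_right x hx y hy ih =>
    obtain ⟨j, l, rfl⟩ := ih
    rcases hy with rfl | ⟨i, rfl⟩
    · exact ⟨_, _, (word_mul_tau j l).symm⟩
    · exact ⟨_, _, (word_mul_simpleRefl j l i).symm⟩
  | mul_inv_cancel x hx y hy ih =>
    obtain ⟨j, l, rfl⟩ := ih
    rcases hy with rfl | ⟨i, rfl⟩
    · exact ⟨_, _, (word_mul_tau_inv j l).symm⟩
    · rw [inv_eq_of_mul_eq_one_left (simpleRefl_mul_self i)]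
      exact ⟨_, _, (word_mul_simpleRefl j l i).symm⟩

/-- Every element has a reduced expression `w = τ^j s_{i_1} ⋯ s_{i_l}`, `l = len w`. -/
theorem exists_reduced_word (w : ExtWeyl n) :
    ∃ p : ℤ × List (Fin n), word p.1 p.2 = w ∧ p.2.length = len w := by
  obtain ⟨j, l, h⟩ := exists_word w
  obtain ⟨j, l, h, h'⟩ := Nat.sInf_mem (s := {k | ∃ j l, word j l = w ∧ l.length = k})
    ⟨l.length, j, l, h, rfl⟩
  exact ⟨(j, l), h, h'⟩

/-- A chosen reduced expression of `w`. -/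
def reducedWord (w : ExtWeyl n) : ℤ × List (Fin n) := (exists_reduced_word w).choose

/-- The automorphism `w ↦ w*` of `W̃`: `t_μ u ↦ t_{-w_0 μ} w_0 u w_0`, with `w_0 = (i ↦ n - 1 - i)`.
By the two lemmas below it is the one with `s_i* = s_{-i}` and `τ* = τ⁻¹`. -/
def starAut : ExtWeyl n →* ExtWeyl n where
  toFun w := ⟨fun i => (w.left i.rev)⁻¹, Fin.revPerm * w.right * Fin.revPerm⟩
  map_one' := extWeyl_ext (by simp) (by simp)
  map_mul' x y := extWeyl_ext
    (by
      intro i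
      simp [mul_comm])
    (by intro i; simp)

theorem rev_eq_sub (i : Fin n) : i.rev = -i - 1 := by
  obtain ⟨m, rfl⟩ : ∃ m, n = m + 1 := ⟨n - 1, by have := NeZero.pos n; omega⟩
  rw [eq_sub_iff_add_eq, ← add_eq_zero_iff_eq_neg, Fin.ext_iff]
  simp [Fin.val_add]
  have := i.2
  rw [show m - (i : ℕ) + 1 + i = m + 1 by omega, Nat.mod_self]

theorem star_simpleRefl (i : Fin n) : starAut (simpleRefl i) = simpleRefl (-i) := by
  apply extWeyl_ext
  · intro j
    apply Multiplicative.toAdd.injective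
    by_cases h0 : i = 0
    · subst h0
      simp [starAut, simpleRefl, Pi.single_apply, rev_eq_sub]
      grind
    · simp [starAut, simpleRefl, h0]
  · intro j
    simp [starAut, simpleRefl, rev_eq_sub, Equiv.swap_apply_def]
    grind

theorem star_tau : starAut (tau : ExtWeyl n) = tau⁻¹ := by
  rw [eq_inv_iff_mul_eq_one]
  apply extWeyl_ext
  · intro j
    apply Multiplicative.toAdd.injective
    simp [starAut, tau, rev_eq_sub, Pi.single_apply]
    have h : -j - 1 = 0 ↔ 1 + j = 0 := by
      rw [show -j - 1 = -(1 + j) by abel, neg_eq_zero]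
    simp [h]
  · intro j
    simp [starAut, tau, rev_eq_sub]

end Lemmas

/-! ## The representation ring and the `K`-nil-Hecke ring -/

section Rep

variable (n : ℕ)

/-- `R(T) = ℤ[X]` for the character lattice `X = ⊕ ℤ a_i`. -/
abbrev RepRing : Type := AddMonoidAlgebra ℤ (Fin n → ℤ)

variable {n}

/-- The character `a_i`. -/
def chr (i : Fin n) : Fin n → ℤ := Pi.single i 1

/-- `e^λ`. -/
def expo (lam : Fin n → ℤ) : RepRing n := AddMonoidAlgebra.single lam 1

/-- `c(λ) = 1 - e^λ`. -/
def cc (lam : Fin n → ℤ) : RepRing n := 1 - expo lam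

/-- `b_i = 1 - e^{-a_i}`. -/
def bb (i : Fin n) : RepRing n := cc (-chr i)

/-- `S_n` acts on characters by `u (a_i) = a_{u i}`. -/
def permChar (u : Equiv.Perm (Fin n)) : (Fin n → ℤ) →+ (Fin n → ℤ) where
  toFun lam := fun i => lam (u⁻¹ i)
  map_zero' := rfl
  map_add' _ _ := rfl

/-- The involution `a_i ↦ -a_{n-1-i}` on characters. -/
def iotaChar : (Fin n → ℤ) →+ (Fin n → ℤ) where
  toFun lam := fun i => -lam i.rev
  map_zero' := by ext; simp
  map_add' _ _ := by ext; simp [add_comm]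

/-- The action of `S_n` on `R(T)`. -/
def permRep (u : Equiv.Perm (Fin n)) : RepRing n →+* RepRing n :=
  AddMonoidAlgebra.mapDomainRingHom ℤ (permChar u)

/-- The involution `ι` of `R(T)`. -/
def iotaRep : RepRing n →+* RepRing n := AddMonoidAlgebra.mapDomainRingHom ℤ iotaChar

variable (n) in
/-- The multiplicative set generated by `c(α)`, `α` a root. -/
def rootSet : Submonoid (RepRing n) :=
  Submonoid.closure {x | ∃ i j : Fin n, i ≠ j ∧ x = cc (chr i - chr j)}

variable (n) in
/-- `R(T)^Δ`. -/
def RepLoc : Type := Localization (rootSet n)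

instance : CommRing (RepLoc n) := inferInstanceAs (CommRing (Localization (rootSet n)))

instance : Algebra (RepRing n) (RepLoc n) :=
  inferInstanceAs (Algebra (RepRing n) (Localization (rootSet n)))

instance : IsLocalization (rootSet n) (RepLoc n) :=
  inferInstanceAs (IsLocalization (rootSet n) (Localization (rootSet n)))

theorem permChar_chr (u : Equiv.Perm (Fin n)) (i : Fin n) : permChar u (chr i) = chr (u i) := by
  ext k
  simp only [permChar, chr, Pi.single_apply, AddMonoidHom.coe_mk, ZeroHom.coe_mk,
    Equiv.Perm.inv_eq_iff_eq]

theorem iotaChar_chr (i : Fin n) : iotaChar (chr i) = -chr i.rev := by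
  ext k
  simp [iotaChar, chr, Pi.single_apply, Fin.rev_eq_iff]

theorem permRep_cc (u : Equiv.Perm (Fin n)) (lam) : permRep u (cc lam) = cc (permChar u lam) := by
  rw [cc, cc, map_sub, map_one]
  simp [permRep, expo]

theorem iotaRep_cc (lam : Fin n → ℤ) : iotaRep (cc lam) = cc (iotaChar lam) := by
  rw [cc, cc, map_sub, map_one]
  simp [iotaRep, expo]

theorem rootSet_le_permRep (u : Equiv.Perm (Fin n)) :
    rootSet n ≤ (rootSet n).comap (permRep u) := by
  rw [rootSet, Submonoid.closure_le]
  rintro _ ⟨i, j, hij, rfl⟩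
  refine Submonoid.subset_closure ⟨u i, u j, u.injective.ne hij, ?_⟩
  rw [permRep_cc, map_sub, permChar_chr, permChar_chr]

theorem rootSet_le_iotaRep : rootSet n ≤ (rootSet n).comap iotaRep := by
  rw [rootSet, Submonoid.closure_le]
  rintro _ ⟨i, j, hij, rfl⟩
  refine Submonoid.subset_closure ⟨j.rev, i.rev, Fin.rev_injective.ne hij.symm, ?_⟩
  rw [iotaRep_cc, map_sub, iotaChar_chr, iotaChar_chr, sub_neg_eq_add, neg_add_eq_sub]

theorem permRep_one : permRep (1 : Equiv.Perm (Fin n)) = RingHom.id _ := by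
  apply AddMonoidAlgebra.ringHom_ext <;> intros <;> simp [permRep, permChar]
  rfl

theorem permRep_mul (u v : Equiv.Perm (Fin n)) : permRep (u * v) = (permRep u).comp (permRep v) := by
  apply AddMonoidAlgebra.ringHom_ext <;> intros <;> simp [permRep, permChar]

theorem iotaRep_permRep (u : Equiv.Perm (Fin n)) : iotaRep.comp (permRep u) =
    (permRep (Fin.revPerm * u * Fin.revPerm)).comp iotaRep := by
  apply AddMonoidAlgebra.ringHom_ext <;> intros <;> simp [iotaRep, iotaChar, permRep, permChar]

/-- The action of `S_n` on `R(T)^Δ`. -/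
def permLoc : Equiv.Perm (Fin n) →* (RepLoc n →+* RepLoc n) where
  toFun u := IsLocalization.map (RepLoc n) (permRep u) (rootSet_le_permRep u)
  map_one' := by
    refine IsLocalization.ringHom_ext (rootSet n) (RingHom.ext fun x => ?_)
    simp [permRep_one]
  map_mul' u v := by
    refine IsLocalization.ringHom_ext (rootSet n) (RingHom.ext fun x => ?_)
    simp [permRep_mul]

/-- The involution `ι` of `R(T)^Δ`. -/
def iotaLoc : RepLoc n →+* RepLoc n :=
  IsLocalization.map (M := rootSet n) (T := rootSet n) (RepLoc n) iotaRep rootSet_le_iotaRep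

theorem iotaLoc_permLoc (u : Equiv.Perm (Fin n)) (x : RepLoc n) : iotaLoc (permLoc u x) =
    permLoc (Fin.revPerm * u * Fin.revPerm) (iotaLoc x) := by
  have : iotaLoc.comp (permLoc u) =
      (permLoc (Fin.revPerm * u * Fin.revPerm)).comp (iotaLoc (n := n)) := by
    refine IsLocalization.ringHom_ext (rootSet n) (RingHom.ext fun x => ?_)
    have := RingHom.congr_fun (iotaRep_permRep u) x
    simp only [RingHom.comp_apply] at this
    simp [iotaLoc, permLoc, -map_mul, this]
  exact RingHom.congr_fun this x

/-- The level zero action of `W̃` on `R(T)^Δ`: translations act trivially. -/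
instance levelZero : MulSemiringAction (ExtWeyl n) (RepLoc n) :=
  MulSemiringAction.compHom (RepLoc n) (permLoc.comp SemidirectProduct.rightHom)

variable (n) in
/-- `K^Δ`: the smash product of `R(T)^Δ` and `ℤ[W̃]`, `(f ⊗ w) (g ⊗ v) = f w(g) ⊗ w v`. -/
abbrev KDelta : Type := SkewMonoidAlgebra (RepLoc n) (ExtWeyl n)

/-- `R(T)^Δ ⊂ K^Δ`. -/
def scal : RepLoc n →+* KDelta n := SkewMonoidAlgebra.singleOneRingHom

/-- `W̃ ⊂ K^Δ`. -/
def grp : ExtWeyl n →* KDelta n := SkewMonoidAlgebra.of (RepLoc n) (ExtWeyl n)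

/-- `R(T) ⊂ K^Δ`. -/
def scalRep : RepRing n →+* KDelta n := scal.comp (algebraMap (RepRing n) (RepLoc n))

/-- The involution `ι` of `K^Δ`: `ι (f ⊗ w) = ι(f) ⊗ w*`. -/
def iotaK [NeZero n] : KDelta n →+* KDelta n :=
  SkewMonoidAlgebra.liftNCRingHom (scal.comp iotaLoc) (grp.comp starAut) (by
    intro x y
    have h : iotaLoc (y • x) = starAut y • iotaLoc x := iotaLoc_permLoc y.right x
    simp only [RingHom.comp_apply, MonoidHom.comp_apply, h]
    change SkewMonoidAlgebra.single 1 _ * SkewMonoidAlgebra.single _ 1 =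
      SkewMonoidAlgebra.single _ 1 * SkewMonoidAlgebra.single 1 _
    simp [SkewMonoidAlgebra.single_mul_single])

variable [NeZero n]

/-- The simple root `α_i = a_{i-1} - a_i`; in particular `α_0 = a_{n-1} - a_0`. -/
def simpleRoot (i : Fin n) : Fin n → ℤ := chr (i - 1) - chr i

theorem isUnit_cc_simpleRoot (hn : 2 ≤ n) (i : Fin n) :
    IsUnit (algebraMap (RepRing n) (RepLoc n) (cc (simpleRoot i))) := by
  have h : i - 1 ≠ i := by
    intro h
    have h1 : (1 : Fin n) = 0 := by simpa using h
    have := congrArg Fin.val h1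
    rw [Fin.val_one', Fin.val_zero, Nat.mod_eq_of_lt (by omega)] at this
    omega
  exact IsLocalization.map_units (RepLoc n)
    (⟨_, Submonoid.subset_closure ⟨i - 1, i, h, rfl⟩⟩ : rootSet n)

/-- `T_i = c(α_i)⁻¹ (s_i - 1)`; for `n ≥ 2` the element `c(α_i)` is a unit of `R(T)^Δ`. -/
def demT (i : Fin n) : KDelta n :=
  scal (Ring.inverse (algebraMap _ (RepLoc n) (cc (simpleRoot i)))) * (grp (simpleRefl i) - 1)

/-- `D_i = T_i + 1`. -/
def demD (i : Fin n) : KDelta n := demT i + 1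

/-- `T_w = τ^j T_{i_1} ⋯ T_{i_l}` for a reduced expression `w = τ^j s_{i_1} ⋯ s_{i_l}`
(by the braid relations it does not matter which). -/
def bigT (w : ExtWeyl n) : KDelta n :=
  grp (tau ^ (reducedWord w).1) * ((reducedWord w).2.map demT).prod

/-- `D_w = τ^j D_{i_1} ⋯ D_{i_l}` for a reduced expression `w = τ^j s_{i_1} ⋯ s_{i_l}`
(by the braid relations it does not matter which). -/
def bigD (w : ExtWeyl n) : KDelta n :=
  grp (tau ^ (reducedWord w).1) * ((reducedWord w).2.map demD).prod

variable (n) in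
/-- The level zero affine `K`-nil-Hecke ring of `GL_n`: the subring of `K^Δ` generated by `R(T)`,
the `T_i` and the fundamental group `⟨τ⟩`. -/
def nilHecke : Subring (KDelta n) :=
  Subring.closure (Set.range scalRep ∪ Set.range demT ∪ Set.range fun j : ℤ => grp (tau ^ j))

variable (n) in
/-- The `K`-theoretic Peterson subalgebra: the centralizer of `R(T)` in the nil-Hecke ring. -/
def peterson : Subring (KDelta n) := nilHecke n ⊓ Subring.centralizer (Set.range scalRep)

end Rep

/-! ## Symmetric series -/

section Sym

/-- The completed ring `Λ̂_A` of symmetric functions in `y_0, y_1, …` over `A`: formal sums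
`f_0 + f_1 + ⋯` with `f_d ∈ A ⊗ Λ_d`, that is, symmetric formal power series over `A`. -/
def SymSeries (A : Type*) [CommRing A] : Subalgebra A (MvPowerSeries ℕ A) where
  carrier := {f | ∀ e : Equiv.Perm ℕ, MvPowerSeries.rename e f = f}
  mul_mem' hf hg e := by rw [map_mul, hf e, hg e]
  add_mem' hf hg e := by rw [map_add, hf e, hg e]
  algebraMap_mem' r e := AlgHom.commutes _ r

variable {A B : Type*} [CommRing A] [CommRing B]

/-- Base change `Λ̂_A → Λ̂_B` along `A → B`, coefficient by coefficient. -/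
def SymSeries.map (φ : A →+* B) : SymSeries A →+* SymSeries B :=
  ((MvPowerSeries.map φ).comp (SymSeries A).subtype).codRestrict (SymSeries B) (by
    intro f e
    have h : MvPowerSeries.rename e (f : MvPowerSeries ℕ A) = f := f.2 e
    rw [RingHom.comp_apply, MvPowerSeries.rename_map]
    exact congrArg _ h)

theorem coeff_rename_equiv (e : Equiv.Perm ℕ) (f : MvPowerSeries ℕ A) (m : ℕ →₀ ℕ) :
    MvPowerSeries.coeff m (MvPowerSeries.rename e f) =
      MvPowerSeries.coeff (m.equivMapDomain e.symm) f := by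
  have h := MvPowerSeries.coeff_embDomain_rename e.toEmbedding f (m.equivMapDomain e.symm)
  rw [← h]
  congr 2
  ext i
  have := Finsupp.embDomain_apply_self e.toEmbedding (m.equivMapDomain e.symm) (e.symm i)
  simpa using this.symm

theorem degree_equivMapDomain (e : Equiv.Perm ℕ) (m : ℕ →₀ ℕ) :
    (m.equivMapDomain e).degree = m.degree := by
  rw [Finsupp.equivMapDomain_eq_mapDomain, Finsupp.degree_mapDomain]

/-- A power series whose coefficients do not change when the variables are permuted. -/
def symOfCoeff (c : (ℕ →₀ ℕ) → A) (hc : ∀ (e : Equiv.Perm ℕ) m, c (m.equivMapDomain e) = c m) :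
    SymSeries A :=
  ⟨(c : MvPowerSeries ℕ A), fun e => MvPowerSeries.ext fun m =>
    (coeff_rename_equiv e c m).trans (hc e.symm m)⟩

/-- `∏_j (1 - b y_j)⁻¹`, expanded: the coefficient of a monomial of degree `d` is `b^d`. -/
def omegaSeries (b : A) : SymSeries A := symOfCoeff (fun m => b ^ m.degree)
  fun e m => by rw [degree_equivMapDomain]

theorem omegaSeries_mul_inv (b : A) : (omegaSeries b : MvPowerSeries ℕ A) *
    MvPowerSeries.invOfUnit (omegaSeries b : MvPowerSeries ℕ A) 1 = 1 := by
  apply MvPowerSeries.mul_invOfUnit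
  change b ^ (0 : ℕ →₀ ℕ).degree = 1
  simp

/-- `Ω(b | y)` as a unit of `Λ̂_A`. -/
def Omega (b : A) : (SymSeries A)ˣ where
  val := omegaSeries b
  inv := ⟨MvPowerSeries.invOfUnit (omegaSeries b : MvPowerSeries ℕ A) 1, fun e => by
    have h := congrArg (MvPowerSeries.rename e) (omegaSeries_mul_inv b)
    have h2 : MvPowerSeries.rename e (omegaSeries b : MvPowerSeries ℕ A) = omegaSeries b :=
      (omegaSeries b).2 e
    rw [map_mul, h2, map_one] at h
    exact (left_inv_eq_right_inv ((mul_comm _ _).trans (omegaSeries_mul_inv b)) h).symm⟩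
  val_inv := Subtype.ext (omegaSeries_mul_inv b)
  inv_val := Subtype.ext ((mul_comm _ _).trans (omegaSeries_mul_inv b))

/-- The ring `Λ` of symmetric functions over `ℤ`: symmetric power series of bounded degree. -/
def SymFun : Subring (MvPowerSeries ℕ ℤ) where
  carrier := {f | f ∈ SymSeries ℤ ∧ ∃ d : ℕ, ∀ m : ℕ →₀ ℕ, d < m.degree → MvPowerSeries.coeff m f = 0}
  mul_mem' := by
    rintro f g ⟨hf, d, hd⟩ ⟨hg, d', hd'⟩
    refine ⟨mul_mem hf hg, d + d', fun m hm => ?_⟩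
    classical
    rw [MvPowerSeries.coeff_mul]
    refine Finset.sum_eq_zero fun p hp => ?_
    have hp := Finset.HasAntidiagonal.mem_antidiagonal.mp hp
    have : m.degree = p.1.degree + p.2.degree := by rw [← hp, map_add]
    rcases lt_or_ge d p.1.degree with h | h
    · rw [hd _ h, zero_mul]
    · rw [hd' _ (by omega), mul_zero]
  one_mem' := ⟨one_mem _, 0, fun m hm => by
    classical
    rw [MvPowerSeries.coeff_one, if_neg]
    rintro rfl
    simp at hm⟩
  add_mem' := by
    rintro f g ⟨hf, d, hd⟩ ⟨hg, d', hd'⟩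
    refine ⟨add_mem hf hg, d + d', fun m hm => ?_⟩
    rw [map_add, hd _ (by omega), hd' _ (by omega), add_zero]
  zero_mem' := ⟨zero_mem _, 0, fun m _ => by simp⟩
  neg_mem' := by
    rintro f ⟨hf, d, hd⟩
    exact ⟨neg_mem hf, d, fun m hm => by rw [map_neg, hd m hm, neg_zero]⟩

/-- The complete symmetric function `h_l`: the sum of all monomials of degree `l`. -/
def hh (l : ℕ) : SymFun :=
  ⟨symOfCoeff (A := ℤ) (fun m => if m.degree = l then 1 else 0)
      fun e m => by rw [degree_equivMapDomain],
    Subtype.prop _, l, fun m hm => if_neg (show ¬ m.degree = l from hm.ne')⟩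

open Classical in
/-- The elementary symmetric function `e_l`: the sum of all squarefree monomials of degree `l`. -/
def ee (l : ℕ) : SymFun :=
  ⟨symOfCoeff (A := ℤ) (fun m => if m.degree = l ∧ ∀ i, m i ≤ 1 then 1 else 0) fun e m => by
      have h : (∀ i, m (e.symm i) ≤ 1) ↔ ∀ i, m i ≤ 1 :=
        ⟨fun H i => by simpa using H (e i), fun H i => H _⟩
      simp only [degree_equivMapDomain, Finsupp.equivMapDomain_apply, h],
    Subtype.prop _, l, fun m hm =>
      if_neg (show ¬ (m.degree = l ∧ ∀ i, m i ≤ 1) from fun h => hm.ne' h.1)⟩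

end Sym

/-! ## The action on symmetric series and the double `k`-Schur functions -/

section Action

variable {n : ℕ}

/-- `Ω^μ = ∏_i Ω(b_i | y)^{μ_i}`. -/
def OmegaPow (μ : Fin n → Multiplicative ℤ) : (SymSeries (RepLoc n))ˣ :=
  ∏ i, Omega (algebraMap (RepRing n) (RepLoc n) (bb i)) ^ (μ i).toAdd

theorem OmegaPow_mul (μ ν : Fin n → Multiplicative ℤ) :
    OmegaPow (μ * ν) = OmegaPow μ * OmegaPow ν := by
  simp [OmegaPow, zpow_add, Finset.prod_mul_distrib]

theorem SymSeries.map_smul {A B : Type*} [CommRing A] [CommRing B] (φ : A →+* B) (x : A)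
    (f : SymSeries A) : SymSeries.map φ (x • f) = φ x • SymSeries.map φ f :=
  Subtype.ext (MvPowerSeries.ext fun m =>
    map_mul φ x (MvPowerSeries.coeff m (f : MvPowerSeries ℕ A)))

theorem map_omegaSeries {A B : Type*} [CommRing A] [CommRing B] (φ : A →+* B) (b : A) :
    SymSeries.map φ (omegaSeries b) = omegaSeries (φ b) :=
  Subtype.ext (MvPowerSeries.ext fun m => map_pow φ b m.degree)

theorem permLoc_bb (u : Equiv.Perm (Fin n)) (i : Fin n) :
    permLoc u (algebraMap (RepRing n) (RepLoc n) (bb i)) = algebraMap _ _ (bb (u i)) := by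
  simp [permLoc, bb, permRep_cc, permChar_chr]

theorem map_OmegaPow (u : Equiv.Perm (Fin n)) (μ : Fin n → Multiplicative ℤ) :
    Units.map (SymSeries.map (permLoc u)).toMonoidHom (OmegaPow μ) =
      OmegaPow (mulAutArrow u μ) := by
  have h1 : ∀ i, Units.map (SymSeries.map (permLoc u)).toMonoidHom
      (Omega (algebraMap (RepRing n) (RepLoc n) (bb i))) =
      Omega (algebraMap (RepRing n) (RepLoc n) (bb (u i))) := fun i => Units.ext (by
    rw [← permLoc_bb]
    exact map_omegaSeries _ _)
  rw [OmegaPow, OmegaPow, map_prod]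
  refine Fintype.prod_equiv u _ _ fun i => ?_
  rw [map_zpow]
  rw [h1]
  have h2 : mulAutArrow u μ (u i) = μ i := congrArg μ (u.symm_apply_apply i)
  rw [h2]

/-- `t_μ u` acts on `Λ̂` over `R(T)^Δ`: `u` permutes the `b_i` in the coefficients and `t_μ` is
multiplication by `Ω^μ`. -/
def weylAct : ExtWeyl n →* AddMonoid.End (SymSeries (RepLoc n)) where
  toFun w := (AddMonoidHom.mulLeft (OmegaPow w.left : SymSeries (RepLoc n))).comp
    (SymSeries.map (permLoc w.right)).toAddMonoidHom
  map_one' := by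
    refine AddMonoidHom.ext fun f => ?_
    have h : SymSeries.map (permLoc (1 : Equiv.Perm (Fin n))) f = f := by
      rw [map_one]
      exact Subtype.ext (MvPowerSeries.ext fun m => rfl)
    change (OmegaPow (1 : Fin n → Multiplicative ℤ) : SymSeries (RepLoc n)) *
      SymSeries.map (permLoc 1) f = f
    rw [h]
    simp [OmegaPow]
  map_mul' x y := by
    refine AddMonoidHom.ext fun f => ?_
    have h : SymSeries.map (permLoc (x.right * y.right)) f =
        SymSeries.map (permLoc x.right) (SymSeries.map (permLoc y.right) f) := by
      rw [map_mul]
      exact Subtype.ext (MvPowerSeries.ext fun m => rfl)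
    have h2 := congrArg Units.val (map_OmegaPow x.right y.left)
    change SymSeries.map (permLoc x.right) (OmegaPow y.left : SymSeries (RepLoc n)) = _ at h2
    change (OmegaPow (x.left * mulAutArrow x.right y.left) : SymSeries (RepLoc n)) *
      SymSeries.map (permLoc (x.right * y.right)) f = OmegaPow x.left *
      SymSeries.map (permLoc x.right) (OmegaPow y.left * SymSeries.map (permLoc y.right) f)
    rw [h, map_mul, h2, OmegaPow_mul, Units.val_mul, mul_assoc]

theorem weylAct_smul (y : ExtWeyl n) (x : RepLoc n) (f : SymSeries (RepLoc n)) :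
    weylAct y (x • f) = (y • x) • weylAct y f := by
  have h := SymSeries.map_smul (permLoc y.right) x f
  change (OmegaPow y.left : SymSeries (RepLoc n)) * SymSeries.map (permLoc y.right) (x • f) =
    permLoc y.right x • (OmegaPow y.left * SymSeries.map (permLoc y.right) f)
  rw [h, mul_smul_comm]

/-- The action of `K^Δ` on `Λ̂` over `R(T)^Δ`, with `R(T)^Δ` acting by multiplication. -/
def kAct : KDelta n →+* AddMonoid.End (SymSeries (RepLoc n)) :=
  SkewMonoidAlgebra.liftNCRingHom (Module.toAddMonoidEnd (RepLoc n) (SymSeries (RepLoc n))) weylAct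
    (fun {x y} => AddMonoidHom.ext fun f => (weylAct_smul y x f).symm)

/-- `a • f` for `a ∈ K^Δ`. -/
def act (a : KDelta n) (f : SymSeries (RepLoc n)) : SymSeries (RepLoc n) :=
  (kAct a : SymSeries (RepLoc n) →+ SymSeries (RepLoc n)) f

variable [NeZero n]

/-- The `K`-theoretic double `k`-Schur function `g_w = T_w (1)`. -/
def gFun (w : ExtWeyl n) : SymSeries (RepLoc n) := act (bigT w) 1

/-- The closed `K`-theoretic double `k`-Schur function `g̃_w = D_w (1)`. -/
def gClosed (w : ExtWeyl n) : SymSeries (RepLoc n) := act (bigD w) 1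

variable (n) in
/-- `Λ̂_{(n)} = K · 1`. -/
def hatLambdaN : Set (SymSeries (RepLoc n)) := {f | ∃ a ∈ nilHecke n, act a 1 = f}

end Action

/-! ## Expansion in powers of the `b_i` -/

section Expansion

variable (n : ℕ)

/-- `Λ[[b_0, …, b_{n-1}]]`. -/
abbrev BSym : Type := MvPowerSeries (Fin n) SymFun

variable {n}

/-- The unit `e^{-a_i} = 1 - b_i` of `ℤ[[b]]`. -/
def expUnit (i : Fin n) : (MvPowerSeries (Fin n) ℤ)ˣ where
  val := 1 - MvPowerSeries.X i
  inv := MvPowerSeries.invOfUnit (1 - MvPowerSeries.X i) 1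
  val_inv := MvPowerSeries.mul_invOfUnit _ _ (by simp)
  inv_val := MvPowerSeries.invOfUnit_mul _ _ (by simp)

/-- `R(T) → ℤ[[b]]`, `e^{-a_i} ↦ 1 - b_i`. -/
def expandRep : RepRing n →+* MvPowerSeries (Fin n) ℤ :=
  (AddMonoidAlgebra.lift ℤ (MvPowerSeries (Fin n) ℤ) (Fin n → ℤ)
    { toFun := fun lam => ((∏ i, expUnit i ^ (-lam.toAdd i) : (MvPowerSeries (Fin n) ℤ)ˣ) :
        MvPowerSeries (Fin n) ℤ)
      map_one' := by simp
      map_mul' := fun x y => by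
        simp [zpow_add, Finset.prod_mul_distrib, mul_comm] }).toRingHom

/-- `f ∈ Λ̂_{R(T)^Δ}` and `F ∈ Λ[[b]]` are the same series: `f` has coefficients in `R(T)`, and
expanding these in powers of the `b_i` gives `F`. -/
def SameSeries (f : SymSeries (RepLoc n)) (F : BSym n) : Prop :=
  ∃ f' : SymSeries (RepRing n), SymSeries.map (algebraMap (RepRing n) (RepLoc n)) f' = f ∧
    ∀ (m : ℕ →₀ ℕ) (d : Fin n →₀ ℕ),
      MvPowerSeries.coeff d (expandRep (MvPowerSeries.coeff m (f' : MvPowerSeries ℕ (RepRing n)))) =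
        MvPowerSeries.coeff m (MvPowerSeries.coeff d F : SymFun).1

/-- `⊖ b_i = -b_i / (1 - b_i)` in `Λ[[b]]`. -/
def ominusB (i : Fin n) : BSym n :=
  -MvPowerSeries.X i * MvPowerSeries.invOfUnit (1 - MvPowerSeries.X i) 1

/-- Morse's automorphism `ω̃` of `Λ`: `ω̃ (h_l) = ∑_{r=0}^{l-1} (l-1 choose r) e_{r+1}`, `l ≥ 1`. -/
def IsMorse (ω : SymFun ≃+* SymFun) : Prop :=
  ∀ l : ℕ, 1 ≤ l → ω (hh l) = ∑ r ∈ Finset.range l, (l - 1).choose r • ee (r + 1)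

/-- The automorphism `ι̂` of `Λ[[b]]`: it extends `ω̃`, maps `b_i` to `⊖ b_{n-1-i}`, and is
continuous for the `b`-adic topology (it does not lower the order in the `b_i`). -/
def IsIotaHat (ω : SymFun ≃+* SymFun) (ι : BSym n ≃+* BSym n) : Prop :=
  (∀ f : SymFun, ι (MvPowerSeries.C f) = MvPowerSeries.C (ω f)) ∧
  (∀ i : Fin n, ι (MvPowerSeries.X i) = ominusB i.rev) ∧
  ∀ F : BSym n, F.order ≤ (ι F).order

/-- `ι̂` maps the series `f` to the series `f'`. -/
def Maps (ι : BSym n ≃+* BSym n) (f f' : SymSeries (RepLoc n)) : Prop :=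
  ∃ F : BSym n, SameSeries f F ∧ SameSeries f' (ι F)

end Expansion

end KDoubleSchur

end

open KDoubleSchur

/-! The statements about `ι̂` rest on one identity: `ι̂ (a · 1) = ι(a) · 1` for every `a` in the
nil-Hecke ring (`maps_act_one`). The elements `a` such that acting by `a` on one side and by `ι(a)`
on the other preserves the relation `Maps` form a subring, so generators suffice. Conjugation by `τ`
permutes the `T_i` cyclically, so `R(T)`, `W̃` and `T_1` generate (`nilHecke_induction`), and no
`T_i` that involves a translation has to be treated.

On scalars, `e^{-a_i} = 1 - b_i` goes to `1 - ⊖b = (1 - b)⁻¹` with `b = b_{n-1-i}`, as `ι`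
prescribes. For translations, `Ω(b_i | y)` is the generating function `H` of the `h_l` at `b_i`.
Morse's map takes `E(-t) = H(t)⁻¹` to `H(⊖t)`, hence `H(t)` to `E(-⊖t)`. Since `⊖⊖v = v`, `ι̂` sends
`Ω(b_i | y)` to `Ω(b_{n-1-i} | y)⁻¹` (`iotaHat_substVar_hSeries`), which matches the star of a
translation. The operator `T_1` is a divided difference: `c(α_1) T_1 f = s_1 f - f`, and one cancels
`c(α_1)`. Here the quotient has to be shown to lie in `Λ[[b]]`, that is, to have coefficients of
bounded degree in `y`; this follows from additivity of orders in `ℤ[[b]]`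
(`exists_swapSeries_of_mul`).

`Λ` is the polynomial ring in the `e_l` (`evalEEquiv`), so Morse's map may be prescribed on them.
`⊖⊖t = t` makes it an involution. `ι̂` is Morse's map on coefficients followed by a substitution; it
is unique because a homomorphism that does not lower orders is determined on polynomials
(`ringHom_ext_of_order`).

An element of the Peterson subalgebra is supported on translations, hence acts as multiplication by
its value at `1`; this gives multiplicativity. Injectivity is the linear independence of the series
`Ω^μ`, which follows from Dedekind's theorem on characters (`multSeries_linearIndependent`). For
surjectivity, the elements that map the image of the Peterson subalgebra into itself form a subring
containing the generators (`surjOn_peterson`).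

Finally `ι(T_w) = T_{w*}` and `ι(D_w) = D_{w*}`. The star of a chosen reduced word need not be the
chosen word of `w*`, so independence of the reduced expression is needed: the braid relations for
`T_i` and `D_i`, and the word property (`word_property`), proved by realizing `W̃` as affine
permutations. -/

noncomputable section

namespace KDoubleSchur

/-! ## The affine permutation action of `W̃` and the word property -/

section WordProperty

variable {n : ℕ}

/-- `W̃` acts on `ℤ × Fin n`, the pair `(k, i)` standing for the integer `n k + i`, by affine
permutations. -/
instance affineAction : MulAction (ExtWeyl n) (ℤ × Fin n) where
  smul w x := (x.1 + (w.left (w.right x.2)).toAdd, w.right x.2)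
  one_smul x := by
    change (x.1 + _, _) = x
    simp
  mul_smul v w x := by
    change (x.1 + _, _) = (x.1 + (w.left (w.right x.2)).toAdd +
      (v.left (v.right (w.right x.2))).toAdd, v.right (w.right x.2))
    simp
    ring

theorem affine_smul_def (w : ExtWeyl n) (x : ℤ × Fin n) :
    w • x = (x.1 + (w.left (w.right x.2)).toAdd, w.right x.2) := rfl

theorem eq_of_affine_smul_eq {v w : ExtWeyl n} (h : ∀ x : ℤ × Fin n, v • x = w • x) : v = w := by
  have hr : ∀ i, v.right i = w.right i := fun i => congrArg Prod.snd (h (0, i))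
  refine extWeyl_ext (fun i => ?_) hr
  have := congrArg Prod.fst (h (0, v.right⁻¹ i))
  simp only [affine_smul_def, ← hr] at this
  simpa using this

theorem affine_smul_shift (w : ExtWeyl n) (x : ℤ × Fin n) (m : ℤ) :
    w • (x.1 + m, x.2) = ((w • x).1 + m, (w • x).2) := by
  simp only [affine_smul_def, Prod.mk.injEq, and_true]
  ring

/-- The integer represented by a pair. -/
def affPos (x : ℤ × Fin n) : ℤ := n * x.1 + x.2

theorem affPos_injective : Function.Injective (affPos (n := n)) := by
  rintro ⟨k, i⟩ ⟨l, j⟩ h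
  have hi : ((i : ℕ) : ℤ) < n := by exact_mod_cast i.2
  have hj : ((j : ℕ) : ℤ) < n := by exact_mod_cast j.2
  have hn : (n : ℤ) ≠ 0 := by omega
  simp only [affPos] at h
  have h1 : k = l := by
    have := congrArg (· / (n : ℤ)) h
    simpa [Int.mul_add_ediv_left _ _ hn, Int.ediv_eq_zero_of_lt, hi, hj] using this
  subst h1
  have : i = j := Fin.ext (by omega)
  rw [this]

variable [NeZero n]

theorem val_sub_one (i : Fin n) :
    (((i - 1 : Fin n) : ℕ) : ℤ) = if i = 0 then (n : ℤ) - 1 else (i : ℕ) - 1 := by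
  obtain ⟨m, rfl⟩ : ∃ m, n = m + 1 := ⟨n - 1, by have := NeZero.pos n; omega⟩
  rw [Fin.coe_sub_one]
  split_ifs with h
  · simp
  · have : (i : ℕ) ≠ 0 := fun h' => h (Fin.ext h')
    omega

theorem sub_one_ne (hn : 2 ≤ n) (i : Fin n) : i - 1 ≠ i := by
  intro h
  have h1 := val_sub_one i
  rw [h] at h1
  split_ifs at h1 with h2
  · subst h2; simp at h1; omega
  · omega

theorem simpleRefl_smul_left (hn : 2 ≤ n) (i : Fin n) (x : ℤ × Fin n) (hx : x.2 = i - 1) :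
    (simpleRefl i • x).2 = i ∧ affPos (simpleRefl i • x) = affPos x + 1 := by
  obtain ⟨k, j⟩ := x
  simp only at hx
  subst hx
  have h1 := val_sub_one i
  have h2 := sub_one_ne hn i
  refine ⟨by simp [affine_smul_def, simpleRefl], ?_⟩
  by_cases h0 : i = 0
  · subst h0
    simp only [if_true, zero_sub] at h1
    rw [zero_sub] at h2 ⊢
    simp [affine_smul_def, simpleRefl, affPos, h2.symm, h1]
    ring
  · rw [if_neg h0] at h1
    simp [affine_smul_def, simpleRefl, affPos, h0, h1]
    ring

theorem simpleRefl_smul_smul (i : Fin n) (x : ℤ × Fin n) :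
    simpleRefl i • simpleRefl i • x = x := by
  rw [smul_smul, simpleRefl_mul_self, one_smul]

theorem simpleRefl_smul_right (hn : 2 ≤ n) (i : Fin n) (x : ℤ × Fin n) (hx : x.2 = i) :
    (simpleRefl i • x).2 = i - 1 ∧ affPos (simpleRefl i • x) = affPos x - 1 := by
  have h : (simpleRefl i • x).2 = i - 1 := by simp [affine_smul_def, simpleRefl, hx]
  have := (simpleRefl_smul_left hn i _ h).2
  rw [simpleRefl_smul_smul] at this
  exact ⟨h, by omega⟩

theorem simpleRefl_smul_of_ne (i : Fin n) (x : ℤ × Fin n) (h : x.2 ≠ i - 1)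
    (h' : x.2 ≠ i) : simpleRefl i • x = x := by
  have e : Equiv.swap (i - 1) i x.2 = x.2 := Equiv.swap_apply_of_ne_of_ne h h'
  by_cases h0 : i = 0
  · subst h0
    simp only [zero_sub] at h e
    simp [affine_smul_def, simpleRefl, e, h, h']
  · simp [affine_smul_def, simpleRefl, e, h0]

/-- A simple reflection moves each position by at most one, and upwards only in the class `i - 1`.
Two positions can therefore change order only if they are neighbours that the reflection exchanges.
-/
theorem eq_simpleRefl_smul_of_inversion (hn : 2 ≤ n) {i : Fin n} {x y : ℤ × Fin n}
    (h : affPos x < affPos y) (h' : affPos (simpleRefl i • y) < affPos (simpleRefl i • x)) :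
    x.2 = i - 1 ∧ y = simpleRefl i • x := by
  have key : ∀ z : ℤ × Fin n, (z.2 = i - 1 ∧ affPos (simpleRefl i • z) = affPos z + 1) ∨
      (affPos z - 1 ≤ affPos (simpleRefl i • z) ∧ affPos (simpleRefl i • z) ≤ affPos z) := by
    intro z
    by_cases h1 : z.2 = i - 1
    · exact Or.inl ⟨h1, (simpleRefl_smul_left hn i z h1).2⟩
    by_cases h2 : z.2 = i
    · have := (simpleRefl_smul_right hn i z h2).2
      exact Or.inr ⟨by omega, by omega⟩
    · rw [simpleRefl_smul_of_ne i z h1 h2]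
      exact Or.inr ⟨by omega, le_rfl⟩
  have hx := key x
  have hy := key y
  have hx' : x.2 = i - 1 ∧ affPos (simpleRefl i • x) = affPos x + 1 := by
    rcases hx with hx | hx
    · exact hx
    · omega
  exact ⟨hx'.1, affPos_injective (by omega)⟩

/-- `r` is the affine reflection exchanging `a` and `b`. -/
def IsAffineRefl (r : ExtWeyl n) (a b : ℤ × Fin n) : Prop :=
  ∃ (g : ExtWeyl n) (t : Fin n) (p : ℤ × Fin n), p.2 = t - 1 ∧ r = g * simpleRefl t * g⁻¹ ∧
    g • p = a ∧ g • simpleRefl t • p = b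

theorem IsAffineRefl.conj {r : ExtWeyl n} {a b : ℤ × Fin n} (h : IsAffineRefl r a b)
    (v : ExtWeyl n) : IsAffineRefl (v * r * v⁻¹) (v • a) (v • b) := by
  obtain ⟨g, t, p, hp, rfl, rfl, rfl⟩ := h
  exact ⟨v * g, t, p, hp, by group, by rw [mul_smul], by rw [mul_smul]⟩

/-- An affine permutation commutes with shifts of the first coordinate, so its value at one point of
a residue class fixes it on the class. Outside the classes of `a` and its partner both reflections
are the identity. -/
theorem IsAffineRefl.eq_simpleRefl {r : ExtWeyl n} {a : ℤ × Fin n} {i : Fin n} (ha : a.2 = i - 1)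
    (h : IsAffineRefl r a (simpleRefl i • a)) : r = simpleRefl i := by
  obtain ⟨g, t, p, hp, rfl, rfl, hb⟩ := h
  have e1 : (g * simpleRefl t * g⁻¹) • g • p = simpleRefl i • g • p := by
    rw [← hb]; simp [mul_smul]
  have e2 : (g * simpleRefl t * g⁻¹) • simpleRefl i • g • p = simpleRefl i • simpleRefl i • g • p := by
    rw [simpleRefl_smul_smul, ← hb]
    simp [mul_smul, simpleRefl_smul_smul]
  have hshift : ∀ (v w : ExtWeyl n) (x y : ℤ × Fin n), v • x = w • x → y.2 = x.2 →
      v • y = w • y := by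
    intro v w x y h h'
    have : y = (x.1 + (y.1 - x.1), x.2) := by rw [← h']; ext <;> simp
    rw [this, affine_smul_shift, affine_smul_shift, h]
  refine eq_of_affine_smul_eq fun y => ?_
  have hb2 : (simpleRefl i • g • p).2 = i := by
    simp [affine_smul_def, simpleRefl] at ha ⊢; simp [ha]
  by_cases h1 : y.2 = i - 1
  · exact hshift _ _ _ _ e1 (by rw [h1, ha])
  by_cases h2 : y.2 = i
  · exact hshift _ _ _ _ e2 (by rw [h2, hb2])
  rw [simpleRefl_smul_of_ne i y h1 h2, mul_smul, mul_smul, simpleRefl_smul_of_ne, smul_inv_smul]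
  · rw [← hp]
    intro h3
    refine h1 ?_
    have := congrArg g.right h3
    rw [← ha]
    calc y.2 = (g • g⁻¹ • y).2 := by rw [smul_inv_smul]
      _ = _ := this
  · intro h3
    refine h2 ?_
    have h4 : (simpleRefl t • p).2 = t := by simp [affine_smul_def, simpleRefl, hp]
    rw [← h4] at h3
    have := congrArg g.right h3
    rw [← hb2, ← hb]
    calc y.2 = (g • g⁻¹ • y).2 := by rw [smul_inv_smul]
      _ = _ := this

theorem isAffineRefl_simpleRefl {i : Fin n} {a : ℤ × Fin n} (ha : a.2 = i - 1) :
    IsAffineRefl (simpleRefl i) a (simpleRefl i • a) :=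
  ⟨1, i, a, ha, by simp, by simp, by simp⟩

/-- The product of simple reflections along a word. -/
def wordProd (l : List (Fin n)) : ExtWeyl n := (l.map simpleRefl).prod

@[simp] theorem wordProd_nil : wordProd ([] : List (Fin n)) = 1 := rfl

@[simp] theorem wordProd_cons (i : Fin n) (l : List (Fin n)) :
    wordProd (i :: l) = simpleRefl i * wordProd l := by simp [wordProd]

@[simp] theorem wordProd_append (l l' : List (Fin n)) :
    wordProd (l ++ l') = wordProd l * wordProd l' := by simp [wordProd]

/-- The exchange property for an inverted pair. -/
theorem exists_eraseIdx_of_inversion (hn : 2 ≤ n) : ∀ (l : List (Fin n)) (r : ExtWeyl n)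
    (a b : ℤ × Fin n), IsAffineRefl r a b → affPos a < affPos b →
    affPos ((wordProd l)⁻¹ • b) < affPos ((wordProd l)⁻¹ • a) →
    ∃ j < l.length, r * wordProd l = wordProd (l.eraseIdx j)
  | [], r, a, b, _, hab, h => by
    simp at h; omega
  | s :: l, r, a, b, hr, hab, h => by
    -- If the first letter inverts the pair, then it exchanges the two positions, equals `r` and
    -- cancels. Otherwise the pair and `r` are moved by this letter and the search continues in the
    -- tail.
    by_cases hs : affPos (simpleRefl s • b) < affPos (simpleRefl s • a)
    · obtain ⟨h1, rfl⟩ := eq_simpleRefl_smul_of_inversion hn hab hs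
      refine ⟨0, by simp, ?_⟩
      rw [hr.eq_simpleRefl h1]
      simp [← mul_assoc, simpleRefl_mul_self]
    · have hne : affPos (simpleRefl s • a) ≠ affPos (simpleRefl s • b) := fun h' => by
        rw [(smul_left_cancel _ (affPos_injective h'))] at hab
        exact lt_irrefl _ hab
      have hinv : (simpleRefl s : ExtWeyl n)⁻¹ = simpleRefl s :=
        inv_eq_of_mul_eq_one_left (simpleRefl_mul_self s)
      obtain ⟨j, hj, h2⟩ := exists_eraseIdx_of_inversion hn l _ _ _ (hr.conj (simpleRefl s))
        (by omega) (by simpa [mul_smul, hinv] using h)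
      refine ⟨j + 1, by simpa using hj, ?_⟩
      rw [List.eraseIdx_cons_succ, wordProd_cons, wordProd_cons, ← h2, hinv]
      simp only [← mul_assoc, simpleRefl_mul_self, one_mul]

/-- A word is reduced if it is a shortest one for its product. -/
def IsReducedWord (l : List (Fin n)) : Prop :=
  ∀ l', wordProd l' = wordProd l → l.length ≤ l'.length

theorem IsReducedWord.tail {s : Fin n} {l : List (Fin n)} (h : IsReducedWord (s :: l)) :
    IsReducedWord l := fun l' h' => by
  have := h (s :: l') (by simp [h'])
  simpa using this

theorem IsReducedWord.of_append {s : Fin n} {l : List (Fin n)} (h : IsReducedWord (l ++ [s])) :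
    IsReducedWord l := fun l' h' => by
  have := h (l' ++ [s]) (by simp [h'])
  simpa using this

theorem IsReducedWord.of_eq {l l' : List (Fin n)} (h : IsReducedWord l)
    (h' : wordProd l' = wordProd l) (hl : l'.length = l.length) : IsReducedWord l' :=
  fun l'' h'' => hl ▸ h l'' (h''.trans h')

/-- A first letter of a reduced word is a descent. -/
theorem IsReducedWord.descent (hn : 2 ≤ n) {t : Fin n} {l : List (Fin n)}
    (h : IsReducedWord (t :: l)) {p : ℤ × Fin n} (hp : p.2 = t - 1) :
    affPos ((wordProd (t :: l))⁻¹ • simpleRefl t • p) < affPos ((wordProd (t :: l))⁻¹ • p) := by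
  have hinv : (simpleRefl t : ExtWeyl n)⁻¹ = simpleRefl t :=
    inv_eq_of_mul_eq_one_left (simpleRefl_mul_self t)
  simp only [wordProd_cons, mul_inv_rev, mul_smul, hinv, simpleRefl_smul_smul]
  -- Otherwise `l` already inverts the pair, and deleting a letter of `l` gives a word for
  -- `simpleRefl t * wordProd l` that is shorter than `t :: l`.
  by_contra hc
  have hlt := (simpleRefl_smul_left hn t p hp).2
  have hne : affPos ((wordProd l)⁻¹ • p) ≠ affPos ((wordProd l)⁻¹ • simpleRefl t • p) := fun h' => by
    rw [← (smul_left_cancel _ (affPos_injective h'))] at hlt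
    omega
  obtain ⟨j, hj, h2⟩ := exists_eraseIdx_of_inversion hn l _ _ _ (isAffineRefl_simpleRefl hp)
    (by omega) (by omega)
  have := h (l.eraseIdx j) (by rw [wordProd_cons, h2])
  rw [List.length_eraseIdx_of_lt hj, List.length_cons] at this
  omega

/-- The exchange property. -/
theorem IsReducedWord.exchange (hn : 2 ≤ n) {t : Fin n} {l l' : List (Fin n)}
    (h : IsReducedWord (t :: l')) (hl : wordProd l = wordProd (t :: l')) :
    ∃ j < l.length, wordProd (t :: l.eraseIdx j) = wordProd l := by
  have hp : ((0, t - 1) : ℤ × Fin n).2 = t - 1 := rfl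
  have h1 := h.descent hn hp
  rw [← hl] at h1
  have hlt := (simpleRefl_smul_left hn t _ hp).2
  obtain ⟨j, hj, h2⟩ := exists_eraseIdx_of_inversion hn l _ _ _ (isAffineRefl_simpleRefl hp)
    (by omega) h1
  refine ⟨j, hj, ?_⟩
  rw [wordProd_cons, ← h2, ← mul_assoc, simpleRefl_mul_self, one_mul]

end WordProperty

/-! ### Coxeter relations, uniqueness of reduced expressions, and length under the star involution.
-/

section WordProperty

variable {n : ℕ}

theorem star_star (w : ExtWeyl n) : starAut (starAut w) = w :=
  extWeyl_ext (fun i => by simp [starAut]) (fun i => by simp [starAut])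

variable [NeZero n]

theorem add_one_ne (hn : 2 ≤ n) (i : Fin n) : i + 1 ≠ i := by
  have := sub_one_ne hn (i + 1)
  rw [add_sub_cancel_right] at this
  exact this.symm

theorem add_one_ne_sub_one (hn : 3 ≤ n) (i : Fin n) : i + 1 ≠ i - 1 := by
  intro h
  have h0 := val_sub_one (i + 1)
  rw [add_sub_cancel_right] at h0
  have h1 := val_sub_one i
  rw [← h] at h1
  have e1 : i = 0 ↔ (i : ℕ) = 0 := by rw [Fin.ext_iff]; simp
  have e2 : i + 1 = 0 ↔ ((i + 1 : Fin n) : ℕ) = 0 := by rw [Fin.ext_iff]; simp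
  simp only [e1, e2] at h0 h1
  split_ifs at h0 h1 <;> omega

/-- The reflection `simpleRefl i` fixes both positions of a pair exchanged by `simpleRefl j`, so
conjugation by it leaves `simpleRefl j` unchanged. -/
theorem simpleRefl_comm (hn : 2 ≤ n) {i j : Fin n} (h : i ≠ j) (h1 : i + 1 ≠ j) (h2 : j + 1 ≠ i) :
    (simpleRefl i : ExtWeyl n) * simpleRefl j = simpleRefl j * simpleRefl i := by
  have ha : ((0, j - 1) : ℤ × Fin n).2 = j - 1 := rfl
  have hb := (simpleRefl_smul_left hn j _ ha).1
  have e := (isAffineRefl_simpleRefl ha).conj (simpleRefl i)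
  rw [simpleRefl_smul_of_ne i (0, j - 1), simpleRefl_smul_of_ne i (simpleRefl j • _)] at e
  · exact mul_inv_eq_iff_eq_mul.mp (e.eq_simpleRefl ha)
  · rw [hb]; exact fun h' => h2 (by rw [h']; simp)
  · rw [hb]; exact h.symm
  · simpa using h.symm
  · exact fun h' => h1 (by rw [← h']; simp)

/-- Conjugation by `simpleRefl i * simpleRefl (i + 1)` carries a pair exchanged by `simpleRefl i` to
one exchanged by `simpleRefl (i + 1)`, and a reflection is determined by such a pair. -/
theorem simpleRefl_braid (hn : 3 ≤ n) (i : Fin n) :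
    (simpleRefl i : ExtWeyl n) * simpleRefl (i + 1) * simpleRefl i =
      simpleRefl (i + 1) * simpleRefl i * simpleRefl (i + 1) := by
  have ha : ((0, i - 1) : ℤ × Fin n).2 = i - 1 := rfl
  have hb := (simpleRefl_smul_left (by omega) i _ ha).1
  have hb' : (simpleRefl i • ((0, i - 1) : ℤ × Fin n)).2 = i + 1 - 1 := by simpa using hb
  have hc := (simpleRefl_smul_left (by omega) (i + 1) _ hb').1
  have e := (isAffineRefl_simpleRefl ha).conj (simpleRefl i * simpleRefl (i + 1))
  rw [mul_smul, mul_smul, simpleRefl_smul_of_ne (i + 1) (0, i - 1),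
    simpleRefl_smul_of_ne i (simpleRefl (i + 1) • _)] at e
  · rw [mul_inv_eq_iff_eq_mul.mp (e.eq_simpleRefl hb'), mul_assoc]
  · rw [hc]; exact add_one_ne_sub_one hn i
  · rw [hc]; exact add_one_ne (by omega) i
  · simpa using sub_one_ne (by omega) i
  · exact (add_one_ne_sub_one hn i).symm

theorem simpleRefl_not_comm (hn : 3 ≤ n) (i : Fin n) :
    (simpleRefl i : ExtWeyl n) * simpleRefl (i + 1) ≠ simpleRefl (i + 1) * simpleRefl i := by
  intro h
  have h1 := congrArg (fun w : ExtWeyl n => (w • ((0, i - 1) : ℤ × Fin n)).2) h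
  have ha : ((0, i - 1) : ℤ × Fin n).2 = i - 1 := rfl
  have hb := (simpleRefl_smul_left (by omega) i _ ha).1
  have hb' : (simpleRefl i • ((0, i - 1) : ℤ × Fin n)).2 = i + 1 - 1 := by simpa using hb
  have hc := (simpleRefl_smul_left (by omega) (i + 1) _ hb').1
  simp only [mul_smul] at h1
  rw [hc, simpleRefl_smul_of_ne (i + 1) (0, i - 1), hb] at h1
  · exact add_one_ne (by omega) i h1.symm
  · simpa using sub_one_ne (by omega) i
  · exact (add_one_ne_sub_one hn i).symm

/-- For `n = 2` the group generated by the reflections is infinite dihedral. Applying `s` and then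
`t` to a position moves it up by a full period, whereas two descents would make the inverse
permutation strictly decrease along this chain, although it commutes with the period. -/
theorem not_two_descents (hn : n = 2) {s t : Fin n} (hst : s ≠ t) {l l' : List (Fin n)}
    (h : IsReducedWord (s :: l)) (h' : IsReducedWord (t :: l'))
    (hl : wordProd (s :: l) = wordProd (t :: l')) : False := by
  have hn2 : 2 ≤ n := hn.ge
  have hts : t = s - 1 ∧ s = t - 1 := by
    have h1 := val_sub_one s
    have h2 := val_sub_one t
    have h3 : (s : ℕ) ≠ t := fun h => hst (Fin.ext h)
    have := s.2
    have := t.2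
    have e1 : s = 0 ↔ (s : ℕ) = 0 := by rw [Fin.ext_iff]; simp
    have e2 : t = 0 ↔ (t : ℕ) = 0 := by rw [Fin.ext_iff]; simp
    simp only [e1, e2] at h1 h2
    constructor <;> apply Fin.ext <;> split_ifs at h1 h2 <;> omega
  have ha : ((0, s - 1) : ℤ × Fin n).2 = s - 1 := rfl
  have hb := simpleRefl_smul_left hn2 s _ ha
  have hb' : (simpleRefl s • ((0, s - 1) : ℤ × Fin n)).2 = t - 1 := hb.1.trans hts.2
  have hc := simpleRefl_smul_left hn2 t _ hb'
  have d1 := h.descent hn2 ha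
  have d2 := h'.descent hn2 hb'
  rw [← hl] at d2
  have e : simpleRefl t • simpleRefl s • ((0, s - 1) : ℤ × Fin n) = (0 + 1, s - 1) := by
    apply affPos_injective
    rw [hc.2, hb.2]
    simp only [affPos, hn]
    push_cast
    ring
  have e2 := affine_smul_shift (wordProd (s :: l))⁻¹ ((0, s - 1) : ℤ × Fin n) 1
  simp only at e2
  rw [e, e2] at d2
  have e3 : ∀ x : ℤ × Fin n, affPos (x.1 + 1, x.2) = affPos x + n := fun x => by
    simp only [affPos]; ring
  rw [e3] at d2
  omega

/-- Induction on length, with words sharing a first or last letter settled by the induction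
hypothesis. The exchange property moves the first letter of one word to the front of the other at
the cost of one letter; unless this is the last letter, a common last letter remains. Alternating
the two first letters `s` and `t` leaves words that begin with the two sides of a braid or
commutation relation and continue alike. -/
theorem word_property_aux {M : Type*} [Monoid M] (hn : 2 ≤ n) (f : Fin n → M)
    (hbraid : 3 ≤ n → ∀ i, f i * f (i + 1) * f i = f (i + 1) * f i * f (i + 1))
    (hcomm : ∀ i j, i ≠ j → i + 1 ≠ j → j + 1 ≠ i → f i * f j = f j * f i) :
    ∀ (q : ℕ) (l l' : List (Fin n)), l.length = q → l'.length = q → IsReducedWord l →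
      wordProd l = wordProd l' → (l.map f).prod = (l'.map f).prod := by
  intro q
  induction q with
  | zero =>
    intro l l' h h' _ _
    rw [List.length_eq_zero_iff.mp h, List.length_eq_zero_iff.mp h']
  | succ q ih =>
    have head : ∀ (s : Fin n) (l l' : List (Fin n)), l.length = q → l'.length = q →
        IsReducedWord (s :: l) → wordProd (s :: l) = wordProd (s :: l') →
        ((s :: l).map f).prod = ((s :: l').map f).prod := by
      intro s l l' hl hl' hr he
      rw [wordProd_cons, wordProd_cons, mul_left_cancel_iff] at he
      rw [List.map_cons, List.prod_cons, ih l l' hl hl' hr.tail he, List.map_cons, List.prod_cons]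
    have last : ∀ (s : Fin n) (l l' : List (Fin n)), l.length = q → l'.length = q →
        IsReducedWord (l ++ [s]) → wordProd (l ++ [s]) = wordProd (l' ++ [s]) →
        ((l ++ [s]).map f).prod = ((l' ++ [s]).map f).prod := by
      intro s l l' hl hl' hr he
      rw [wordProd_append, wordProd_append, mul_right_cancel_iff] at he
      rw [List.map_append, List.prod_append, ih l l' hl hl' hr.of_append he, List.map_append,
        List.prod_append]
    -- replacing the last letter of one word by the first letter of the other
    have step : ∀ (t : Fin n) (l l' : List (Fin n)), l.length = q + 1 → l'.length = q →
        IsReducedWord l → wordProd l = wordProd (t :: l') →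
        (l.map f).prod = ((t :: l').map f).prod ∨ (wordProd (t :: l.dropLast) = wordProd l ∧
          ((t :: l.dropLast).map f).prod = ((t :: l').map f).prod) := by
      intro t l l' hl hl' hr he
      have hr' : IsReducedWord (t :: l') := hr.of_eq he.symm (by simp [hl, hl'])
      obtain ⟨j, hj, h2⟩ := hr'.exchange hn he
      have hlen : (l.eraseIdx j).length = q := by rw [List.length_eraseIdx_of_lt hj]; omega
      have hred : IsReducedWord (t :: l.eraseIdx j) := hr.of_eq h2 (by simp [hlen, hl])
      have e1 := head t _ l' hlen hl' hred (h2.trans he)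
      obtain ⟨r, x, rfl⟩ : ∃ r x, l = r ++ [x] := by
        rcases List.eq_nil_or_concat l with rfl | ⟨r, x, h⟩
        · simp at hl
        · exact ⟨r, x, by simpa using h⟩
      simp only [List.length_append, List.length_singleton, Nat.add_right_cancel_iff] at hl hj
      rcases Nat.lt_or_ge j r.length with hjr | hjr
      · left
        rw [List.eraseIdx_append_of_lt_length hjr, ← List.cons_append] at e1 h2
        rw [← e1]
        refine last x _ _ hl ?_ hr h2.symm
        rw [List.length_cons, List.length_eraseIdx_of_lt hjr]; omega
      · right
        have : j = r.length := by omega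
        subst this
        rw [List.eraseIdx_append_of_length_le le_rfl, Nat.sub_self, List.eraseIdx_cons_zero,
          List.append_nil] at e1 h2
        rw [List.dropLast_concat]
        exact ⟨h2, e1⟩
    have adj : ∀ (s t : Fin n) (l l' : List (Fin n)), l.length = q → l'.length = q →
        IsReducedWord (s :: l) → wordProd (s :: l) = wordProd (t :: l') → s ≠ t →
        (simpleRefl s * simpleRefl t : ExtWeyl n) ≠ simpleRefl t * simpleRefl s →
        (simpleRefl s * simpleRefl t * simpleRefl s : ExtWeyl n) =
          simpleRefl t * simpleRefl s * simpleRefl t → f s * f t * f s = f t * f s * f t →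
        ((s :: l).map f).prod = ((t :: l').map f).prod := by
      intro s t l l' hl hl' hr he hst hne hg hf
      rcases step t (s :: l) l' (by simp [hl]) hl' hr he with h | ⟨h1, h2⟩
      · exact h
      have hr' := hr.of_eq h1 (by simp [hl])
      -- A second exchange yields a word beginning with `s, t, s`. If `l` has fewer than two
      -- letters, the products would force `s` and `t` to commute, which `hne` excludes.
      rcases step s (t :: (s :: l).dropLast) l (by simp [hl]) hl hr' h1 with h | ⟨h3, h4⟩
      · rw [← h, h2]
      rcases l with _ | ⟨z, l⟩
      · simp only [List.dropLast_singleton, wordProd_cons, wordProd_nil, mul_one] at h1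
        simp only [List.length_nil] at hl
        subst hl
        rw [List.length_eq_zero_iff.mp hl'] at he
        simp only [wordProd_cons, wordProd_nil, mul_one] at he
        exact absurd (by rw [he]) hne
      rcases l with _ | ⟨z', l⟩
      · simp only [List.dropLast_cons_cons, List.dropLast_singleton, wordProd_cons, wordProd_nil,
          mul_one] at h3
        exact absurd h3 hne
      rw [← h2, ← h4]
      simp only [List.dropLast_cons_cons] at h1 h3 h4 hr' ⊢
      have e1 : wordProd (t :: s :: t :: (z :: (z' :: l).dropLast).dropLast) =
          wordProd (s :: t :: s :: (z :: (z' :: l).dropLast).dropLast) := by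
        simp only [wordProd_cons, ← mul_assoc, hg]
      have e2 : ((t :: s :: t :: (z :: (z' :: l).dropLast).dropLast).map f).prod =
          ((s :: t :: s :: (z :: (z' :: l).dropLast).dropLast).map f).prod := by
        simp only [List.map_cons, List.prod_cons, ← mul_assoc, hf]
      rw [← e2]
      refine (head t _ _ ?_ ?_ hr' (e1.trans h3).symm).symm
      · simp at hl ⊢; omega
      · simp at hl ⊢; omega
    intro l l' hl hl' hr he
    rcases l with _ | ⟨s, l⟩
    · simp at hl
    rcases l' with _ | ⟨t, l'⟩
    · simp at hl'
    simp only [List.length_cons, Nat.add_right_cancel_iff] at hl hl'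
    by_cases hst : s = t
    · subst hst
      exact head s l l' hl hl' hr he
    rcases hn.eq_or_lt with h2 | h3
    · exact (not_two_descents h2.symm hst hr (hr.of_eq he.symm (by simp [hl, hl'])) he).elim
    by_cases hs : s + 1 = t
    · subst hs
      exact adj s (s + 1) l l' hl hl' hr he hst (simpleRefl_not_comm h3 s) (simpleRefl_braid h3 s)
        (hbraid h3 s)
    by_cases ht : t + 1 = s
    · subst ht
      exact adj (t + 1) t l l' hl hl' hr he hst (simpleRefl_not_comm h3 t).symm
        (simpleRefl_braid h3 t).symm (hbraid h3 t).symm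
    have hg := simpleRefl_comm hn hst hs ht
    have hf := hcomm s t hst hs ht
    rcases step t (s :: l) l' (by simp [hl]) hl' hr he with h | ⟨h1, h2⟩
    · exact h
    rcases l with _ | ⟨z, l⟩
    · simp only [List.length_nil] at hl
      subst hl
      rw [List.length_eq_zero_iff.mp hl'] at he
      simp only [wordProd_cons, wordProd_nil, mul_one] at he
      have h4 := congrArg (fun w : ExtWeyl n => (w • ((0, s - 1) : ℤ × Fin n)).2) he
      have ha : ((0, s - 1) : ℤ × Fin n).2 = s - 1 := rfl
      simp only [(simpleRefl_smul_left hn s _ ha).1] at h4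
      rw [simpleRefl_smul_of_ne t (0, s - 1)] at h4
      · exact absurd h4 (sub_one_ne hn s).symm
      · simpa using hst
      · rintro h5
        exact ht (by rw [← h5]; simp)
    rw [← h2]
    simp only [List.dropLast_cons_cons] at h1 h2 ⊢
    have e1 : wordProd (s :: t :: (z :: l).dropLast) = wordProd (t :: s :: (z :: l).dropLast) := by
      simp only [wordProd_cons, ← mul_assoc, hg]
    have e2 : ((s :: t :: (z :: l).dropLast).map f).prod =
        ((t :: s :: (z :: l).dropLast).map f).prod := by
      simp only [List.map_cons, List.prod_cons, ← mul_assoc, hf]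
    rw [← e2]
    exact head s _ _ hl (by simp at hl ⊢; omega) hr (h1.symm.trans e1.symm)

/-- The word property: a map on the simple reflections that satisfies the braid relations has the
same value on all reduced words of an element. -/
theorem word_property {M : Type*} [Monoid M] (hn : 2 ≤ n) (f : Fin n → M)
    (hbraid : 3 ≤ n → ∀ i, f i * f (i + 1) * f i = f (i + 1) * f i * f (i + 1))
    (hcomm : ∀ i j, i ≠ j → i + 1 ≠ j → j + 1 ≠ i → f i * f j = f j * f i)
    {l l' : List (Fin n)} (hl : IsReducedWord l) (hl' : IsReducedWord l')
    (h : wordProd l = wordProd l') : (l.map f).prod = (l'.map f).prod :=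
  word_property_aux hn f hbraid hcomm _ l l' rfl
    (le_antisymm (hl' l h) (hl l' h.symm)) hl h

/-- The degree `W̃ → ℤ`, which is `1` on `τ` and `0` on the simple reflections. -/
def weylDegree : ExtWeyl n →* Multiplicative ℤ where
  toFun w := ∏ i, w.left i
  map_one' := by simp
  map_mul' x y := by
    simp only [mul_left_apply, Finset.prod_mul_distrib]
    congr 1
    exact Equiv.prod_comp x.right⁻¹ fun i => y.left i

theorem weylDegree_simpleRefl (i : Fin n) : weylDegree (simpleRefl i : ExtWeyl n) = 1 := by
  apply Multiplicative.toAdd.injective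
  by_cases h0 : i = 0
  · subst h0
    simp [weylDegree, simpleRefl, toAdd_prod]
  · simp [weylDegree, simpleRefl, h0]

theorem weylDegree_tau : weylDegree (tau : ExtWeyl n) = Multiplicative.ofAdd 1 := by
  apply Multiplicative.toAdd.injective
  simp [weylDegree, tau, toAdd_prod]

theorem weylDegree_word (j : ℤ) (l : List (Fin n)) :
    weylDegree (word j l) = Multiplicative.ofAdd j := by
  have h : weylDegree (l.map simpleRefl).prod = 1 := by
    induction l with
    | nil => simp
    | cons a l ih => rw [List.map_cons, List.prod_cons, map_mul, ih, weylDegree_simpleRefl, one_mul]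
  rw [word, map_mul, map_zpow, weylDegree_tau, h, ← ofAdd_zsmul]
  simp

theorem len_le {w : ExtWeyl n} {j : ℤ} {l : List (Fin n)} (h : word j l = w) : len w ≤ l.length :=
  Nat.sInf_le ⟨j, l, h, rfl⟩

theorem isReducedWord_of_length_eq_len {w : ExtWeyl n} {j : ℤ} {l : List (Fin n)}
    (h : word j l = w) (hl : l.length = len w) : IsReducedWord l := fun l' h' => by
  rw [hl]
  refine len_le (j := j) ?_
  rw [← h, word, word]
  exact congrArg _ h'

theorem reducedWord_spec (w : ExtWeyl n) :
    word (reducedWord w).1 (reducedWord w).2 = w ∧ (reducedWord w).2.length = len w :=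
  (exists_reduced_word w).choose_spec

/-- Products along any two reduced expressions agree. -/
theorem reduced_expression_unique {M : Type*} [Monoid M] (hn : 2 ≤ n) (f : Fin n → M)
    (hbraid : 3 ≤ n → ∀ i, f i * f (i + 1) * f i = f (i + 1) * f i * f (i + 1))
    (hcomm : ∀ i j, i ≠ j → i + 1 ≠ j → j + 1 ≠ i → f i * f j = f j * f i)
    {w : ExtWeyl n} {j : ℤ} {l : List (Fin n)} (h : word j l = w) (hl : l.length = len w) :
    j = (reducedWord w).1 ∧ (l.map f).prod = ((reducedWord w).2.map f).prod := by
  obtain ⟨h', hl'⟩ := reducedWord_spec w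
  have hj : j = (reducedWord w).1 := by
    have := weylDegree_word j l
    rw [h, ← h', weylDegree_word] at this
    exact (Multiplicative.ofAdd.injective this).symm
  refine ⟨hj, word_property hn f hbraid hcomm (isReducedWord_of_length_eq_len h hl)
    (isReducedWord_of_length_eq_len h' hl') ?_⟩
  have e := h'.trans h.symm
  rw [← hj, word, word, mul_left_cancel_iff] at e
  exact e.symm

theorem star_word (j : ℤ) (l : List (Fin n)) :
    starAut (word j l) = word (-j) (l.map (- ·)) := by
  have h : starAut (l.map simpleRefl).prod = ((l.map (- ·)).map simpleRefl).prod := by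
    rw [map_list_prod]
    simp [star_simpleRefl, Function.comp_def]
  rw [word, word, map_mul, map_zpow, star_tau, h, inv_zpow, zpow_neg]

theorem len_star_le (w : ExtWeyl n) : len (starAut w) ≤ len w := by
  obtain ⟨h, hl⟩ := reducedWord_spec w
  have := len_le (star_word (reducedWord w).1 (reducedWord w).2).symm
  rwa [h, List.length_map, hl] at this

theorem len_star (w : ExtWeyl n) : len (starAut w) = len w :=
  le_antisymm (len_star_le w) (by simpa [star_star] using len_star_le (starAut w))

theorem IsGrassmannian.star {w : ExtWeyl n} (h : IsGrassmannian w) :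
    IsGrassmannian (starAut w) := fun i hi => by
  have := h (-i) (neg_ne_zero.mpr hi)
  rwa [← len_star, ← len_star (w * _), map_mul, star_simpleRefl, neg_neg] at this

end WordProperty

/-! ## Relations in the `K`-nil-Hecke ring -/

/-- Here `x`, `y`, `z` stand for the inverses of `c(α)`, `c(β)`, `c(α + β)`. The hypothesis `h`
merges the two leftover multiples of `s - 1` into `x * y * z`, and the outcome is symmetric under
exchanging `(x, s)` with `(y, t)` as soon as `s * t * s = t * s * t`. -/
theorem demazure_braid {K : Type*} [Ring K] {x y z s t : K} (hsx : s * x = (1 - x) * s)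
    (hsz : s * z = y * s) (hsy : s * y = z * s) (htx : t * x = z * t) (hs : s * s = 1)
    (hxy : Commute x y) (hyz : Commute y z)
    (h : x * y = z * (x + y - 1)) :
    x * (s - 1) * (y * (t - 1)) * (x * (s - 1)) =
      x * y * z * (s * t * s - s * t - t * s + t + s - 1) := by
  have h1 : (s - 1) * y = z * s - y := by rw [sub_mul, hsy, one_mul]
  have h2 : (t - 1) * x = z * t - x := by rw [sub_mul, htx, one_mul]
  have h3 : (z * s - y) * (z * t - x) =
      (y * z) * (s * t) - z * (1 - x) * s - (y * z) * t + x * y := by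
    calc (z * s - y) * (z * t - x) = z * (s * z) * t - z * (s * x) - y * z * t + y * x := by
          noncomm_ring
      _ = _ := by rw [hsz, hsx, ← hxy.eq, ← mul_assoc z y, ← hyz.eq]; noncomm_ring
  have h4 : s * (s - 1) = -(s - 1) := by rw [mul_sub, hs]; noncomm_ring
  have h5 : x * (z * (1 - x)) + x * (x * y) = x * y * z := by
    calc x * (z * (1 - x)) + x * (x * y) = x * (z * (1 - x)) + x * (z * (x + y - 1)) := by rw [h]
      _ = x * (z * y) := by noncomm_ring
      _ = _ := by rw [← hyz.eq, mul_assoc]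
  calc x * (s - 1) * (y * (t - 1)) * (x * (s - 1))
      = x * (((s - 1) * y) * ((t - 1) * x)) * (s - 1) := by noncomm_ring
    _ = x * ((y * z) * (s * t) - z * (1 - x) * s - (y * z) * t + x * y) * (s - 1) := by
        rw [h1, h2, h3]
    _ = x * y * z * (s * t * s - s * t - t * s + t) - x * (z * (1 - x)) * (s * (s - 1)) +
        x * (x * y) * (s - 1) := by noncomm_ring
    _ = x * y * z * (s * t * s - s * t - t * s + t) +
        (x * (z * (1 - x)) + x * (x * y)) * (s - 1) := by rw [h4]; noncomm_ring
    _ = _ := by rw [h5]; noncomm_ring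

section Relations

variable {n : ℕ}

theorem grp_mul_scal (w : ExtWeyl n) (x : RepLoc n) :
    grp w * scal x = scal (permLoc w.right x) * grp w := by
  change SkewMonoidAlgebra.single w (1 : RepLoc n) * SkewMonoidAlgebra.single 1 x =
    SkewMonoidAlgebra.single 1 (w • x) * SkewMonoidAlgebra.single w 1
  simp [SkewMonoidAlgebra.single_mul_single]

theorem isUnit_cc {i j : Fin n} (h : i ≠ j) :
    IsUnit (algebraMap (RepRing n) (RepLoc n) (cc (chr i - chr j))) :=
  IsLocalization.map_units (RepLoc n) (⟨_, Submonoid.subset_closure ⟨i, j, h, rfl⟩⟩ : rootSet n)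

/-- `c(a_i - a_j)⁻¹`. -/
def rootInv (i j : Fin n) : RepLoc n :=
  Ring.inverse (algebraMap (RepRing n) (RepLoc n) (cc (chr i - chr j)))

theorem cc_mul_rootInv {i j : Fin n} (h : i ≠ j) :
    algebraMap (RepRing n) (RepLoc n) (cc (chr i - chr j)) * rootInv i j = 1 :=
  Ring.mul_inverse_cancel _ (isUnit_cc h)

theorem eq_rootInv {i j : Fin n} (h : i ≠ j) {x : RepLoc n}
    (hx : algebraMap (RepRing n) (RepLoc n) (cc (chr i - chr j)) * x = 1) : x = rootInv i j :=
  (isUnit_cc h).mul_left_cancel (hx.trans (cc_mul_rootInv h).symm)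

theorem permLoc_algebraMap (u : Equiv.Perm (Fin n)) (r : RepRing n) :
    permLoc u (algebraMap _ (RepLoc n) r) = algebraMap _ _ (permRep u r) := by
  simp [permLoc]

theorem iotaLoc_algebraMap (r : RepRing n) :
    iotaLoc (algebraMap _ (RepLoc n) r) = algebraMap _ _ (iotaRep r) := by
  simp [iotaLoc]

theorem permLoc_rootInv (u : Equiv.Perm (Fin n)) {i j : Fin n} (h : i ≠ j) :
    permLoc u (rootInv i j) = rootInv (u i) (u j) := by
  apply eq_rootInv (u.injective.ne h)
  have := congrArg (permLoc u) (cc_mul_rootInv h)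
  rwa [map_mul, map_one, permLoc_algebraMap, permRep_cc, map_sub, permChar_chr, permChar_chr] at this

theorem iotaLoc_rootInv {i j : Fin n} (h : i ≠ j) :
    iotaLoc (rootInv i j) = rootInv j.rev i.rev := by
  apply eq_rootInv (Fin.rev_injective.ne h.symm)
  have := congrArg iotaLoc (cc_mul_rootInv h)
  rwa [map_mul, map_one, iotaLoc_algebraMap, iotaRep_cc, map_sub, iotaChar_chr, iotaChar_chr,
    sub_neg_eq_add, neg_add_eq_sub] at this

theorem expo_add (x y : Fin n → ℤ) : expo (x + y) = expo x * expo y := by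
  simp [expo, AddMonoidAlgebra.single_mul_single]

theorem expo_zero : expo (0 : Fin n → ℤ) = 1 := rfl

/-- This is `1 / (1 - x) + 1 / (1 - x⁻¹) = 1`. It gives `s_i c(α_i)⁻¹ = (1 - c(α_i)⁻¹) s_i`, the
source of the quadratic relation. -/
theorem rootInv_add_swap {i j : Fin n} (h : i ≠ j) : rootInv i j + rootInv j i = 1 := by
  have h1 := cc_mul_rootInv h
  have h2 := cc_mul_rootInv h.symm
  have h3 : expo (chr i - chr j) * expo (chr j - chr i) = 1 := by
    rw [← expo_add, ← expo_zero]; congr 1; abel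
  have h4 := congrArg (algebraMap (RepRing n) (RepLoc n)) h3
  rw [map_mul, map_one] at h4
  simp only [cc, map_sub, map_one] at h1 h2
  have h5 := isUnit_cc h
  have h6 := isUnit_cc h.symm
  refine (h5.mul h6).mul_left_cancel ?_
  simp only [cc, map_sub, map_one]
  linear_combination (1 - algebraMap (RepRing n) (RepLoc n) (expo (chr j - chr i))) * h1 +
    (1 - algebraMap (RepRing n) (RepLoc n) (expo (chr i - chr j))) * h2 - h4

/-- With `x = e^{a_i - a_j}` and `y = e^{a_j - a_k}`, clearing denominators leaves `(1 - y) + (1 -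
x) - (1 - x)(1 - y) = 1 - x y`. -/
theorem rootInv_mul {i j k : Fin n} (hij : i ≠ j) (hjk : j ≠ k) (hik : i ≠ k) :
    rootInv i j * rootInv j k = rootInv i k * (rootInv i j + rootInv j k - 1) := by
  have h1 := cc_mul_rootInv hij
  have h2 := cc_mul_rootInv hjk
  have h3 := cc_mul_rootInv hik
  have h4 : expo (chr i - chr k) = expo (chr i - chr j) * expo (chr j - chr k) := by
    rw [← expo_add]; congr 1; abel
  simp only [cc, map_sub, map_one, h4, map_mul] at h1 h2 h3
  set x := algebraMap (RepRing n) (RepLoc n) (expo (chr i - chr j))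
  set y := algebraMap (RepRing n) (RepLoc n) (expo (chr j - chr k))
  have e1 := isUnit_cc hij
  have e2 := isUnit_cc hjk
  have e3 := isUnit_cc hik
  refine ((e1.mul e2).mul e3).mul_left_cancel ?_
  simp only [cc, map_sub, map_one, h4, map_mul]
  change (1 - x) * (1 - y) * (1 - x * y) * _ = (1 - x) * (1 - y) * (1 - x * y) * _
  have e4 : (1 - x) * (1 - y) * (1 - x * y) * (rootInv i j * rootInv j k) = 1 - x * y := by
    linear_combination (1 - x * y) * ((1 - x) * rootInv i j * h2 + h1)
  rw [e4]
  linear_combination -(1 - x) * (1 - y) * (rootInv i j + rootInv j k - 1) * h3 -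
    (1 - y) * h1 - (1 - x) * h2

theorem iotaK_scal [NeZero n] (x : RepLoc n) : iotaK (scal x) = scal (iotaLoc x) := by
  change iotaK (SkewMonoidAlgebra.single 1 x) = _
  simp [iotaK, SkewMonoidAlgebra.liftNCRingHom]

theorem iotaK_grp [NeZero n] (w : ExtWeyl n) : iotaK (grp w) = grp (starAut w) := by
  change iotaK (SkewMonoidAlgebra.single w 1) = _
  simp [iotaK, SkewMonoidAlgebra.liftNCRingHom]

theorem scal_commute (x y : RepLoc n) : Commute (scal x : KDelta n) (scal y) :=
  (Commute.all x y).map scal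

theorem iotaRep_iotaRep (r : RepRing n) : iotaRep (iotaRep r) = r := by
  have : (iotaRep.comp iotaRep : RepRing n →+* RepRing n) = RingHom.id _ := by
    apply AddMonoidAlgebra.ringHom_ext <;> intros <;> simp [iotaRep, iotaChar]
    rfl
  exact RingHom.congr_fun this r

variable [NeZero n]

theorem demT_eq (i : Fin n) :
    demT i = scal (rootInv (i - 1) i) * (grp (simpleRefl i) - 1) := rfl

theorem simpleRefl_right (i : Fin n) :
    (simpleRefl i : ExtWeyl n).right = Equiv.swap (i - 1) i := by
  simp [simpleRefl]

theorem grp_simpleRefl_mul_rootInv (i : Fin n) {j k : Fin n} (h : j ≠ k) :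
    grp (simpleRefl i) * scal (rootInv j k) =
      scal (rootInv (Equiv.swap (i - 1) i j) (Equiv.swap (i - 1) i k)) * grp (simpleRefl i) := by
  rw [grp_mul_scal, simpleRefl_right, permLoc_rootInv _ h]

theorem grp_simpleRefl_mul_self (i : Fin n) :
    (grp (simpleRefl i) : KDelta n) * grp (simpleRefl i) = 1 := by
  rw [← map_mul, simpleRefl_mul_self, map_one]

theorem demT_sq (hn : 2 ≤ n) (i : Fin n) : demT i * demT i = -(demT i : KDelta n) := by
  have h := grp_simpleRefl_mul_rootInv i (sub_one_ne hn i)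
  rw [Equiv.swap_apply_left, Equiv.swap_apply_right,
    eq_sub_of_add_eq' (rootInv_add_swap (sub_one_ne hn i)), map_sub, map_one] at h
  have hs := grp_simpleRefl_mul_self i
  rw [demT_eq]
  set x : KDelta n := scal (rootInv (i - 1) i)
  set s : KDelta n := grp (simpleRefl i)
  calc x * (s - 1) * (x * (s - 1)) = x * (s * x - x) * (s - 1) := by noncomm_ring
    _ = x * (1 - x) * (s * s - s) - x * x * (s - 1) := by rw [h]; noncomm_ring
    _ = _ := by rw [hs]; noncomm_ring

theorem demT_braid (hn : 3 ≤ n) (i : Fin n) : demT i * demT (i + 1) * demT i =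
    (demT (i + 1) * demT i * demT (i + 1) : KDelta n) := by
  have h1 := sub_one_ne (by omega) i
  have h2 := add_one_ne (by omega) i
  have h3 := add_one_ne_sub_one hn i
  rw [demT_eq, demT_eq, add_sub_cancel_right]
  have hsx := grp_simpleRefl_mul_rootInv i h1
  have hsy := grp_simpleRefl_mul_rootInv i h2.symm
  have hsz := grp_simpleRefl_mul_rootInv i h3.symm
  have htx := grp_simpleRefl_mul_rootInv (i + 1) h1
  have hty := grp_simpleRefl_mul_rootInv (i + 1) h2.symm
  have htz := grp_simpleRefl_mul_rootInv (i + 1) h3.symm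
  rw [Equiv.swap_apply_left, Equiv.swap_apply_right,
    eq_sub_of_add_eq' (rootInv_add_swap h1), map_sub, map_one] at hsx
  rw [add_sub_cancel_right, Equiv.swap_apply_left, Equiv.swap_apply_right,
    eq_sub_of_add_eq' (rootInv_add_swap h2.symm), map_sub, map_one] at hty
  rw [Equiv.swap_apply_right, Equiv.swap_apply_of_ne_of_ne h3 h2] at hsy
  rw [Equiv.swap_apply_left, Equiv.swap_apply_of_ne_of_ne h3 h2] at hsz
  rw [add_sub_cancel_right, Equiv.swap_apply_left,
    Equiv.swap_apply_of_ne_of_ne h1 h3.symm] at htx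
  rw [add_sub_cancel_right, Equiv.swap_apply_right,
    Equiv.swap_apply_of_ne_of_ne h1 h3.symm] at htz
  have hm := congrArg (scal : RepLoc n →+* KDelta n) (rootInv_mul h1 h2.symm h3.symm)
  simp only [map_mul, map_sub, map_add, map_one] at hm
  have hb := congrArg (grp : ExtWeyl n →* KDelta n) (simpleRefl_braid hn i)
  simp only [map_mul] at hb
  have cm := fun x y : RepLoc n => scal_commute x y
  -- The second expansion has the roles of `i` and `i + 1` exchanged. The group braid relation then
  -- makes the two expansions equal.
  rw [demazure_braid hsx hsz hsy htx (grp_simpleRefl_mul_self i) (cm _ _) (cm _ _) hm,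
    demazure_braid hty htz htx hsy (grp_simpleRefl_mul_self _) (cm _ _) (cm _ _)
      (by rw [(cm _ _).eq, hm, add_comm (scal (rootInv (i - 1) i))]), hb,
    (cm (rootInv (i - 1) i) _).eq]
  congr 1
  abel

theorem demT_comm (hn : 2 ≤ n) {i j : Fin n} (h : i ≠ j) (h1 : i + 1 ≠ j) (h2 : j + 1 ≠ i) :
    (demT i : KDelta n) * demT j = demT j * demT i := by
  have e1 : j - 1 ≠ i := fun h => h1 (by rw [← h]; simp)
  have e2 : i - 1 ≠ j := fun h => h2 (by rw [← h]; simp)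
  have e3 : i - 1 ≠ j - 1 := by simpa using h
  have hs := grp_simpleRefl_mul_rootInv i (sub_one_ne hn j)
  have ht := grp_simpleRefl_mul_rootInv j (sub_one_ne hn i)
  rw [Equiv.swap_apply_of_ne_of_ne e3.symm e1, Equiv.swap_apply_of_ne_of_ne e2.symm h.symm] at hs
  rw [Equiv.swap_apply_of_ne_of_ne e3 e2, Equiv.swap_apply_of_ne_of_ne e1.symm h] at ht
  have hc := congrArg (grp : ExtWeyl n →* KDelta n) (simpleRefl_comm hn h h1 h2)
  simp only [map_mul] at hc
  have c1 : Commute (scal (rootInv (i - 1) i) : KDelta n) (demT j) :=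
    (scal_commute _ _).mul_right ((Commute.symm ht).sub_right (Commute.one_right _))
  have c2 : Commute (grp (simpleRefl i) - 1 : KDelta n) (demT j) :=
    ((show Commute _ _ from hs).mul_right ((show Commute _ _ from hc).sub_right
      (Commute.one_right _))).sub_left (Commute.one_left _)
  exact c1.mul_left c2

/-- Because `T_i² = -T_i`, the expansion of `(x + 1)(y + 1)(x + 1)` reduces to `x y x + x y + y x +
x + y + 1`, so the braid relation passes from `T_i` to `D_i`. -/
theorem demD_braid (hn : 3 ≤ n) (i : Fin n) : demD i * demD (i + 1) * demD i =
    (demD (i + 1) * demD i * demD (i + 1) : KDelta n) := by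
  have h1 := demT_sq (by omega) i
  have h2 := demT_sq (by omega) (i + 1)
  have h3 := demT_braid hn i
  simp only [demD]
  set x : KDelta n := demT i
  set y : KDelta n := demT (i + 1)
  calc (x + 1) * (y + 1) * (x + 1) = x * y * x + x * x + x * y + y * x + x + x + y + 1 := by
        noncomm_ring
    _ = y * x * y + y * y + x * y + y * x + y + y + x + 1 := by rw [h1, h2, h3]; abel
    _ = _ := by noncomm_ring

theorem demD_comm (hn : 2 ≤ n) {i j : Fin n} (h : i ≠ j) (h1 : i + 1 ≠ j) (h2 : j + 1 ≠ i) :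
    (demD i : KDelta n) * demD j = demD j * demD i :=
  ((show Commute _ _ from demT_comm hn h h1 h2).add_left (Commute.one_left _)).add_right
    (Commute.one_right _)

theorem iotaK_demT (hn : 2 ≤ n) (i : Fin n) : iotaK (demT i) = (demT (-i) : KDelta n) := by
  rw [demT_eq, map_mul, map_sub, map_one, iotaK_scal, iotaK_grp, star_simpleRefl,
    iotaLoc_rootInv (sub_one_ne hn i), demT_eq, rev_eq_sub, rev_eq_sub]
  congr 3
  abel

theorem iotaK_demD (hn : 2 ≤ n) (i : Fin n) : iotaK (demD i) = (demD (-i) : KDelta n) := by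
  rw [demD, map_add, map_one, iotaK_demT hn, demD]

/-- The star involution carries the chosen reduced word of `w` to a reduced word of `w*`, usually
not the chosen one. The braid relations for `f` remove the difference. -/
theorem iotaK_word_prod {f : Fin n → KDelta n} (hf : ∀ i, iotaK (f i) = f (-i)) (hn : 2 ≤ n)
    (hbraid : 3 ≤ n → ∀ i, f i * f (i + 1) * f i = f (i + 1) * f i * f (i + 1))
    (hcomm : ∀ i j, i ≠ j → i + 1 ≠ j → j + 1 ≠ i → f i * f j = f j * f i) (w : ExtWeyl n) :
    iotaK (grp (tau ^ (reducedWord w).1) * ((reducedWord w).2.map f).prod) =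
      grp (tau ^ (reducedWord (starAut w)).1) * ((reducedWord (starAut w)).2.map f).prod := by
  obtain ⟨h, hl⟩ := reducedWord_spec w
  have h2 := star_word (reducedWord w).1 (reducedWord w).2
  rw [h] at h2
  obtain ⟨e1, e2⟩ := reduced_expression_unique hn f hbraid hcomm h2.symm
    (by rw [List.length_map, hl, len_star])
  rw [map_mul, iotaK_grp, map_zpow, star_tau, inv_zpow, ← zpow_neg, e1, ← e2, map_list_prod,
    List.map_map, List.map_map]
  congr 3
  exact funext hf

theorem iotaK_bigT (hn : 2 ≤ n) (w : ExtWeyl n) : iotaK (bigT w) = bigT (starAut w) :=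
  iotaK_word_prod (iotaK_demT hn) hn demT_braid (fun _ _ => demT_comm hn) w

theorem iotaK_bigD (hn : 2 ≤ n) (w : ExtWeyl n) : iotaK (bigD w) = bigD (starAut w) :=
  iotaK_word_prod (iotaK_demD hn) hn demD_braid (fun _ _ => demD_comm hn) w

/-! ### Elements of the nil-Hecke ring -/

theorem scalRep_mem (r : RepRing n) : scalRep r ∈ nilHecke n :=
  Subring.subset_closure (Or.inl (Or.inl ⟨r, rfl⟩))

theorem demT_mem (i : Fin n) : demT i ∈ nilHecke n :=
  Subring.subset_closure (Or.inl (Or.inr ⟨i, rfl⟩))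

theorem grp_tau_zpow_mem (j : ℤ) : grp (tau ^ j) ∈ nilHecke n :=
  Subring.subset_closure (Or.inr ⟨j, rfl⟩)

theorem demD_mem (i : Fin n) : demD i ∈ nilHecke n := add_mem (demT_mem i) (one_mem _)

theorem bigT_mem (w : ExtWeyl n) : bigT w ∈ nilHecke n :=
  mul_mem (grp_tau_zpow_mem _) (list_prod_mem fun x hx => by
    obtain ⟨i, _, rfl⟩ := List.mem_map.mp hx; exact demT_mem i)

theorem bigD_mem (w : ExtWeyl n) : bigD w ∈ nilHecke n :=
  mul_mem (grp_tau_zpow_mem _) (list_prod_mem fun x hx => by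
    obtain ⟨i, _, rfl⟩ := List.mem_map.mp hx; exact demD_mem i)

theorem scal_cc_mul_demT (hn : 2 ≤ n) (i : Fin n) :
    scalRep (cc (simpleRoot i)) * demT i = (grp (simpleRefl i) - 1 : KDelta n) := by
  have := congrArg (scal : RepLoc n →+* KDelta n) (cc_mul_rootInv (sub_one_ne hn i))
  rw [map_mul, map_one] at this
  rw [demT_eq, ← mul_assoc]
  change scal _ * _ * _ = _
  rw [simpleRoot, this, one_mul]

theorem grp_simpleRefl_mem (hn : 2 ≤ n) (i : Fin n) : grp (simpleRefl i) ∈ nilHecke n := by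
  have := add_mem (mul_mem (scalRep_mem (cc (simpleRoot i))) (demT_mem i)) (one_mem (nilHecke n))
  rwa [scal_cc_mul_demT hn, sub_add_cancel] at this

theorem grp_mem (hn : 2 ≤ n) (w : ExtWeyl n) : grp w ∈ nilHecke n := by
  obtain ⟨j, l, rfl⟩ := exists_word w
  rw [word, map_mul, map_list_prod]
  exact mul_mem (grp_tau_zpow_mem j) (list_prod_mem fun x hx => by
    obtain ⟨y, hy, rfl⟩ := List.mem_map.mp hx
    obtain ⟨i, _, rfl⟩ := List.mem_map.mp hy
    exact grp_simpleRefl_mem hn i)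

theorem iotaK_scalRep (r : RepRing n) : iotaK (scalRep r) = (scalRep (iotaRep r) : KDelta n) := by
  rw [scalRep, RingHom.comp_apply, iotaK_scal, iotaLoc_algebraMap]
  rfl

theorem iotaK_mem_nilHecke (hn : 2 ≤ n) {x : KDelta n} (hx : x ∈ nilHecke n) :
    iotaK x ∈ nilHecke n := by
  have : nilHecke n ≤ (nilHecke n).comap iotaK := by
    refine Subring.closure_le.mpr ?_
    rintro _ ((⟨r, rfl⟩ | ⟨i, rfl⟩) | ⟨j, rfl⟩)
    · simpa [iotaK_scalRep] using scalRep_mem _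
    · simpa [iotaK_demT hn] using demT_mem _
    · simpa [iotaK_grp, -map_zpow] using grp_mem hn _
  exact this hx

theorem iotaK_mem_peterson (hn : 2 ≤ n) {x : KDelta n} (hx : x ∈ peterson n) :
    iotaK x ∈ peterson n := by
  refine ⟨iotaK_mem_nilHecke hn hx.1, ?_⟩
  rintro _ ⟨r, rfl⟩
  have := congrArg iotaK (hx.2 _ ⟨iotaRep r, rfl⟩)
  rwa [map_mul, map_mul, iotaK_scalRep, iotaRep_iotaRep] at this

/-- Conjugation by `τ` permutes the `T_i` cyclically. -/
theorem grp_tau_mul_demT (hn : 2 ≤ n) (i : Fin n) :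
    grp tau * demT i = (demT (i + 1) * grp tau : KDelta n) := by
  have h : (tau : ExtWeyl n).right = Equiv.addRight 1 := by simp [tau]
  have hc := congrArg (grp : ExtWeyl n →* KDelta n) (tau_mul_simpleRefl i)
  simp only [map_mul] at hc
  rw [demT_eq, demT_eq, ← mul_assoc, grp_mul_scal, h, permLoc_rootInv _ (sub_one_ne hn i),
    Equiv.coe_addRight]
  simp only [sub_add_cancel, add_sub_cancel_right, mul_assoc, mul_sub, hc, sub_mul, mul_one]

/-- `K` is generated by `R(T)`, `W̃` and `T_i` for one `i`. -/
theorem nilHecke_induction (hn : 2 ≤ n) (i : Fin n) (S : Subring (KDelta n))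
    (h1 : ∀ r, scalRep r ∈ S) (h2 : ∀ w, grp w ∈ S) (h3 : demT i ∈ S) : nilHecke n ≤ S := by
  -- Induction on the cyclic distance from `i` to `j`: each step is a conjugation by `τ`.
  have key : ∀ (m : ℕ) (j : Fin n), ((j - i : Fin n) : ℕ) = m → demT j ∈ S := by
    intro m
    induction m with
    | zero =>
      intro j hj
      have : j - i = 0 := Fin.ext (by simpa using hj)
      rwa [sub_eq_zero.mp this]
    | succ m ih =>
      intro j hj
      have h0 := val_sub_one (j - i)
      rw [if_neg (fun h => by rw [h] at hj; simp at hj), hj] at h0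
      have := mul_mem (mul_mem (h2 tau) (ih (j - 1) (by rw [sub_right_comm]; omega))) (h2 tau⁻¹)
      rwa [grp_tau_mul_demT hn, mul_assoc, ← map_mul, mul_inv_cancel, map_one, mul_one,
        sub_add_cancel] at this
  refine Subring.closure_le.mpr ?_
  rintro _ ((⟨r, rfl⟩ | ⟨j, rfl⟩) | ⟨j, rfl⟩)
  · exact h1 r
  · exact key _ j rfl
  · exact h2 _

end Relations

/-! ## Multiplicative series -/

section Multiplicative

variable {A : Type*} [CommRing A]

/-- The series `∏_j p(y_j)`, for a power series `p` with constant term `1`. -/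
def multSeries (p : PowerSeries A) : MvPowerSeries ℕ A :=
  fun m => m.prod fun _ k => PowerSeries.coeff k p

theorem coeff_multSeries (p : PowerSeries A) (m : ℕ →₀ ℕ) :
    MvPowerSeries.coeff m (multSeries p) = m.prod fun _ k => PowerSeries.coeff k p := rfl

theorem multSeries_one : multSeries (1 : PowerSeries A) = 1 := by
  classical
  refine MvPowerSeries.ext fun m => ?_
  rw [coeff_multSeries, MvPowerSeries.coeff_one]
  split_ifs with h
  · simp [h]
  · obtain ⟨j, hj⟩ := Finsupp.support_nonempty_iff.mpr h
    exact Finset.prod_eq_zero hj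
      ((PowerSeries.coeff_one _).trans (if_neg (Finsupp.mem_support_iff.mp hj)))

/-- Multiplying out the product, over the variables of `m`, of the coefficients of `p * q` means
choosing a splitting of every exponent of `m`; such families are the splittings of `m` itself. -/
theorem multSeries_mul {p q : PowerSeries A} (hp : PowerSeries.coeff 0 p = 1)
    (hq : PowerSeries.coeff 0 q = 1) : multSeries (p * q) = multSeries p * multSeries q := by
  classical
  refine MvPowerSeries.ext fun m => ?_
  rw [coeff_multSeries, MvPowerSeries.coeff_mul, Finsupp.prod]
  simp only [PowerSeries.coeff_mul, coeff_multSeries]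
  rw [Finset.prod_sum]
  -- The constant term `1` allows the product to run over the support of `m` instead of the smaller
  -- support of `x`.
  have key : ∀ (r : PowerSeries A), PowerSeries.coeff 0 r = 1 → ∀ x : ℕ →₀ ℕ, x ≤ m →
      (x.prod fun _ k => PowerSeries.coeff k r) =
        ∏ j ∈ m.support.attach, PowerSeries.coeff (x j) r := by
    intro r hr x hx
    rw [Finset.prod_attach m.support fun j => PowerSeries.coeff (x j) r]
    exact Finsupp.prod_of_support_subset _ (Finsupp.support_mono hx) _ fun j _ => hr
  symm
  refine Finset.sum_bij' (fun x _ => fun j _ => (x.1 j, x.2 j))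
    (fun g _ => (Finsupp.onFinset m.support (fun j => if h : j ∈ m.support then (g j h).1 else 0)
        fun j hj => by by_contra h; simp only [dif_neg h] at hj; exact hj rfl,
      Finsupp.onFinset m.support (fun j => if h : j ∈ m.support then (g j h).2 else 0)
        fun j hj => by by_contra h; simp only [dif_neg h] at hj; exact hj rfl)) ?_ ?_ ?_ ?_ ?_
  · intro x hx
    rw [Finset.HasAntidiagonal.mem_antidiagonal] at hx
    rw [Finset.mem_pi]
    intro j _
    rw [Finset.HasAntidiagonal.mem_antidiagonal, ← hx]
    rfl
  · intro g hg
    rw [Finset.HasAntidiagonal.mem_antidiagonal]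
    ext j
    by_cases h : j ∈ m.support
    · have := Finset.HasAntidiagonal.mem_antidiagonal.mp (Finset.mem_pi.mp hg j h)
      simpa [Finsupp.mem_support_iff.mp h] using this
    · have h' := Finsupp.notMem_support_iff.mp h
      simp [h']
  · intro x hx
    rw [Finset.HasAntidiagonal.mem_antidiagonal] at hx
    have h0 : ∀ j, j ∉ m.support → x.1 j = 0 ∧ x.2 j = 0 := by
      intro j hj
      rw [← hx] at hj
      simpa using hj
    ext j
    · by_cases h : j ∈ m.support
      · simp [Finsupp.mem_support_iff.mp h]
      · simp [Finsupp.notMem_support_iff.mp h, (h0 j h).1]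
    · by_cases h : j ∈ m.support
      · simp [Finsupp.mem_support_iff.mp h]
      · simp [Finsupp.notMem_support_iff.mp h, (h0 j h).2]
  · intro g hg
    funext j h
    simp [Finsupp.mem_support_iff.mp h]
  · intro x hx
    rw [Finset.HasAntidiagonal.mem_antidiagonal] at hx
    rw [key p hp x.1 (by rw [← hx]; exact le_self_add),
      key q hq x.2 (by rw [← hx]; exact le_add_self), ← Finset.prod_mul_distrib]

theorem multSeries_geom (b : A) :
    multSeries (PowerSeries.mk fun k => b ^ k) = (omegaSeries b : MvPowerSeries ℕ A) := by
  refine MvPowerSeries.ext fun m => ?_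
  rw [coeff_multSeries]
  simp only [PowerSeries.coeff_mk]
  exact (Finset.prod_pow_eq_pow_sum m.support m b)

/-- `∏_j (1 - b y_j)`. -/
def eSeries (b : A) : MvPowerSeries ℕ A := multSeries (1 - PowerSeries.C b * PowerSeries.X)

theorem geom_mul (b : A) : (PowerSeries.mk fun k => b ^ k) * (1 - PowerSeries.C b * PowerSeries.X) =
    1 := by
  ext k
  rw [mul_sub, mul_one, mul_left_comm, ← mul_assoc]
  rcases k with _ | k
  · simp
  · simp [mul_assoc, PowerSeries.coeff_succ_mul_X, pow_succ', PowerSeries.coeff_one]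

theorem omegaSeries_mul_eSeries (b : A) :
    (omegaSeries b : MvPowerSeries ℕ A) * eSeries b = 1 := by
  rw [eSeries, ← multSeries_geom, ← multSeries_mul (by simp) (by simp), geom_mul, multSeries_one]

theorem coeff_eSeries (b : A) (m : ℕ →₀ ℕ) [Decidable (∀ i, m i ≤ 1)] :
    MvPowerSeries.coeff m (eSeries b) = if ∀ i, m i ≤ 1 then (-b) ^ m.degree else 0 := by
  rw [eSeries, coeff_multSeries]
  have h1 : ∀ k, PowerSeries.coeff k (1 - PowerSeries.C b * PowerSeries.X) =
      if k ≤ 1 then (-b) ^ k else 0 := by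
    intro k
    rcases k with _ | _ | k <;>
      simp [PowerSeries.coeff_succ_mul_X, PowerSeries.coeff_one, PowerSeries.coeff_C]
  simp only [h1]
  split_ifs with h
  · rw [Finsupp.prod, Finset.prod_congr rfl fun i _ => if_pos (h i)]
    exact Finset.prod_pow_eq_pow_sum m.support m (-b)
  · push Not at h
    obtain ⟨i, hi⟩ := h
    exact Finset.prod_eq_zero (i := i) (Finsupp.mem_support_iff.mpr (by omega))
      (if_neg (by omega))

theorem map_eSeries {B : Type*} [CommRing B] (φ : A →+* B) (b : A) :
    MvPowerSeries.map φ (eSeries b) = eSeries (φ b) := by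
  classical
  refine MvPowerSeries.ext fun m => ?_
  rw [MvPowerSeries.coeff_map, coeff_eSeries, coeff_eSeries]
  split_ifs <;> simp

end Multiplicative

/-! ## Interchanging the two kinds of variables -/

section Interchange

variable {σ : Type*}

/-- A power series over `Λ` as a power series in `y`. -/
def swapFun (F : MvPowerSeries σ SymFun) : MvPowerSeries ℕ (MvPowerSeries σ ℤ) :=
  fun m => (fun d => MvPowerSeries.coeff m (MvPowerSeries.coeff d F : SymFun).1 :
    MvPowerSeries σ ℤ)

theorem coeff_coeff_swapFun (F : MvPowerSeries σ SymFun) (m : ℕ →₀ ℕ) (d : σ →₀ ℕ) :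
    MvPowerSeries.coeff d (MvPowerSeries.coeff m (swapFun F)) =
      MvPowerSeries.coeff m (MvPowerSeries.coeff d F).1 := rfl

/-- `swapFun` as a ring homomorphism. -/
def swapSeries : MvPowerSeries σ SymFun →+* MvPowerSeries ℕ (MvPowerSeries σ ℤ) where
  toFun := swapFun
  map_one' := by
    classical
    refine MvPowerSeries.ext fun m => MvPowerSeries.ext fun d => ?_
    rw [coeff_coeff_swapFun, MvPowerSeries.coeff_one, MvPowerSeries.coeff_one]
    split_ifs with h1 h2 h2
    · simp [h1, h2]
    · simp [MvPowerSeries.coeff_one, h2]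
    · simp [MvPowerSeries.coeff_one, h1]
    · simp
  map_zero' := rfl
  map_add' F G := rfl
  map_mul' F G := by
    classical
    refine MvPowerSeries.ext fun m => MvPowerSeries.ext fun d => ?_
    rw [coeff_coeff_swapFun, MvPowerSeries.coeff_mul, MvPowerSeries.coeff_mul, map_sum]
    simp only [AddSubmonoidClass.coe_finsetSum, map_sum, MvPowerSeries.coeff_mul, Subring.coe_mul,
      coeff_coeff_swapFun]
    exact Finset.sum_comm

theorem coeff_coeff_swapSeries (F : MvPowerSeries σ SymFun) (m : ℕ →₀ ℕ) (d : σ →₀ ℕ) :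
    MvPowerSeries.coeff d (MvPowerSeries.coeff m (swapSeries F)) =
      MvPowerSeries.coeff m (MvPowerSeries.coeff d F).1 := rfl

theorem swapSeries_injective : Function.Injective (swapSeries (σ := σ)) := by
  intro F G h
  refine MvPowerSeries.ext fun d => Subtype.ext (MvPowerSeries.ext fun m => ?_)
  rw [← coeff_coeff_swapSeries, h, coeff_coeff_swapSeries]

/-- `F ↦ F(b_i)`. -/
def substVar (A : Type*) [CommRing A] (i : σ) : PowerSeries A →+* MvPowerSeries σ A :=
  (PowerSeries.substAlgHom (R := A) (S := A) (PowerSeries.HasSubst.X i)).toRingHom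

theorem substVar_apply {A : Type*} [CommRing A] (i : σ) (f : PowerSeries A) :
    substVar A i f = f.subst (MvPowerSeries.X i : MvPowerSeries σ A) :=
  congrFun (PowerSeries.coe_substAlgHom _) f

theorem substVar_X {A : Type*} [CommRing A] (i : σ) :
    substVar A i PowerSeries.X = MvPowerSeries.X i := by
  rw [substVar_apply, PowerSeries.subst_X (PowerSeries.HasSubst.X i)]

/-- Substituting one variable only relocates coefficients, so it commutes with reading off a
coefficient in `y`. This reduces the evaluation of `H` and `E` at `b_i` to one variable. -/
theorem swapSeries_substVar (i : σ) (F : PowerSeries SymFun) :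
    swapSeries (substVar SymFun i F) =
      MvPowerSeries.map (substVar ℤ i) (swapSeries (σ := Unit) F) := by
  classical
  refine MvPowerSeries.ext fun m => MvPowerSeries.ext fun d => ?_
  rw [coeff_coeff_swapSeries, MvPowerSeries.coeff_map, substVar_apply, substVar_apply,
    PowerSeries.coeff_subst_single, PowerSeries.coeff_subst_single]
  split_ifs
  · rfl
  · rfl

/-- `H(t) = ∑ h_l t^l`. -/
def hSeries : PowerSeries SymFun := PowerSeries.mk hh

/-- `E(-t) = ∑ e_l (-t)^l`. -/
def eNegSeries : PowerSeries SymFun := PowerSeries.mk fun l => (-1) ^ l * ee l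

theorem coeff_hh (l : ℕ) (m : ℕ →₀ ℕ) :
    MvPowerSeries.coeff m (hh l).1 = if m.degree = l then 1 else 0 := rfl

open Classical in
theorem coeff_ee (l : ℕ) (m : ℕ →₀ ℕ) :
    MvPowerSeries.coeff m (ee l).1 = if m.degree = l ∧ ∀ i, m i ≤ 1 then 1 else 0 := rfl

theorem swapSeries_hSeries : swapSeries (σ := Unit) hSeries =
    (omegaSeries (PowerSeries.X : PowerSeries ℤ) : MvPowerSeries ℕ (PowerSeries ℤ)) := by
  refine MvPowerSeries.ext fun m => PowerSeries.ext fun k => ?_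
  change MvPowerSeries.coeff m (PowerSeries.coeff k hSeries).1 =
    PowerSeries.coeff k (PowerSeries.X ^ m.degree)
  rw [hSeries, PowerSeries.coeff_mk, coeff_hh, PowerSeries.coeff_X_pow]
  simp only [eq_comm]

theorem neg_one_pow_mul_val (l : ℕ) (f : SymFun) : ((-1) ^ l * f).1 = (-1 : ℤ) ^ l • f.1 := by
  rcases Nat.even_or_odd l with h | h <;> simp [h.neg_one_pow]

theorem swapSeries_eNegSeries : swapSeries (σ := Unit) eNegSeries =
    eSeries (PowerSeries.X : PowerSeries ℤ) := by
  classical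
  refine MvPowerSeries.ext fun m => PowerSeries.ext fun k => ?_
  change MvPowerSeries.coeff m (PowerSeries.coeff k eNegSeries).1 = _
  rw [eNegSeries, PowerSeries.coeff_mk, neg_one_pow_mul_val, map_smul, coeff_ee, coeff_eSeries]
  by_cases h : ∀ i, m i ≤ 1
  · rw [if_pos h, neg_pow PowerSeries.X, show ((-1 : PowerSeries ℤ)) ^ m.degree =
        PowerSeries.C ((-1) ^ m.degree) by simp, PowerSeries.coeff_C_mul, PowerSeries.coeff_X_pow]
    by_cases h2 : m.degree = k
    · simp [h, h2]
    · simp [h2, Ne.symm h2]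
  · simp [h]

theorem hSeries_mul_eNegSeries : hSeries * eNegSeries = 1 := by
  apply swapSeries_injective (σ := Unit)
  have := map_mul (swapSeries (σ := Unit)) hSeries eNegSeries
  rw [swapSeries_hSeries, swapSeries_eNegSeries, omegaSeries_mul_eSeries] at this
  exact this.trans (map_one _).symm

theorem swapSeries_substVar_hSeries (i : σ) : swapSeries (substVar SymFun i hSeries) =
    (omegaSeries (MvPowerSeries.X i : MvPowerSeries σ ℤ) : MvPowerSeries ℕ _) := by
  rw [swapSeries_substVar, swapSeries_hSeries]
  have := congrArg Subtype.val (map_omegaSeries (substVar ℤ i) PowerSeries.X)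
  rw [substVar_X] at this
  exact this

theorem swapSeries_substVar_eNegSeries (i : σ) : swapSeries (substVar SymFun i eNegSeries) =
    eSeries (MvPowerSeries.X i : MvPowerSeries σ ℤ) := by
  rw [swapSeries_substVar, swapSeries_eNegSeries, map_eSeries, substVar_X]

end Interchange

/-! ## `Λ` is the polynomial ring in the elementary symmetric functions -/

section Fundamental

theorem SymFun.coeff_equivMapDomain (f : SymFun) (e : Equiv.Perm ℕ) (m : ℕ →₀ ℕ) :
    MvPowerSeries.coeff (m.equivMapDomain e) f.1 = MvPowerSeries.coeff m f.1 := by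
  have h := congrArg (MvPowerSeries.coeff m) (f.2.1 e.symm)
  rwa [coeff_rename_equiv, Equiv.symm_symm] at h

/-- Every monomial can be moved to one in the first `N` variables, if it involves at most `N`. -/
theorem exists_embDomain_eq (m : ℕ →₀ ℕ) {N : ℕ} (h : m.support.card ≤ N) :
    ∃ (e : Equiv.Perm ℕ) (x : Fin N →₀ ℕ),
      m.equivMapDomain e = x.embDomain Fin.valEmbedding := by
  classical
  have := Equiv.Perm.isMultiplyPretransitive ℕ m.support.card
  obtain ⟨g, hg⟩ := MulAction.exists_smul_eq (Equiv.Perm ℕ)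
    ((m.support.equivFin.symm.toEmbedding.trans (Function.Embedding.subtype _)) :
      Fin m.support.card ↪ ℕ) Fin.valEmbedding
  have hg' : ∀ j ∈ m.support, g j < N := by
    intro j hj
    have := DFunLike.congr_fun hg (m.support.equivFin ⟨j, hj⟩)
    simp at this
    rw [this]
    exact (Fin.is_lt _).trans_le h
  refine ⟨g, (m.equivMapDomain g).comapDomain Fin.valEmbedding Fin.valEmbedding.injective.injOn, ?_⟩
  rw [Finsupp.embDomain_comapDomain]
  intro j hj
  have : g.symm j ∈ m.support := by
    simpa using hj
  have := hg' _ this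
  exact ⟨⟨j, by simpa using this⟩, rfl⟩

/-- Restriction to the first `N` variables. -/
def resVars (N : ℕ) : SymFun →+* MvPowerSeries (Fin N) ℤ :=
  (MvPowerSeries.killCompl (R := ℤ) (Fin.valEmbedding (n := N))).toRingHom.comp SymFun.subtype

theorem coeff_resVars {N : ℕ} (f : SymFun) (x : Fin N →₀ ℕ) :
    MvPowerSeries.coeff x (resVars N f) =
      MvPowerSeries.coeff (x.embDomain Fin.valEmbedding) f.1 := rfl

theorem degree_embDomain {N : ℕ} (x : Fin N →₀ ℕ) :
    (x.embDomain (Fin.valEmbedding (n := N))).degree = x.degree := by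
  rw [Finsupp.embDomain_eq_mapDomain, Finsupp.degree_mapDomain]

theorem coeff_esymm {N : ℕ} (l : ℕ) (x : Fin N →₀ ℕ) [Decidable (x.degree = l ∧ ∀ i, x i ≤ 1)] :
    MvPolynomial.coeff x (MvPolynomial.esymm (Fin N) ℤ l) =
      if x.degree = l ∧ ∀ i, x i ≤ 1 then 1 else 0 := by
  classical
  have hs : ∀ (t : Finset (Fin N)) (i : Fin N),
      (∑ j ∈ t, Finsupp.single j 1 : Fin N →₀ ℕ) i = if i ∈ t then 1 else 0 := by
    intro t i
    simp [Finsupp.finsetSum_apply, Finsupp.single_apply]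
  rw [MvPolynomial.esymm_eq_sum_monomial, MvPolynomial.coeff_sum]
  simp only [MvPolynomial.coeff_monomial]
  split_ifs with h
  · have hx : ∑ j ∈ x.support, Finsupp.single j 1 = x := by
      ext i
      rw [hs]
      have := h.2 i
      split_ifs with h1
      · rw [Finsupp.mem_support_iff] at h1; omega
      · rw [Finsupp.notMem_support_iff] at h1; exact h1.symm
    have hcard : x.support.card = l := by
      rw [← h.1, Finsupp.degree_apply, Finset.card_eq_sum_ones]
      refine Finset.sum_congr rfl fun i hi => ?_
      have := h.2 i
      rw [Finsupp.mem_support_iff] at hi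
      omega
    rw [Finset.sum_eq_single x.support, if_pos hx]
    · intro t _ ht
      rw [if_neg]
      rintro rfl
      apply ht
      ext i
      rw [Finsupp.mem_support_iff, hs]
      simp
    · intro h2
      exact absurd (Finset.mem_powersetCard.mpr ⟨Finset.subset_univ _, hcard⟩) h2
  · refine Finset.sum_eq_zero fun t ht => if_neg ?_
    rintro rfl
    refine h ⟨?_, fun i => by rw [hs]; split_ifs <;> omega⟩
    rw [map_sum]
    simp [(Finset.mem_powersetCard.mp ht).2]

theorem resVars_ee (N l : ℕ) :
    resVars N (ee l) = (MvPolynomial.esymm (Fin N) ℤ l : MvPowerSeries (Fin N) ℤ) := by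
  classical
  refine MvPowerSeries.ext fun x => ?_
  rw [coeff_resVars, coeff_ee, MvPolynomial.coeff_coe, coeff_esymm, degree_embDomain]
  congr 1
  refine propext (and_congr_right fun _ => ⟨fun h i => ?_, fun h i => ?_⟩)
  · have := h (Fin.valEmbedding i)
    rwa [Finsupp.embDomain_apply_self] at this
  · by_cases hi : i ∈ Set.range (Fin.valEmbedding (n := N))
    · obtain ⟨j, rfl⟩ := hi
      rw [Finsupp.embDomain_apply_self]; exact h j
    · rw [Finsupp.embDomain_of_notMem_range _ _ _ hi]; omega

/-- `ℤ[x_0, x_1, …] → Λ`, `x_i ↦ e_{i+1}`. -/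
def evalE : MvPolynomial ℕ ℤ →+* SymFun :=
  MvPolynomial.eval₂Hom (Int.castRingHom SymFun) fun i => ee (i + 1)

theorem evalE_X (i : ℕ) : evalE (MvPolynomial.X i) = ee (i + 1) := by simp [evalE]

/-- Ties `evalE` to the fundamental theorem in finitely many variables; both injectivity and
surjectivity are drawn from it. -/
theorem resVars_evalE {N : ℕ} (Q : MvPolynomial (Fin N) ℤ) :
    resVars N (evalE (MvPolynomial.rename Fin.val Q)) =
      ((MvPolynomial.esymmAlgHom (Fin N) ℤ N Q).val : MvPowerSeries (Fin N) ℤ) := by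
  have : ((resVars N).comp evalE).comp (MvPolynomial.rename (Fin.val (n := N))).toRingHom =
      (MvPolynomial.coeToMvPowerSeries.ringHom (R := ℤ) (σ := Fin N)).comp
        ((MvPolynomial.symmetricSubalgebra (Fin N) ℤ).subtype.comp
          (MvPolynomial.esymmAlgHom (Fin N) ℤ N).toRingHom) := by
    apply MvPolynomial.ringHom_ext
    · intro r
      simp
    · intro i
      simp [evalE_X, resVars_ee, MvPolynomial.esymmAlgHom]
      rfl
  exact RingHom.congr_fun this Q

/-- A relation involves finitely many `e_i`. Restricted to as many variables, these are
algebraically independent. -/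
theorem evalE_injective : Function.Injective evalE := by
  rw [injective_iff_map_eq_zero]
  intro P hP
  obtain ⟨N, hN⟩ : ∃ N, ∀ i ∈ P.vars, i < N := ⟨P.vars.sup id + 1, fun i hi =>
    Nat.lt_succ_of_le (Finset.le_sup (f := id) hi)⟩
  obtain ⟨Q, rfl⟩ := MvPolynomial.exists_rename_eq_of_vars_subset_range P
    (Fin.val (n := N)) Fin.val_injective (fun i hi => ⟨⟨i, hN i hi⟩, rfl⟩)
  have h := resVars_evalE Q
  rw [hP, map_zero] at h
  have h2 : (MvPolynomial.esymmAlgHom (Fin N) ℤ N Q).val = 0 :=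
    MvPolynomial.coe_injective _ _ (by rw [← h]; simp)
  have h3 : Q = 0 := MvPolynomial.esymmAlgHom_injective (σ := Fin N) ℤ (by simp)
    (Subtype.ext (by rw [h2]; simp))
  rw [h3, map_zero]

/-- The homogeneous component of degree `k`. -/
def homComp (k : ℕ) : SymFun →+ SymFun where
  toFun f := ⟨symOfCoeff (A := ℤ) (fun m => if m.degree = k then MvPowerSeries.coeff m f.1 else 0)
      (fun e m => by rw [degree_equivMapDomain, SymFun.coeff_equivMapDomain]),
    Subtype.prop _, k, fun m hm => if_neg hm.ne'⟩
  map_zero' := Subtype.ext (MvPowerSeries.ext fun m => by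
    change (if _ then MvPowerSeries.coeff m (0 : MvPowerSeries ℕ ℤ) else 0) = (0 : ℤ)
    simp)
  map_add' f g := Subtype.ext (MvPowerSeries.ext fun m => by
    change (if _ then MvPowerSeries.coeff m (f.1 + g.1) else 0) =
      (if m.degree = k then MvPowerSeries.coeff m f.1 else 0) +
      (if m.degree = k then MvPowerSeries.coeff m g.1 else 0)
    split_ifs <;> simp)

theorem coeff_homComp (k : ℕ) (f : SymFun) (m : ℕ →₀ ℕ) :
    MvPowerSeries.coeff m (homComp k f).1 =
      if m.degree = k then MvPowerSeries.coeff m f.1 else 0 := rfl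

theorem homComp_mul (k : ℕ) (f g : SymFun) :
    homComp k (f * g) = ∑ p ∈ Finset.HasAntidiagonal.antidiagonal k, homComp p.1 f * homComp p.2 g := by
  classical
  refine Subtype.ext (MvPowerSeries.ext fun m => ?_)
  rw [coeff_homComp, AddSubmonoidClass.coe_finsetSum, map_sum, Subring.coe_mul]
  simp only [Subring.coe_mul, MvPowerSeries.coeff_mul, coeff_homComp]
  rw [Finset.sum_comm]
  have key : ∀ x ∈ Finset.HasAntidiagonal.antidiagonal m, ∑ p ∈ Finset.HasAntidiagonal.antidiagonal k,
      ((if x.1.degree = p.1 then MvPowerSeries.coeff x.1 f.1 else 0) *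
        if x.2.degree = p.2 then MvPowerSeries.coeff x.2 g.1 else 0) =
      if m.degree = k then MvPowerSeries.coeff x.1 f.1 * MvPowerSeries.coeff x.2 g.1 else 0 := by
    intro x hx
    rw [Finset.HasAntidiagonal.mem_antidiagonal] at hx
    have hd : m.degree = x.1.degree + x.2.degree := by rw [← hx, map_add]
    split_ifs with h
    · rw [Finset.sum_eq_single (x.1.degree, x.2.degree)]
      · simp
      · rintro ⟨i, j⟩ _ hp
        by_cases h1 : x.1.degree = i
        · rw [if_neg (c := x.2.degree = _) fun h2 => hp (by simp [h1, h2]), mul_zero]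
        · rw [if_neg h1, zero_mul]
      · intro h1
        exact absurd (Finset.HasAntidiagonal.mem_antidiagonal.mpr (hd.symm.trans h)) h1
    · refine Finset.sum_eq_zero fun p hp => ?_
      rw [Finset.HasAntidiagonal.mem_antidiagonal] at hp
      by_cases h1 : x.1.degree = p.1
      · rw [if_neg (c := x.2.degree = _) fun h2 => h (by rw [hd, h1, h2, hp]), mul_zero]
      · rw [if_neg h1, zero_mul]
  rw [Finset.sum_congr rfl key]
  split_ifs <;> simp

/-- The generators `e_i` are homogeneous. The lemma is needed because restriction to `d` variables
determines a symmetric function only in degrees at most `d`, so a lift has to be cut off there. -/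
theorem homComp_mem_range {f : SymFun} (hf : f ∈ evalE.range) (k : ℕ) :
    homComp k f ∈ evalE.range := by
  obtain ⟨P, rfl⟩ := hf
  induction P using MvPolynomial.induction_on generalizing k with
  | C r =>
    have hC : ∀ j : ℕ, homComp j (1 : SymFun) = if j = 0 then 1 else 0 := by
      classical
      intro j
      refine Subtype.ext (MvPowerSeries.ext fun m => ?_)
      rw [coeff_homComp]
      change (if _ then MvPowerSeries.coeff m (1 : MvPowerSeries ℕ ℤ) else 0) = _
      rw [MvPowerSeries.coeff_one]
      by_cases hm : m = 0
      · subst hm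
        by_cases hj : j = 0
        · simp [hj]
        · simp [hj, Ne.symm hj]
      · by_cases hj : j = 0 <;> simp [hm, hj, MvPowerSeries.coeff_one]
    have h1 : evalE (MvPolynomial.C r) = r • (1 : SymFun) := by simp [evalE]
    rw [h1, map_zsmul, hC]
    refine zsmul_mem ?_ r
    split_ifs
    · exact one_mem _
    · exact zero_mem _
  | add p q hp hq =>
    rw [map_add, map_add]
    exact add_mem (hp k) (hq k)
  | mul_X p i hp =>
    rw [map_mul, homComp_mul]
    refine sum_mem fun x _ => mul_mem (hp _) ?_
    rw [evalE_X]
    have : homComp x.2 (ee (i + 1)) = if x.2 = i + 1 then ee (i + 1) else 0 := by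
      classical
      refine Subtype.ext (MvPowerSeries.ext fun m => ?_)
      rw [coeff_homComp]
      split_ifs with h1 h2 h2
      · rfl
      · rw [coeff_ee, if_neg fun h3 => h2 (h1.symm.trans h3.1)]; simp
      · rw [coeff_ee, if_neg fun h3 => h1 (h3.1.trans h2.symm)]
      · simp
    rw [this]
    split_ifs
    · exact ⟨_, evalE_X i⟩
    · exact zero_mem _

/-- If `f` has degree at most `d`, its restriction to `d` variables is a symmetric polynomial, hence
a polynomial in elementary ones, which lifts to some `F` in the range. A monomial of degree at most
`d` involves at most `d` variables and can be permuted into the first `d`, so `f` and `F` agree up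
to degree `d`; the part of `F` above `d` is discarded. -/
theorem evalE_surjective : Function.Surjective evalE := by
  classical
  intro f
  obtain ⟨d, hd⟩ := f.2.2
  obtain ⟨g, hg⟩ : ∃ g : MvPolynomial (Fin d) ℤ, (g : MvPowerSeries (Fin d) ℤ) = resVars d f := by
    refine ⟨MvPowerSeries.truncFinset ℤ (Finsupp.finite_of_degree_lt (d + 1)).toFinset
      (resVars d f), MvPowerSeries.ext fun x => ?_⟩
    rw [MvPolynomial.coeff_coe]
    by_cases hx : x.degree < d + 1
    · rw [MvPowerSeries.coeff_truncFinset_of_mem]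
      simpa using hx
    · rw [MvPowerSeries.coeff_truncFinset_eq_zero _ (by simpa using hx), coeff_resVars, hd]
      rw [degree_embDomain]; omega
  have hsymm : g ∈ MvPolynomial.symmetricSubalgebra (Fin d) ℤ := by
    rw [MvPolynomial.mem_symmetricSubalgebra]
    intro e
    ext x
    obtain ⟨x, rfl⟩ : ∃ x', x = Finsupp.mapDomain e x' :=
      ⟨Finsupp.mapDomain e.symm x, by
        rw [← Finsupp.mapDomain_comp]; simp⟩
    rw [MvPolynomial.coeff_rename_mapDomain _ e.injective, ← MvPolynomial.coeff_coe,
      ← MvPolynomial.coeff_coe, hg, coeff_resVars, coeff_resVars]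
    have e1 : (Finsupp.mapDomain e x).embDomain (Fin.valEmbedding (n := d)) =
        (x.embDomain Fin.valEmbedding).equivMapDomain
          (e.viaFintypeEmbedding (Fin.valEmbedding (n := d))) := by
      rw [Finsupp.equivMapDomain_eq_mapDomain, Finsupp.embDomain_eq_mapDomain,
        Finsupp.embDomain_eq_mapDomain, ← Finsupp.mapDomain_comp, ← Finsupp.mapDomain_comp]
      congr 1
      funext i
      exact (Equiv.Perm.viaFintypeEmbedding_apply_image e Fin.valEmbedding i).symm
    rw [e1, SymFun.coeff_equivMapDomain]
  obtain ⟨Q, hQ⟩ := MvPolynomial.esymmAlgHom_surjective (σ := Fin d) (n := d) ℤ (by simp) ⟨g, hsymm⟩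
  set F := evalE (MvPolynomial.rename Fin.val Q) with hF
  have hres : resVars d F = resVars d f := by
    rw [hF, resVars_evalE, hQ, ← hg]
  have hmem : ∑ k ∈ Finset.range (d + 1), homComp k F ∈ evalE.range :=
    sum_mem fun k _ => homComp_mem_range ⟨_, rfl⟩ k
  suffices h : f = ∑ k ∈ Finset.range (d + 1), homComp k F by
    rw [h]
    exact hmem
  refine Subtype.ext (MvPowerSeries.ext fun m => ?_)
  rw [AddSubmonoidClass.coe_finsetSum, map_sum]
  simp only [coeff_homComp, Finset.sum_ite_eq, Finset.mem_range]
  split_ifs with hm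
  · obtain ⟨e, x, hx⟩ := exists_embDomain_eq m (N := d) (by
      refine le_trans ?_ (Nat.lt_succ_iff.mp hm)
      rw [Finset.card_eq_sum_ones, Finsupp.degree_apply]
      exact Finset.sum_le_sum fun i hi =>
        Nat.one_le_iff_ne_zero.mpr (Finsupp.mem_support_iff.mp hi))
    rw [← SymFun.coeff_equivMapDomain f e, ← SymFun.coeff_equivMapDomain F e, hx, ← coeff_resVars,
      ← coeff_resVars, hres]
  · exact hd m (by omega)

/-- `ℤ[x_0, x_1, …] ≃ Λ`, `x_i ↦ e_{i+1}`. -/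
def evalEEquiv : MvPolynomial ℕ ℤ ≃+* SymFun :=
  RingEquiv.ofBijective evalE ⟨evalE_injective, evalE_surjective⟩

theorem SymFun.hom_ext {S : Type*} [Ring S] {φ ψ : SymFun →+* S}
    (h : ∀ i, φ (ee (i + 1)) = ψ (ee (i + 1))) : φ = ψ := by
  have : φ.comp evalE = ψ.comp evalE := MvPolynomial.ringHom_ext (by simp) fun i => by
    simpa [evalE_X] using h i
  refine RingHom.ext fun f => ?_
  obtain ⟨P, rfl⟩ := evalE_surjective f
  exact RingHom.congr_fun this P

end Fundamental

/-! ## Morse's involution of `Λ` -/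

section Morse

/-- `⊖X = -X / (1 - X)`. -/
def ominusX (A : Type*) [CommRing A] : PowerSeries A := PowerSeries.mk fun k => if k = 0 then 0 else -1

theorem ominusX_eq (A : Type*) [CommRing A] :
    ominusX A = -PowerSeries.X * PowerSeries.mk 1 := by
  ext k
  rcases k with _ | k
  · simp [ominusX]
  · simp [ominusX, PowerSeries.coeff_succ_X_mul]

theorem ominusX_mul (A : Type*) [CommRing A] :
    ominusX A * (1 - PowerSeries.X) = -PowerSeries.X := by
  rw [ominusX_eq, mul_assoc, PowerSeries.mk_one_mul_one_sub_eq_one, mul_one]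

theorem hasSubst_ominusX (A : Type*) [CommRing A] : PowerSeries.HasSubst (ominusX A) :=
  PowerSeries.HasSubst.of_constantCoeff_zero' (by simp [ominusX_eq])

theorem map_ominusX {A B : Type*} [CommRing A] [CommRing B] (φ : A →+* B) :
    PowerSeries.map φ (ominusX A) = ominusX B := by
  ext k
  rw [PowerSeries.coeff_map, ominusX, ominusX, PowerSeries.coeff_mk, PowerSeries.coeff_mk]
  split_ifs <;> simp

/-- If `z = ⊖x` then `⊖z = x`. -/
theorem ominus_ominus {B : Type*} [CommRing B] {x z w : B} (h : z * (1 - x) = -x)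
    (hw : w * (1 - z) = -z) : w = x := by
  have h1 : (1 - z) * (1 - x) = 1 := by linear_combination -h
  linear_combination (1 - x) * hw - w * h1 - h

theorem subst_ominusX_ominusX (A : Type*) [CommRing A] :
    (ominusX A).subst (ominusX A) = (PowerSeries.X : PowerSeries A) := by
  refine ominus_ominus (ominusX_mul A) ?_
  have h := congrArg (PowerSeries.substAlgHom (R := A) (hasSubst_ominusX A)) (ominusX_mul A)
  rw [map_mul, map_sub, map_one, map_neg, PowerSeries.substAlgHom_X, PowerSeries.coe_substAlgHom] at h
  exact h

theorem hh_zero : hh 0 = 1 := by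
  classical
  refine Subtype.ext (MvPowerSeries.ext fun m => ?_)
  rw [coeff_hh]
  change _ = MvPowerSeries.coeff m (1 : MvPowerSeries ℕ ℤ)
  rw [MvPowerSeries.coeff_one]
  exact if_congr (Finsupp.degree_eq_zero_iff m) rfl rfl

theorem ee_zero : ee 0 = 1 := by
  have h := congrArg PowerSeries.constantCoeff hSeries_mul_eNegSeries
  simpa [hSeries, eNegSeries, hh_zero] using h

/-- `H(⊖t)`. -/
def hOminus : PowerSeries SymFun := hSeries.subst (ominusX SymFun)

/-- `E(-⊖t)`. -/
def eOminus : PowerSeries SymFun := eNegSeries.subst (ominusX SymFun)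

theorem hOminus_mul_eOminus : hOminus * eOminus = 1 := by
  have h := congrArg (PowerSeries.substAlgHom (R := SymFun) (hasSubst_ominusX SymFun))
    hSeries_mul_eNegSeries
  rwa [map_mul, map_one, PowerSeries.coe_substAlgHom] at h

theorem coeff_zero_hOminus : PowerSeries.coeff 0 hOminus = 1 := by
  rw [hOminus, PowerSeries.coeff_subst' (hasSubst_ominusX _), finsum_eq_single _ 0]
  · simp [hSeries, hh_zero]
  · intro k hk
    simp [ominusX_eq, hk]

/-- Morse's endomorphism of `Λ`. -/
def morseHom : SymFun →+* SymFun :=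
  (MvPolynomial.eval₂Hom (Int.castRingHom SymFun)
    fun i => (-1) ^ (i + 1) * PowerSeries.coeff (i + 1) hOminus).comp evalEEquiv.symm.toRingHom

theorem morseHom_ee (i : ℕ) :
    morseHom (ee (i + 1)) = (-1) ^ (i + 1) * PowerSeries.coeff (i + 1) hOminus := by
  have : evalEEquiv.symm (ee (i + 1)) = MvPolynomial.X i :=
    evalEEquiv.symm_apply_eq.mpr (evalE_X i).symm
  simp [morseHom, this]

/-- The values chosen on the `e_i` say that `E(-t)` goes to `H(⊖t)`. Working with generating
functions makes the remaining properties formal. -/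
theorem map_morseHom_eNegSeries : PowerSeries.map morseHom eNegSeries = hOminus := by
  ext k : 1
  rw [PowerSeries.coeff_map, eNegSeries, PowerSeries.coeff_mk]
  rcases k with _ | k
  · rw [ee_zero, coeff_zero_hOminus]; simp
  · rw [map_mul, morseHom_ee, ← mul_assoc]
    simp [← mul_pow]

theorem map_morseHom_hSeries : PowerSeries.map morseHom hSeries = eOminus := by
  have h := congrArg (PowerSeries.map morseHom) hSeries_mul_eNegSeries
  rw [map_mul, map_one, map_morseHom_eNegSeries] at h
  exact left_inv_eq_right_inv h hOminus_mul_eOminus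

/-- The series `⊖t` has integer coefficients, so the map commutes with substituting it: `H(⊖t)` goes
to `E(-⊖⊖t) = E(-t)`. -/
theorem map_morseHom_hOminus : PowerSeries.map morseHom hOminus = eNegSeries := by
  have h : PowerSeries.map morseHom hOminus = MvPowerSeries.map morseHom hOminus := rfl
  rw [h, hOminus, PowerSeries.map_subst (hasSubst_ominusX _)]
  change (PowerSeries.map morseHom hSeries).subst (PowerSeries.map morseHom (ominusX SymFun)) = _
  rw [map_morseHom_hSeries, map_ominusX, eOminus,
    PowerSeries.subst_comp_subst_apply (hasSubst_ominusX _) (hasSubst_ominusX _),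
    subst_ominusX_ominusX, PowerSeries.X_subst]

theorem eNegSeries_ext {φ ψ : SymFun →+* SymFun}
    (h : PowerSeries.map φ eNegSeries = PowerSeries.map ψ eNegSeries) : φ = ψ := by
  refine SymFun.hom_ext fun i => ?_
  have := congrArg (PowerSeries.coeff (i + 1)) h
  simp only [eNegSeries, PowerSeries.coeff_map, PowerSeries.coeff_mk, map_mul, map_pow, map_neg,
    map_one] at this
  have h2 := congrArg ((-1) ^ (i + 1) * ·) this
  simpa only [← mul_assoc, ← mul_pow, neg_mul_neg, one_mul, one_pow] using h2

theorem morseHom_morseHom (f : SymFun) : morseHom (morseHom f) = f := by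
  have : morseHom.comp morseHom = RingHom.id _ := by
    apply eNegSeries_ext
    rw [PowerSeries.map_comp, RingHom.comp_apply, map_morseHom_eNegSeries, map_morseHom_hOminus]
    exact (congrFun PowerSeries.map_id _).symm
  exact RingHom.congr_fun this f

/-- Morse's involution of `Λ`. -/
def morse : SymFun ≃+* SymFun where
  toFun := morseHom
  invFun := morseHom
  left_inv := morseHom_morseHom
  right_inv := morseHom_morseHom
  map_mul' := map_mul _
  map_add' := map_add _

theorem coeff_ominusX_pow (l r : ℕ) : PowerSeries.coeff (l + 1) (ominusX SymFun ^ (r + 1)) =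
    if r ≤ l then (-1) ^ (r + 1) * (l.choose r : SymFun) else 0 := by
  rw [ominusX_eq, mul_pow, neg_pow, mul_assoc, show ((-1 : PowerSeries SymFun)) ^ (r + 1) =
    PowerSeries.C ((-1) ^ (r + 1)) by simp, PowerSeries.coeff_C_mul, PowerSeries.coeff_X_pow_mul',
    PowerSeries.mk_one_pow_eq_mk_choose_add, PowerSeries.coeff_mk]
  by_cases h : r ≤ l
  · rw [if_pos h, if_pos (by omega)]
    congr 3
    omega
  · rw [if_neg h, if_neg (by omega), mul_zero]

/-- Compare coefficients in `H(t) ↦ E(-⊖t)`. The sign of `e_{r+1}` in `E(-t)` cancels that of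
`(⊖t)^{r+1} = (-1)^{r+1} t^{r+1} (1 - t)^{-(r+1)}`. -/
theorem isMorse_morse : IsMorse morse := by
  intro l hl
  obtain ⟨l, rfl⟩ : ∃ k, l = k + 1 := ⟨l - 1, by omega⟩
  have h := congrArg (PowerSeries.coeff (l + 1)) map_morseHom_hSeries
  rw [PowerSeries.coeff_map, hSeries, PowerSeries.coeff_mk] at h
  change morseHom _ = _
  -- Powers of `⊖t` beyond the exponent `l + 1` do not reach degree `l + 1`; the zeroth power does
  -- not contribute either and is split off.
  rw [h, eOminus, PowerSeries.coeff_subst' (hasSubst_ominusX _),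
    finsum_eq_sum_of_support_subset (s := Finset.range (l + 2))]
  · rw [Finset.sum_range_succ']
    simp only [pow_zero, PowerSeries.coeff_one, Nat.add_one_ne_zero, if_false, smul_zero, add_zero,
      eNegSeries, PowerSeries.coeff_mk, coeff_ominusX_pow, Nat.add_sub_cancel]
    refine Finset.sum_congr rfl fun r hr => ?_
    rw [if_pos (Nat.lt_succ_iff.mp (Finset.mem_range.mp hr)), smul_eq_mul, nsmul_eq_mul,
      mul_mul_mul_comm, ← mul_pow]
    simp [mul_comm]
  · intro r hr
    rw [Function.mem_support] at hr
    by_contra h2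
    apply hr
    rcases r with _ | r
    · simp at h2
    · rw [coeff_ominusX_pow, if_neg, smul_zero]
      simp at h2
      omega

/-- The `h_l` determine `H(t)`, hence its inverse `E(-t)`, hence the values on the generators `e_l`.
-/
theorem IsMorse.eq {ω ω' : SymFun ≃+* SymFun} (h : IsMorse ω) (h' : IsMorse ω') : ω' = ω := by
  have h1 : ∀ l, ω' (hh l) = ω (hh l) := by
    intro l
    rcases Nat.eq_zero_or_pos l with rfl | hl
    · rw [hh_zero, map_one, map_one]
    · rw [h l hl, h' l hl]
  have h2 : PowerSeries.map (ω' : SymFun →+* SymFun) hSeries =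
      PowerSeries.map (ω : SymFun →+* SymFun) hSeries := by
    ext k : 1
    simp only [PowerSeries.coeff_map, hSeries, PowerSeries.coeff_mk]
    exact h1 k
  have h3 : (ω' : SymFun →+* SymFun) = ω := by
    apply eNegSeries_ext
    have e1 := congrArg (PowerSeries.map (ω : SymFun →+* SymFun)) hSeries_mul_eNegSeries
    have e2 := congrArg (PowerSeries.map (ω' : SymFun →+* SymFun)) hSeries_mul_eNegSeries
    rw [map_mul, map_one] at e1 e2
    rw [h2, mul_comm] at e2
    exact left_inv_eq_right_inv e2 e1
  exact RingEquiv.ext fun f => RingHom.congr_fun h3 f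

end Morse

/-! ## The involution of `Λ[[b]]` -/

section IotaHat

variable {n : ℕ}

/-- A homomorphism of power series rings that does not lower the order is determined by its
values on constants and on the variables. -/
theorem ringHom_ext_of_order {A B : Type*} [CommRing A] [CommRing B]
    {θ ψ : MvPowerSeries (Fin n) A →+* MvPowerSeries (Fin n) B}
    (hθ : ∀ F, F.order ≤ (θ F).order) (hψ : ∀ F, F.order ≤ (ψ F).order)
    (hC : ∀ a, θ (MvPowerSeries.C a) = ψ (MvPowerSeries.C a))
    (hX : ∀ i, θ (MvPowerSeries.X i) = ψ (MvPowerSeries.X i)) : θ = ψ := by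
  classical
  refine RingHom.ext fun F => MvPowerSeries.ext fun d => ?_
  -- `P` keeps the terms of degree at most that of `d`. The rest has larger order, so its images
  -- contribute nothing to the coefficient at `d`.
  let P := MvPowerSeries.truncFinset A
    (Finsupp.finite_of_degree_lt (σ := Fin n) (d.degree + 1)).toFinset F
  have hP : θ (P : MvPowerSeries (Fin n) A) = ψ (P : MvPowerSeries (Fin n) A) := by
    have : θ.comp (MvPolynomial.coeToMvPowerSeries.ringHom) =
        ψ.comp (MvPolynomial.coeToMvPowerSeries.ringHom) :=
      MvPolynomial.ringHom_ext (fun r => by simpa using hC r) fun i => by simpa using hX i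
    exact RingHom.congr_fun this P
  have hG : ((d.degree + 1 : ℕ) : ℕ∞) ≤ (F - P).order := by
    refine MvPowerSeries.nat_le_order fun x hx => ?_
    rw [map_sub, MvPolynomial.coeff_coe, MvPowerSeries.coeff_truncFinset_of_mem, sub_self]
    simpa using hx
  have key : ∀ χ : MvPowerSeries (Fin n) A →+* MvPowerSeries (Fin n) B,
      (∀ F, F.order ≤ (χ F).order) → MvPowerSeries.coeff d (χ (F - P)) = 0 := fun χ hχ =>
    MvPowerSeries.coeff_of_lt_order
      (lt_of_lt_of_le (by exact_mod_cast Nat.lt_succ_self _) (hG.trans (hχ _)))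
  have h1 := key θ hθ
  have h2 := key ψ hψ
  rw [map_sub, map_sub, sub_eq_zero] at h1 h2
  rw [h1, h2, hP]

theorem ominusB_mul (i : Fin n) :
    (ominusB i : BSym n) * (1 - MvPowerSeries.X i) = -MvPowerSeries.X i := by
  rw [ominusB, mul_assoc, mul_comm (MvPowerSeries.invOfUnit _ _), MvPowerSeries.mul_invOfUnit,
    mul_one]
  simp

theorem constantCoeff_ominusB (i : Fin n) :
    MvPowerSeries.constantCoeff (ominusB i : BSym n) = 0 := by simp [ominusB]

theorem hasSubst_ominusB :
    MvPowerSeries.HasSubst (fun i : Fin n => (ominusB i.rev : BSym n)) :=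
  MvPowerSeries.hasSubst_of_constantCoeff_zero fun i => constantCoeff_ominusB i.rev

variable (n) in
/-- The endomorphism `ι̂` of `Λ[[b]]`. -/
def iotaHatHom : BSym n →+* BSym n :=
  ((MvPowerSeries.substAlgHom (R := SymFun) (hasSubst_ominusB (n := n))) : BSym n →+* BSym n).comp
    (MvPowerSeries.map morseHom)

theorem iotaHatHom_apply (F : BSym n) : iotaHatHom n F =
    (MvPowerSeries.map morseHom F).subst (fun i : Fin n => (ominusB i.rev : BSym n)) :=
  congrFun (MvPowerSeries.coe_substAlgHom hasSubst_ominusB) _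

theorem iotaHatHom_C (f : SymFun) :
    iotaHatHom n (MvPowerSeries.C f) = MvPowerSeries.C (morseHom f) := by
  rw [iotaHatHom_apply, MvPowerSeries.map_C, MvPowerSeries.subst_C]

theorem iotaHatHom_X (i : Fin n) : iotaHatHom n (MvPowerSeries.X i) = ominusB i.rev := by
  rw [iotaHatHom_apply, MvPowerSeries.map_X, MvPowerSeries.subst_X hasSubst_ominusB]

theorem order_le_iotaHatHom (F : BSym n) : F.order ≤ (iotaHatHom n F).order := by
  rw [iotaHatHom_apply]
  refine (MvPowerSeries.le_order_map morseHom).trans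
    (le_trans ?_ (MvPowerSeries.le_order_subst hasSubst_ominusB _))
  refine le_mul_of_one_le_left zero_le (le_iInf fun i => ?_)
  exact MvPowerSeries.one_le_order_iff_constCoeff_eq_zero.mpr (constantCoeff_ominusB _)

theorem iotaHatHom_ominusB (i : Fin n) : iotaHatHom n (ominusB i) = MvPowerSeries.X i.rev := by
  refine ominus_ominus (ominusB_mul i.rev) ?_
  have := congrArg (iotaHatHom n) (ominusB_mul i)
  rwa [map_mul, map_sub, map_one, map_neg, iotaHatHom_X] at this

theorem iotaHatHom_iotaHatHom (F : BSym n) : iotaHatHom n (iotaHatHom n F) = F := by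
  have : (iotaHatHom n).comp (iotaHatHom n) = RingHom.id _ := by
    refine ringHom_ext_of_order (fun F => (order_le_iotaHatHom F).trans (order_le_iotaHatHom _))
      (fun F => le_rfl) (fun f => ?_) (fun i => ?_)
    · simp [iotaHatHom_C, morseHom_morseHom]
    · simp [iotaHatHom_X, iotaHatHom_ominusB]
  exact RingHom.congr_fun this F

variable (n) in
/-- The automorphism `ι̂` of `Λ[[b]]`. -/
def iotaHat : BSym n ≃+* BSym n where
  toFun := iotaHatHom n
  invFun := iotaHatHom n
  left_inv := iotaHatHom_iotaHatHom
  right_inv := iotaHatHom_iotaHatHom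
  map_mul' := map_mul _
  map_add' := map_add _

theorem isIotaHat_iotaHat : IsIotaHat morse (iotaHat n) :=
  ⟨iotaHatHom_C, iotaHatHom_X, order_le_iotaHatHom⟩

theorem IsIotaHat.eq {ω : SymFun ≃+* SymFun} {ι ι' : BSym n ≃+* BSym n} (h : IsIotaHat ω ι)
    (h' : IsIotaHat ω ι') : ι' = ι := by
  have : (ι' : BSym n →+* BSym n) = ι :=
    ringHom_ext_of_order h'.2.2 h.2.2 (fun f => (h'.1 f).trans (h.1 f).symm)
      (fun i => (h'.2.1 i).trans (h.2.1 i).symm)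
  exact RingEquiv.ext fun f => RingHom.congr_fun this f

/-- Morse's map turns `H(b_i)` into `E(-⊖t)` at `t = b_i`, and substituting `⊖b_{n-1-i}` cancels the
two `⊖`. This is why `ι̂` inverts `Ω`. -/
theorem iotaHat_substVar_hSeries (i : Fin n) :
    iotaHatHom n (substVar SymFun i hSeries) = substVar SymFun i.rev eNegSeries := by
  have hs : ∀ i : Fin n, PowerSeries.HasSubst (ominusB i : BSym n) := fun i =>
    PowerSeries.HasSubst.of_constantCoeff_zero (constantCoeff_ominusB i)
  rw [iotaHatHom_apply, substVar_apply, substVar_apply,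
    PowerSeries.map_subst (PowerSeries.HasSubst.X i), MvPowerSeries.map_X, map_morseHom_hSeries,
    PowerSeries.subst_def (MvPowerSeries.X i : BSym n),
    MvPowerSeries.subst_comp_subst_apply (PowerSeries.HasSubst.X i).const hasSubst_ominusB,
    MvPowerSeries.subst_X hasSubst_ominusB]
  change PowerSeries.subst (ominusB i.rev : BSym n) eOminus = _
  rw [eOminus, PowerSeries.subst_comp_subst_apply (hasSubst_ominusX _) (hs _)]
  congr 1
  refine ominus_ominus (ominusB_mul i.rev) ?_
  have h := congrArg (PowerSeries.substAlgHom (R := SymFun) (hs i.rev)) (ominusX_mul SymFun)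
  rwa [map_mul, map_sub, map_one, map_neg, PowerSeries.substAlgHom_X,
    PowerSeries.coe_substAlgHom] at h

theorem iotaHat_substVar_eNegSeries (i : Fin n) :
    iotaHatHom n (substVar SymFun i eNegSeries) = substVar SymFun i.rev hSeries := by
  have := iotaHat_substVar_hSeries i.rev
  rw [Fin.rev_rev] at this
  rw [← this, iotaHatHom_iotaHatHom]

end IotaHat

/-! ## The Peterson subalgebra -/

section Independence

theorem exists_coeff_multSeries (l : List ℕ) : ∃ m : ℕ →₀ ℕ, ∀ {A : Type} [CommRing A]
    (p : PowerSeries A), PowerSeries.coeff 0 p = 1 → MvPowerSeries.coeff m (multSeries p) =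
      (l.map fun k => PowerSeries.coeff k p).prod := by
  induction l with
  | nil => exact ⟨0, fun p _ => by simp [coeff_multSeries]⟩
  | cons k l ih =>
    obtain ⟨m, hm⟩ := ih
    -- Each letter gets a fresh variable, possible as there are infinitely many. A letter `0` adds
    -- nothing to `m`, and there the constant term `1` is used.
    obtain ⟨j, hj⟩ := Infinite.exists_notMem_finset m.support
    refine ⟨Finsupp.single j k + m, fun p hp => ?_⟩
    rw [coeff_multSeries, Finsupp.prod_add_index_of_disjoint, Finsupp.prod_single_index hp,
      ← coeff_multSeries, hm p hp, List.map_cons, List.prod_cons]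
    exact Finset.disjoint_of_subset_left Finsupp.support_single_subset
      (Finset.disjoint_singleton_left.mpr hj)

/-- Multiplicative series of different power series are linearly independent. -/
theorem multSeries_linearIndependent {A : Type} [CommRing A] [IsDomain A] {ι : Type*}
    {p : ι → PowerSeries A} (hp : ∀ i, PowerSeries.coeff 0 (p i) = 1) {s : Finset ι}
    (hinj : Set.InjOn p s) {c : ι → A} (h : ∑ i ∈ s, c i • multSeries (p i) = 0) :
    ∀ i ∈ s, c i = 0 := by
  classical
  -- The coefficients of `multSeries (p i)` include all products of coefficients of `p i`,
  -- repetitions allowed. They are the values of a character of the free monoid on the exponents, so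
  -- distinct characters give independence.
  let χ : s → (FreeMonoid ℕ →* A) := fun i => FreeMonoid.lift fun k => PowerSeries.coeff k (p i)
  have hχ : Function.Injective χ := by
    intro i j hij
    refine Subtype.ext (hinj i.2 j.2 (PowerSeries.ext fun k => ?_))
    simpa [χ] using DFunLike.congr_fun hij (FreeMonoid.of k)
  have hli := (linearIndependent_monoidHom (FreeMonoid ℕ) A).comp χ hχ
  have h2 := linearIndependent_iff'.mp hli Finset.univ (fun i => c i) (by
    funext l
    obtain ⟨m, hm⟩ := exists_coeff_multSeries l.toList
    have h3 := congrArg (MvPowerSeries.coeff m) h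
    rw [map_sum, map_zero, ← Finset.sum_coe_sort] at h3
    simp only [map_smul, hm _ (hp _)] at h3
    simpa [χ, FreeMonoid.lift_apply] using h3)
  intro i hi
  exact h2 ⟨i, hi⟩ (Finset.mem_univ _)

/-- The exponent of the factor with `b j` is the multiplicity of the root `(b j)⁻¹` over the
fraction field. -/
theorem prod_one_sub_injective {A : Type} [CommRing A] [IsDomain A] {n : ℕ} {b : Fin n → A}
    (hb : Function.Injective b) (hb0 : ∀ i, b i ≠ 0) {μ ν : Fin n → ℕ}
    (h : ∏ i, (1 - PowerSeries.C (b i) * PowerSeries.X) ^ μ i =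
      ∏ i, (1 - PowerSeries.C (b i) * PowerSeries.X) ^ ν i) : μ = ν := by
  classical
  let φ := algebraMap A (FractionRing A)
  have hφ : Function.Injective φ := IsFractionRing.injective A (FractionRing A)
  have hb0' : ∀ i, φ (b i) ≠ 0 := fun i => (map_ne_zero_iff φ hφ).mpr (hb0 i)
  have h1 : ∏ i, (1 - Polynomial.C (b i) * Polynomial.X) ^ μ i =
      ∏ i, (1 - Polynomial.C (b i) * Polynomial.X) ^ ν i := by
    apply Polynomial.coe_injective A
    have e : ∀ κ : Fin n → ℕ,
        ((∏ i, (1 - Polynomial.C (b i) * Polynomial.X) ^ κ i : Polynomial A) : PowerSeries A) =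
          ∏ i, (1 - PowerSeries.C (b i) * PowerSeries.X) ^ κ i := by
      intro κ
      rw [← Polynomial.coeToPowerSeries.ringHom_apply, map_prod]
      refine Finset.prod_congr rfl fun i _ => ?_
      rw [map_pow, Polynomial.coeToPowerSeries.ringHom_apply]
      simp
    rw [e, e, h]
  have h2 := congrArg (fun P => (Polynomial.map φ P).roots) h1
  have hr : ∀ (κ : Fin n → ℕ) (j : Fin n), (Polynomial.map φ
      (∏ i, (1 - Polynomial.C (b i) * Polynomial.X) ^ κ i)).roots.count (φ (b j))⁻¹ = κ j := by
    intro κ j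
    have e : ∀ i, Polynomial.map φ (1 - Polynomial.C (b i) * Polynomial.X) =
        Polynomial.C (-φ (b i)) * (Polynomial.X - Polynomial.C (φ (b i))⁻¹) := by
      intro i
      rw [mul_sub, ← Polynomial.C_mul, neg_mul, mul_inv_cancel₀ (hb0' i)]
      simp
      ring
    have hne : ∀ i, Polynomial.map φ (1 - Polynomial.C (b i) * Polynomial.X) ≠ 0 := by
      intro i
      rw [e]
      exact mul_ne_zero (Polynomial.C_ne_zero.mpr (neg_ne_zero.mpr (hb0' i)))
        (Polynomial.X_sub_C_ne_zero _)
    rw [Polynomial.map_prod, Polynomial.roots_prod _ _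
      (Finset.prod_ne_zero_iff.mpr fun i _ => by
        rw [Polynomial.map_pow]; exact pow_ne_zero _ (hne i)), Multiset.count_bind]
    simp only [Polynomial.map_pow, Polynomial.roots_pow, Multiset.count_nsmul, e,
      Polynomial.roots_C_mul _ (neg_ne_zero.mpr (hb0' _)), Polynomial.roots_X_sub_C,
      Multiset.count_singleton]
    change ∑ i, _ = _
    rw [Finset.sum_eq_single j]
    · simp
    · intro i _ hij
      rw [if_neg, mul_zero]
      intro h
      exact hij (hb (hφ (inv_injective h))).symm
    · simp
  funext j
  rw [← hr μ j, ← hr ν j]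
  exact congrArg _ h2

end Independence

/-! ### The centralizer of `R(T)` and its action on `1`. -/

section Peterson

variable {n : ℕ}

theorem expo_injective : Function.Injective (expo (n := n)) := fun _ _ h =>
  (AddMonoidAlgebra.single_left_inj one_ne_zero).mp h

theorem chr_injective : Function.Injective (chr (n := n)) := fun i j h => by
  by_contra hij
  have := congrFun h i
  simp [chr, hij] at this

theorem cc_ne_zero {i j : Fin n} (h : i ≠ j) : cc (chr i - chr j) ≠ 0 := by
  rw [cc, sub_ne_zero, ← expo_zero]
  intro h2
  exact h (chr_injective (sub_eq_zero.mp (expo_injective h2).symm))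

theorem rootSet_le : rootSet n ≤ nonZeroDivisors (RepRing n) := by
  rw [rootSet, Submonoid.closure_le]
  rintro _ ⟨i, j, hij, rfl⟩
  exact mem_nonZeroDivisors_of_ne_zero (cc_ne_zero hij)

instance : IsDomain (RepLoc n) := 
  IsLocalization.isDomain_of_le_nonZeroDivisors (M := rootSet n) _ rootSet_le

theorem algebraMap_repLoc_injective :
    Function.Injective (algebraMap (RepRing n) (RepLoc n)) :=
  IsLocalization.injective _ rootSet_le

theorem bb_injective : Function.Injective (bb (n := n)) := fun i j h => by
  have h1 : expo (-chr i) = expo (-chr j) := by simpa [bb, cc] using h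
  exact chr_injective (neg_injective (expo_injective h1))

theorem bb_ne_zero (i : Fin n) : bb i ≠ 0 := by
  rw [bb, cc, sub_ne_zero, ← expo_zero]
  intro h
  have := congrFun (expo_injective h) i
  simp [chr] at this

/-! ### The action -/

theorem act_mul (x y : KDelta n) (f : SymSeries (RepLoc n)) : act (x * y) f = act x (act y f) := by
  rw [act, map_mul]; rfl

theorem act_add (x y : KDelta n) (f : SymSeries (RepLoc n)) : act (x + y) f = act x f + act y f := by
  rw [act, map_add]; rfl

theorem act_one (f : SymSeries (RepLoc n)) : act 1 f = f := by
  rw [act, map_one]; rfl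

theorem act_zero (f : SymSeries (RepLoc n)) : act 0 f = 0 := by
  rw [act, map_zero]; rfl

theorem act_neg (x : KDelta n) (f : SymSeries (RepLoc n)) : act (-x) f = -act x f := by
  rw [act, map_neg]; rfl

theorem act_sub (x y : KDelta n) (f : SymSeries (RepLoc n)) : act (x - y) f = act x f - act y f := by
  rw [sub_eq_add_neg, act_add, act_neg, sub_eq_add_neg]

theorem act_map_zero (x : KDelta n) : act x (0 : SymSeries (RepLoc n)) = 0 :=
  map_zero (kAct x : SymSeries (RepLoc n) →+ _)

theorem act_single (w : ExtWeyl n) (r : RepLoc n) (f : SymSeries (RepLoc n)) :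
    act (SkewMonoidAlgebra.single w r) f = r • weylAct w f := by
  have : kAct (SkewMonoidAlgebra.single w r) =
      Module.toAddMonoidEnd (RepLoc n) (SymSeries (RepLoc n)) r * weylAct w := by
    simp [kAct, SkewMonoidAlgebra.liftNCRingHom]
  rw [act, this]
  rfl

theorem act_scal (r : RepLoc n) (f : SymSeries (RepLoc n)) : act (scal r) f = r • f := by
  refine (act_single 1 r f).trans ?_
  rw [map_one]
  rfl

theorem act_grp (w : ExtWeyl n) (f : SymSeries (RepLoc n)) : act (grp w) f = weylAct w f := by
  refine (act_single w 1 f).trans (one_smul _ _)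

theorem weylAct_apply (w : ExtWeyl n) (f : SymSeries (RepLoc n)) :
    weylAct w f = OmegaPow w.left * SymSeries.map (permLoc w.right) f := rfl

theorem act_eq_sum (x : KDelta n) (f : SymSeries (RepLoc n)) :
    act x f = ∑ w ∈ x.support, x.coeff w • weylAct w f := by
  conv_lhs => rw [← SkewMonoidAlgebra.sum_single x, SkewMonoidAlgebra.sum_def']
  have : ∀ s : Finset (ExtWeyl n), act (∑ w ∈ s, SkewMonoidAlgebra.single w (x.coeff w)) f =
      ∑ w ∈ s, x.coeff w • weylAct w f := by
    classical
    intro s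
    induction s using Finset.induction_on with
    | empty => exact act_zero f
    | insert a s ha ih =>
      rw [Finset.sum_insert ha, Finset.sum_insert ha, act_add, ih, act_single]
  exact this _

theorem permLoc_one_apply (r : RepLoc n) : permLoc (1 : Equiv.Perm (Fin n)) r = r := by
  rw [map_one]; rfl

theorem weylAct_of_right_eq_one {w : ExtWeyl n} (h : w.right = 1) (f : SymSeries (RepLoc n)) :
    weylAct w f = OmegaPow w.left * f := by
  rw [weylAct_apply, h]
  congr 1
  exact Subtype.ext (MvPowerSeries.ext fun m => permLoc_one_apply _)

/-! ### The centralizer of `R(T)` -/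

/-- Comparing coefficients at `w` in `e^{a_i} x = x e^{a_i}` gives `e^{a_i} = e^{a_{w i}}`, since
`R(T)^Δ` is a domain. -/
theorem right_eq_one_of_centralizes {x : KDelta n} (hx : x ∈ Subring.centralizer (Set.range scalRep))
    {w : ExtWeyl n} (hw : w ∈ x.support) : w.right = 1 := by
  by_contra h
  obtain ⟨i, hi⟩ : ∃ i, w.right i ≠ i := by
    by_contra h2
    push Not at h2
    exact h (Equiv.ext h2)
  have h1 := congrArg (fun y => SkewMonoidAlgebra.coeff y w) (hx _ ⟨expo (chr i), rfl⟩)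
  have e1 : SkewMonoidAlgebra.coeff (scalRep (expo (chr i)) * x) w =
      algebraMap _ (RepLoc n) (expo (chr i)) * x.coeff w :=
    SkewMonoidAlgebra.coeff_single_one_mul x _ w
  have e2 : SkewMonoidAlgebra.coeff (x * scalRep (expo (chr i))) w =
      x.coeff w * permLoc w.right (algebraMap _ (RepLoc n) (expo (chr i))) :=
    SkewMonoidAlgebra.coeff_mul_single_one x _ w
  have e3 : permRep w.right (expo (chr i)) = expo (chr (w.right i)) := by
    rw [← permChar_chr]
    simp [permRep, expo]
  simp only [e1, e2, permLoc_algebraMap, e3] at h1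
  rw [mul_comm] at h1
  have h2 := mul_left_cancel₀ (SkewMonoidAlgebra.mem_support_iff.mp hw) h1
  exact hi (chr_injective (expo_injective (algebraMap_repLoc_injective h2))).symm

theorem commute_scal_of_centralizes {x : KDelta n}
    (hx : x ∈ Subring.centralizer (Set.range scalRep)) (r : RepLoc n) : Commute (scal r) x := by
  obtain ⟨⟨a, s⟩, hs⟩ := IsLocalization.surj (rootSet n) r
  have h1 : scal r * scalRep (s : RepRing n) = (scalRep a : KDelta n) := by
    rw [scalRep, RingHom.comp_apply, RingHom.comp_apply, ← map_mul, hs]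
  have hu : IsUnit (scalRep (s : RepRing n) : KDelta n) :=
    (IsLocalization.map_units (RepLoc n) s).map scal
  refine hu.mul_right_cancel ?_
  have ha := hx _ ⟨a, rfl⟩
  have hs' := hx _ ⟨(s : RepRing n), rfl⟩
  rw [mul_assoc, ← hs', ← mul_assoc, h1, mul_assoc, h1, ha]

/-- Only translations occur in `x`, and these act by multiplication. -/
theorem act_of_centralizes {x : KDelta n} (hx : x ∈ Subring.centralizer (Set.range scalRep))
    (f : SymSeries (RepLoc n)) : act x f = act x 1 * f := by
  rw [act_eq_sum, act_eq_sum, Finset.sum_mul]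
  refine Finset.sum_congr rfl fun w hw => ?_
  have := right_eq_one_of_centralizes hx hw
  rw [weylAct_of_right_eq_one this, weylAct_of_right_eq_one this, mul_one, smul_mul_assoc]

theorem act_mul_one_of_centralizes {x : KDelta n}
    (hx : x ∈ Subring.centralizer (Set.range scalRep)) (y : KDelta n) :
    act (x * y) 1 = act x 1 * act y 1 := by
  rw [act_mul, act_of_centralizes hx]

theorem Omega_inv_val {A : Type*} [CommRing A] (b : A) :
    (((Omega b)⁻¹ : (SymSeries A)ˣ) : SymSeries A).1 = eSeries b := by
  have h1 : (omegaSeries b : MvPowerSeries ℕ A) *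
      (((Omega b)⁻¹ : (SymSeries A)ˣ) : SymSeries A).1 = 1 :=
    congrArg Subtype.val (Omega b).mul_inv
  rw [mul_comm] at h1
  exact left_inv_eq_right_inv h1 (omegaSeries_mul_eSeries b)

theorem multSeries_prod {A : Type} [CommRing A] {ι : Type*} (s : Finset ι) {p : ι → PowerSeries A}
    (hp : ∀ i, PowerSeries.coeff 0 (p i) = 1) (k : ι → ℕ) :
    PowerSeries.coeff 0 (∏ i ∈ s, p i ^ k i) = 1 ∧
      multSeries (∏ i ∈ s, p i ^ k i) = ∏ i ∈ s, multSeries (p i) ^ k i := by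
  classical
  have hpow : ∀ i (k : ℕ), PowerSeries.coeff 0 (p i ^ k) = 1 ∧
      multSeries (p i ^ k) = multSeries (p i) ^ k := by
    intro i k
    induction k with
    | zero => simp [multSeries_one]
    | succ k ih =>
      rw [pow_succ, pow_succ, multSeries_mul ih.1 (hp i), ih.2]
      refine ⟨?_, rfl⟩
      have h1 := ih.1
      have h2 := hp i
      rw [PowerSeries.coeff_zero_eq_constantCoeff_apply] at h1 h2 ⊢
      rw [map_mul, h1, h2, one_mul]
  induction s using Finset.induction_on with
  | empty => simp [multSeries_one]
  | insert a s ha ih =>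
    rw [Finset.prod_insert ha, Finset.prod_insert ha, multSeries_mul (hpow a _).1 ih.1, ih.2,
      (hpow a _).2]
    refine ⟨?_, rfl⟩
    have h1 := ih.1
    have h2 := (hpow a (k a)).1
    rw [PowerSeries.coeff_zero_eq_constantCoeff_apply] at h1 h2 ⊢
    rw [map_mul, h1, h2, one_mul]

theorem OmegaPow_neg_val (μ : Fin n → ℕ) :
    ((OmegaPow fun i => Multiplicative.ofAdd (-(μ i : ℤ)) : (SymSeries (RepLoc n))ˣ) :
      SymSeries (RepLoc n)).1 = multSeries (∏ i, (1 - PowerSeries.C (algebraMap (RepRing n)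
        (RepLoc n) (bb i)) * PowerSeries.X) ^ μ i) := by
  rw [(multSeries_prod _ (fun i => by simp) μ).2, OmegaPow, Units.coe_prod,
    ← Subalgebra.coe_val, map_prod]
  refine Finset.prod_congr rfl fun i _ => ?_
  rw [toAdd_ofAdd, zpow_neg, zpow_natCast, ← inv_pow, Units.val_pow_eq_pow_val, map_pow,
    Subalgebra.coe_val, Omega_inv_val]
  rfl

/-- Multiplying by a large negative power of all `Ω(b_i)` turns every `Ω^μ` that occurs into `∏_j
p(y_j)` with `p` a product of powers of `1 - b_i X`. The polynomials `p` remember `μ`, so these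
series are linearly independent. -/
theorem eq_zero_of_act_one_eq_zero {x : KDelta n}
    (hx : x ∈ Subring.centralizer (Set.range scalRep)) (h : act x 1 = 0) : x = 0 := by
  obtain ⟨N, hN⟩ : ∃ N : ℤ, ∀ w ∈ x.support, ∀ i, (w.left i).toAdd ≤ N := by
    refine ⟨∑ w ∈ x.support, ∑ i, |(w.left i).toAdd|, fun w hw i => ?_⟩
    refine (le_abs_self _).trans ((Finset.single_le_sum (f := fun i => |(w.left i).toAdd|)
      (fun _ _ => abs_nonneg _) (Finset.mem_univ i)).trans
      (Finset.single_le_sum (f := fun w : ExtWeyl n => ∑ i, |(w.left i).toAdd|)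
        (fun _ _ => Finset.sum_nonneg fun _ _ => abs_nonneg _) hw))
  -- The choice of `N` as an upper bound for all coordinates makes the truncated differences honest
  -- ones.
  let κ : ExtWeyl n → Fin n → ℕ := fun w i => (N - (w.left i).toAdd).toNat
  have hκ : ∀ w ∈ x.support, ((OmegaPow (fun _ => Multiplicative.ofAdd (-N)) :
      (SymSeries (RepLoc n))ˣ) : SymSeries (RepLoc n)) * OmegaPow w.left =
      (OmegaPow fun i => Multiplicative.ofAdd (-(κ w i : ℤ)) : (SymSeries (RepLoc n))ˣ) := by
    intro w hw
    rw [← Units.val_mul, ← OmegaPow_mul]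
    congr 2
    funext i
    apply Multiplicative.toAdd.injective
    have := hN w hw i
    simp only [Pi.mul_apply, toAdd_mul, toAdd_ofAdd, κ]
    rw [Int.toNat_of_nonneg (by omega)]
    ring
  rw [act_eq_sum] at h
  have h2 := congrArg (fun g => (((OmegaPow (fun _ => Multiplicative.ofAdd (-N)) :
      (SymSeries (RepLoc n))ˣ) : SymSeries (RepLoc n)) * g).1) h
  simp only [Finset.mul_sum, mul_zero] at h2
  have h3 : ∑ w ∈ x.support, x.coeff w • multSeries (∏ i, (1 - PowerSeries.C (algebraMap (RepRing n)
        (RepLoc n) (bb i)) * PowerSeries.X) ^ κ w i) = 0 := by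
    rw [← Subalgebra.coe_val, map_sum] at h2
    refine Eq.trans (Finset.sum_congr rfl fun w hw => ?_) h2
    rw [weylAct_of_right_eq_one (right_eq_one_of_centralizes hx hw), mul_one, mul_smul_comm,
      hκ w hw, map_smul, Subalgebra.coe_val, OmegaPow_neg_val]
  have h4 := multSeries_linearIndependent (fun w => (multSeries_prod _ (fun i => by simp) (κ w)).1)
    (s := x.support) (by
      intro w hw w' hw' he
      have h5 := prod_one_sub_injective (algebraMap_repLoc_injective.comp bb_injective)
        (fun i => (map_ne_zero_iff _ algebraMap_repLoc_injective).mpr (bb_ne_zero i)) he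
      refine extWeyl_ext (fun i => Multiplicative.toAdd.injective ?_) fun i => ?_
      · have h6 := congrFun h5 i
        have := hN w hw i
        have := hN w' hw' i
        simp only [κ] at h6
        omega
      · rw [right_eq_one_of_centralizes hx hw, right_eq_one_of_centralizes hx hw']) h3
  ext w
  by_contra hw
  exact hw (h4 w (SkewMonoidAlgebra.mem_support_iff.mpr hw))

/-! ### Surjectivity onto `K · 1` -/

theorem act_grp_perm_one (u : Equiv.Perm (Fin n)) : act (grp (perm u)) 1 = 1 := by
  rw [act_grp, weylAct_apply, map_one]
  simp [OmegaPow]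

/-- The finite part of `w` twists coefficients on the left, and its inverse on the right undoes the
twist. Since `S_n` fixes `1`, this product acts on `1` as `grp w * y` does. -/
theorem conj_mem_centralizer {y : KDelta n} (hy : y ∈ Subring.centralizer (Set.range scalRep))
    (w : ExtWeyl n) :
    grp w * y * grp (perm w.right⁻¹) ∈ Subring.centralizer (Set.range (scalRep (n := n))) := by
  rintro _ ⟨r, rfl⟩
  have h1 : ∀ (v : ExtWeyl n) (r : RepRing n),
      grp v * scalRep r = (scalRep (permRep v.right r) * grp v : KDelta n) := fun v r => by
    rw [scalRep, RingHom.comp_apply, grp_mul_scal, permLoc_algebraMap]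
    rfl
  have h2 : permRep w.right (permRep w.right⁻¹ r) = r := by
    have := RingHom.congr_fun (permRep_mul w.right w.right⁻¹) r
    rw [mul_inv_cancel, permRep_one] at this
    exact this.symm
  set g : KDelta n := grp w
  set p : KDelta n := grp (perm w.right⁻¹)
  have h3 : p * scalRep r = scalRep (permRep w.right⁻¹ r) * p := h1 _ r
  have h4 : g * scalRep (permRep w.right⁻¹ r) = scalRep r * g := by rw [h1, h2]
  calc scalRep r * (g * y * p) = scalRep r * g * y * p := by simp only [mul_assoc]
    _ = g * (scalRep (permRep w.right⁻¹ r) * y) * p := by rw [← h4]; simp only [mul_assoc]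
    _ = g * (y * scalRep (permRep w.right⁻¹ r)) * p := by rw [hy _ ⟨_, rfl⟩]
    _ = g * y * (scalRep (permRep w.right⁻¹ r) * p) := by simp only [mul_assoc]
    _ = g * y * p * scalRep r := by rw [← h3]; simp only [mul_assoc]

variable [NeZero n]

theorem simpleRefl_eq_perm {i : Fin n} (hi : i ≠ 0) :
    (simpleRefl i : ExtWeyl n) = perm (Equiv.swap (i - 1) i) := by
  apply extWeyl_ext <;> intro j <;> simp [simpleRefl, hi]

/-- The elements that map the image of the Peterson subalgebra into itself form a subring, so it
suffices to treat generators; the case `y = 1` is surjectivity onto `K · 1`. -/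
theorem surjOn_peterson (hn : 2 ≤ n) {a : KDelta n} (ha : a ∈ nilHecke n) :
    ∀ y ∈ peterson n, ∃ x ∈ peterson n, act x 1 = act a (act y 1) := by
  let S : Subring (KDelta n) :=
    { carrier := {a | ∀ y ∈ peterson n, ∃ x ∈ peterson n, act x 1 = act a (act y 1)}
      mul_mem' := fun {a b} ha hb y hy => by
        obtain ⟨x, hx, h⟩ := hb y hy
        obtain ⟨z, hz, h'⟩ := ha x hx
        exact ⟨z, hz, by rw [h', h, act_mul]⟩
      one_mem' := fun y hy => ⟨y, hy, (act_one _).symm⟩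
      add_mem' := fun {a b} ha hb y hy => by
        obtain ⟨x, hx, h⟩ := ha y hy
        obtain ⟨z, hz, h'⟩ := hb y hy
        exact ⟨x + z, add_mem hx hz, by rw [act_add, act_add, h, h']⟩
      zero_mem' := fun y _ => ⟨0, zero_mem _, by rw [act_zero, act_zero]⟩
      neg_mem' := fun {a} ha y hy => by
        obtain ⟨x, hx, h⟩ := ha y hy
        exact ⟨-x, neg_mem hx, by rw [act_neg, act_neg, h]⟩ }
  have h1 : (1 : Fin n) ≠ 0 := by
    intro h
    exact sub_one_ne hn 0 (by rw [h, sub_zero])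
  refine nilHecke_induction hn 1 S (fun r y hy => ?_) (fun w y hy => ?_) (fun y hy => ?_) ha
  · refine ⟨scalRep r * y, ⟨mul_mem (scalRep_mem r) hy.1, ?_⟩, act_mul _ _ _⟩
    rintro _ ⟨r', rfl⟩
    rw [← mul_assoc, ← map_mul, mul_comm r', map_mul, mul_assoc, hy.2 _ ⟨r', rfl⟩, mul_assoc]
  · exact ⟨grp w * y * grp (perm w.right⁻¹),
      ⟨mul_mem (mul_mem (grp_mem hn w) hy.1) (grp_mem hn _), conj_mem_centralizer hy.2 w⟩,
      by rw [act_mul, act_grp_perm_one, act_mul]⟩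
  -- Since `T_1 · 1 = 0` and `s_1 · 1 = 1`, the element `(T_1 y - y T_1) s_1` acts on `1` as `T_1
  -- y`. It equals `c(α_1)⁻¹ (s_1 y s_1 - y)`, which centralizes `R(T)`. A nonzero node is
  -- essential: its reflection lies in `S_n` and fixes `1`.
  · have hs := grp_simpleRefl_mul_self (n := n) 1
    have hc := conj_mem_centralizer hy.2 (simpleRefl 1)
    rw [simpleRefl_right, Equiv.swap_inv, ← simpleRefl_eq_perm h1] at hc
    have hone : act (grp (simpleRefl (1 : Fin n))) 1 = 1 := by
      rw [simpleRefl_eq_perm h1, act_grp_perm_one]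
    have hcom := (commute_scal_of_centralizes hy.2 (rootInv (1 - 1 : Fin n) 1)).eq
    have e : (demT 1 * y - y * demT 1) * grp (simpleRefl 1) =
        scal (rootInv (1 - 1) 1) * (grp (simpleRefl 1) * y * grp (simpleRefl 1) - y) := by
      rw [demT_eq, ← mul_assoc y, ← hcom]
      set s : KDelta n := grp (simpleRefl 1)
      set c : KDelta n := scal (rootInv (1 - 1) 1)
      calc (c * (s - 1) * y - c * y * (s - 1)) * s = c * (s * y * s - y * (s * s)) := by
            noncomm_ring
        _ = _ := by rw [hs, mul_one]
    refine ⟨(demT 1 * y - y * demT 1) * grp (simpleRefl 1),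
      ⟨mul_mem (sub_mem (mul_mem (demT_mem 1) hy.1) (mul_mem hy.1 (demT_mem 1)))
        (grp_mem hn _), ?_⟩, ?_⟩
    · rw [e]
      rintro _ ⟨r, rfl⟩
      have h3 := (sub_mem hc hy.2) _ ⟨r, rfl⟩
      have h4 : scalRep r * scal (rootInv (1 - 1 : Fin n) 1) =
        scal (rootInv (1 - 1) 1) * scalRep r := (scal_commute _ _).eq
      rw [← mul_assoc, h4, mul_assoc, h3, ← mul_assoc]
    · have h4 : act (demT (1 : Fin n)) 1 = 0 := by
        rw [demT_eq, act_mul, act_sub, act_one, hone, sub_self (1 : SymSeries (RepLoc n)), act_map_zero]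
      rw [act_mul, hone, act_sub, act_mul, act_mul, h4, act_map_zero, sub_zero]

theorem bijOn_peterson (hn : 2 ≤ n) :
    Set.BijOn (fun x => act x 1) (peterson n : Set (KDelta n)) (hatLambdaN n) := by
  refine ⟨fun x hx => ⟨x, hx.1, rfl⟩, fun x hx y hy h => ?_, ?_⟩
  · have h1 : act (x - y) 1 = 0 := by
      rw [act_sub, sub_eq_zero]; exact h
    exact sub_eq_zero.mp (eq_zero_of_act_one_eq_zero (sub_mem hx.2 hy.2) h1)
  · rintro _ ⟨a, ha, rfl⟩
    obtain ⟨x, hx, h⟩ := surjOn_peterson hn ha 1 (one_mem _)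
    exact ⟨x, hx, by simp only [h, act_one]⟩

end Peterson

/-! ## Expansions -/

section Expand

variable {n : ℕ}

theorem repRing_hom_ext {S : Type*} [CommRing S] {φ ψ : RepRing n →+* S}
    (h : ∀ i, φ (expo (-chr i)) = ψ (expo (-chr i))) : φ = ψ := by
  have key : ∀ lam, φ (expo lam) = ψ (expo lam) := by
    let G : AddSubgroup (Fin n → ℤ) :=
      { carrier := {lam | φ (expo lam) = ψ (expo lam)}
        add_mem' := fun {x y} hx hy => by
          simp only [Set.mem_ofPred_eq] at hx hy ⊢
          rw [expo_add, map_mul, map_mul, hx, hy]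
        zero_mem' := by simp only [Set.mem_ofPred_eq, expo_zero, map_one]
        neg_mem' := fun {x} hx => by
          simp only [Set.mem_ofPred_eq] at hx ⊢
          have e : expo x * expo (-x) = 1 := by rw [← expo_add, add_neg_cancel, expo_zero]
          have e1 := congrArg φ e
          have e2 := congrArg ψ e
          rw [map_mul, map_one] at e1 e2
          rw [mul_comm, hx] at e1
          exact left_inv_eq_right_inv e1 e2 }
    intro lam
    have h2 : lam = ∑ i, lam i • chr i := by
      funext j
      simp [chr, Finset.sum_apply, Pi.single_apply]
    have : lam ∈ G := by
      rw [h2]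
      refine G.sum_mem fun i _ => G.zsmul_mem ?_ _
      have := G.neg_mem (show -chr i ∈ G from h i)
      rwa [neg_neg] at this
    exact this
  refine AddMonoidAlgebra.ringHom_ext (fun r => ?_) key
  exact RingHom.congr_fun (Subsingleton.elim (φ.comp AddMonoidAlgebra.singleZeroRingHom)
    (ψ.comp AddMonoidAlgebra.singleZeroRingHom)) r

theorem expandRep_expo (lam : Fin n → ℤ) : expandRep (expo lam) =
    ((∏ i, expUnit i ^ (-lam i) : (MvPowerSeries (Fin n) ℤ)ˣ) : MvPowerSeries (Fin n) ℤ) := by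
  change AddMonoidAlgebra.lift ℤ (MvPowerSeries (Fin n) ℤ) (Fin n → ℤ) _
    (AddMonoidAlgebra.single lam 1) = _
  exact (AddMonoidAlgebra.lift_single _ _ _).trans (one_smul ℤ (_ : MvPowerSeries (Fin n) ℤ))

theorem expandRep_expo_neg_chr (i : Fin n) :
    expandRep (expo (-chr i)) = 1 - MvPowerSeries.X i := by
  rw [expandRep_expo, Finset.prod_eq_single i]
  · simp [chr, expUnit]
  · intro j _ hj
    simp [chr, hj]
  · simp

theorem expandRep_bb (i : Fin n) : expandRep (bb i) = MvPowerSeries.X i := by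
  rw [bb, cc, map_sub, map_one, expandRep_expo_neg_chr, sub_sub_cancel]

theorem permRep_expo (u : Equiv.Perm (Fin n)) (lam : Fin n → ℤ) :
    permRep u (expo lam) = expo (permChar u lam) := by
  simp [permRep, expo]

theorem iotaRep_expo (lam : Fin n → ℤ) : iotaRep (expo lam) = expo (iotaChar lam) := by
  simp [iotaRep, expo]

theorem permRep_expo_neg_chr (u : Equiv.Perm (Fin n)) (i : Fin n) :
    permRep u (expo (-chr i)) = expo (-chr (u i)) := by
  rw [permRep_expo, map_neg, permChar_chr]

theorem iotaRep_expo_neg_chr (i : Fin n) : iotaRep (expo (-chr i)) = expo (chr i.rev) := by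
  rw [iotaRep_expo, map_neg, iotaChar_chr, neg_neg]

theorem expandRep_permRep (u : Equiv.Perm (Fin n)) (r : RepRing n) :
    expandRep (permRep u r) = MvPowerSeries.rename u (expandRep r) := by
  have : expandRep.comp (permRep u) =
      ((MvPowerSeries.rename u : MvPowerSeries (Fin n) ℤ →ₐ[ℤ] _) :
        MvPowerSeries (Fin n) ℤ →+* MvPowerSeries (Fin n) ℤ).comp expandRep := by
    refine repRing_hom_ext fun i => ?_
    rw [RingHom.comp_apply, RingHom.comp_apply, permRep_expo_neg_chr, expandRep_expo_neg_chr,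
      expandRep_expo_neg_chr]
    simp
  exact RingHom.congr_fun this r

theorem coeff_rename_perm {σ A : Type*} [CommRing A] (u : Equiv.Perm σ) (f : MvPowerSeries σ A)
    (m : σ →₀ ℕ) : MvPowerSeries.coeff m (MvPowerSeries.rename u f) =
      MvPowerSeries.coeff (m.equivMapDomain u.symm) f := by
  rw [← MvPowerSeries.coeff_embDomain_rename u.toEmbedding f (m.equivMapDomain u.symm)]
  congr 2
  ext i
  have := Finsupp.embDomain_apply_self u.toEmbedding (m.equivMapDomain u.symm) (u.symm i)
  simpa using this.symm

theorem le_order_rename {σ A : Type*} [CommRing A] (u : Equiv.Perm σ) (f : MvPowerSeries σ A) :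
    f.order ≤ (MvPowerSeries.rename u f).order := by
  refine MvPowerSeries.le_order fun d hd => ?_
  rw [coeff_rename_perm]
  apply MvPowerSeries.coeff_of_lt_order
  rwa [Finsupp.equivMapDomain_eq_mapDomain, Finsupp.degree_mapDomain]

theorem swapSeries_rename {σ : Type*} (u : Equiv.Perm σ) (F : MvPowerSeries σ SymFun) :
    swapSeries (MvPowerSeries.rename u F) = MvPowerSeries.map
      ((MvPowerSeries.rename u : MvPowerSeries σ ℤ →ₐ[ℤ] _) :
        MvPowerSeries σ ℤ →+* MvPowerSeries σ ℤ) (swapSeries F) := by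
  refine MvPowerSeries.ext fun m => MvPowerSeries.ext fun d => ?_
  rw [coeff_coeff_swapSeries, coeff_rename_perm, MvPowerSeries.coeff_map]
  refine Eq.trans ?_ (coeff_rename_perm u _ d).symm
  rw [coeff_coeff_swapSeries]

theorem rename_ominusB (u : Equiv.Perm (Fin n)) (i : Fin n) :
    MvPowerSeries.rename u (ominusB i : BSym n) = ominusB (u i) := by
  have h := congrArg (MvPowerSeries.rename (R := SymFun) u) (ominusB_mul i)
  rw [map_mul, map_sub, map_one, map_neg, MvPowerSeries.rename_X] at h
  have hu : IsUnit (1 - MvPowerSeries.X (u i) : BSym n) :=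
    MvPowerSeries.isUnit_iff_constantCoeff.mpr (by simp)
  exact hu.mul_right_cancel (h.trans (ominusB_mul _).symm)

theorem iotaHatHom_rename (u : Equiv.Perm (Fin n)) (F : BSym n) :
    iotaHatHom n (MvPowerSeries.rename u F) =
      MvPowerSeries.rename (Fin.revPerm * u * Fin.revPerm : Equiv.Perm (Fin n))
        (iotaHatHom n F) := by
  let ρ : Equiv.Perm (Fin n) → BSym n →+* BSym n := fun u =>
    ((MvPowerSeries.rename u : BSym n →ₐ[SymFun] BSym n) : BSym n →+* BSym n)
  have : (iotaHatHom n).comp (ρ u) = (ρ (Fin.revPerm * u * Fin.revPerm)).comp (iotaHatHom n) := by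
    refine ringHom_ext_of_order
      (fun F => (le_order_rename u F).trans (order_le_iotaHatHom _))
      (fun F => (order_le_iotaHatHom F).trans (le_order_rename _ _)) (fun f => ?_) fun i => ?_
    · change iotaHatHom n (MvPowerSeries.rename u (MvPowerSeries.C f)) =
        MvPowerSeries.rename _ (iotaHatHom n (MvPowerSeries.C f))
      rw [MvPowerSeries.rename_C, iotaHatHom_C, MvPowerSeries.rename_C]
    · change iotaHatHom n (MvPowerSeries.rename u (MvPowerSeries.X i)) =
        MvPowerSeries.rename _ (iotaHatHom n (MvPowerSeries.X i))
      rw [MvPowerSeries.rename_X, iotaHatHom_X, iotaHatHom_X, rename_ominusB]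
      simp
  exact RingHom.congr_fun this F

/-- The expansion `R(T) → Λ[[b]]`. -/
def expandSym : RepRing n →+* BSym n :=
  (MvPowerSeries.map (Int.castRingHom SymFun)).comp expandRep

theorem swapSeries_map_int {σ : Type*} (f : MvPowerSeries σ ℤ) :
    swapSeries (MvPowerSeries.map (Int.castRingHom SymFun) f) = MvPowerSeries.C f := by
  classical
  refine MvPowerSeries.ext fun m => MvPowerSeries.ext fun d => ?_
  rw [coeff_coeff_swapSeries, MvPowerSeries.coeff_map, MvPowerSeries.coeff_C]
  have : ∀ k : ℤ, ((Int.castRingHom SymFun k : SymFun) : MvPowerSeries ℕ ℤ) =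
      MvPowerSeries.C k := by
    intro k
    simp
  rw [this, MvPowerSeries.coeff_C]
  split_ifs <;> simp

theorem swapSeries_expandSym (r : RepRing n) :
    swapSeries (expandSym r) = MvPowerSeries.C (expandRep r) := swapSeries_map_int _

theorem expandSym_expo_neg_chr (i : Fin n) :
    expandSym (expo (-chr i)) = (1 - MvPowerSeries.X i : BSym n) := by
  rw [expandSym, RingHom.comp_apply, expandRep_expo_neg_chr]
  simp

/-- It is enough to look at `e^{-a_i} = 1 - b_i`, whose image `1 - ⊖b` is inverse to `1 - b =
e^{-a_{n-1-i}}` for `b = b_{n-1-i}`. -/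
theorem iotaHatHom_expandSym (r : RepRing n) :
    iotaHatHom n (expandSym r) = expandSym (iotaRep r) := by
  have : (iotaHatHom n).comp expandSym = expandSym.comp iotaRep := by
    refine repRing_hom_ext fun i => ?_
    rw [RingHom.comp_apply, RingHom.comp_apply, iotaRep_expo_neg_chr, expandSym_expo_neg_chr,
      map_sub, map_one, iotaHatHom_X]
    have h1 : (expandSym (expo (chr i.rev)) : BSym n) * (1 - MvPowerSeries.X i.rev) = 1 := by
      rw [← expandSym_expo_neg_chr, ← map_mul, ← expo_add, add_neg_cancel, expo_zero, map_one]
    have h2 : (1 - MvPowerSeries.X i.rev : BSym n) * (1 - ominusB i.rev) = 1 := by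
      linear_combination -ominusB_mul i.rev
    exact (left_inv_eq_right_inv h1 h2).symm
  exact RingHom.congr_fun this r

/-- A symmetric series in `y` over `ℤ[[b]]` comes from `Λ[[b]]` if its coefficients at each
monomial in `b` have bounded degree. -/
theorem exists_swapSeries_eq {σ : Type*} (f : SymSeries (MvPowerSeries σ ℤ))
    (h : ∀ d, ∃ N, ∀ m : ℕ →₀ ℕ, N < m.degree →
      MvPowerSeries.coeff d (MvPowerSeries.coeff m f.1) = 0) :
    ∃ F : MvPowerSeries σ SymFun, swapSeries F = f.1 := by
  have hf : ∀ (e : Equiv.Perm ℕ) m,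
      MvPowerSeries.coeff (m.equivMapDomain e) f.1 = MvPowerSeries.coeff m f.1 := by
    intro e m
    have := coeff_rename_perm e.symm f.1 m
    rw [f.2 e.symm] at this
    exact this.symm
  exact ⟨fun d => ⟨symOfCoeff (A := ℤ)
    (fun m => MvPowerSeries.coeff d (MvPowerSeries.coeff m f.1)) fun e m => by rw [hf],
    Subtype.prop _, h d⟩, rfl⟩

theorem exists_bound_swapSeries {σ : Type*} (F : MvPowerSeries σ SymFun) (d : σ →₀ ℕ) :
    ∃ N, ∀ m : ℕ →₀ ℕ, N < m.degree →
      MvPowerSeries.coeff d (MvPowerSeries.coeff m (swapSeries F)) = 0 :=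
  (MvPowerSeries.coeff d F).2.2

/-- Boundedness survives division by a nonzero element of `ℤ[[b]]`. -/
theorem exists_swapSeries_of_mul {c : MvPowerSeries (Fin n) ℤ} (hc : c ≠ 0)
    (f : SymSeries (MvPowerSeries (Fin n) ℤ)) (F : BSym n)
    (h : MvPowerSeries.C c * f.1 = swapSeries F) : ∃ G : BSym n, swapSeries G = f.1 := by
  refine exists_swapSeries_eq f fun d => ?_
  obtain ⟨o, ho⟩ : ∃ o : ℕ, c.order = o :=
    (ENat.ne_top_iff_exists.mp fun h => hc (MvPowerSeries.order_eq_top_iff.mp h)).imp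
      fun _ => Eq.symm
  choose N hN using exists_bound_swapSeries F
  have hfin : {e : Fin n →₀ ℕ | e.degree ≤ d.degree + o}.Finite := Finsupp.finite_of_degree_le _
  -- Beyond this degree in `y`, the product of `c` with the coefficient at `m` has no terms of
  -- degree up to `d.degree + o` in `b`. Orders add over `ℤ` and `c` has order `o`, so the
  -- coefficient itself has order greater than `d.degree`.
  refine ⟨hfin.toFinset.sup N, fun m hm => ?_⟩
  have h1 : ((d.degree + o + 1 : ℕ) : ℕ∞) ≤ (c * MvPowerSeries.coeff m f.1).order := by
    refine MvPowerSeries.nat_le_order fun e he => ?_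
    rw [← MvPowerSeries.coeff_C_mul, h]
    refine hN e m (lt_of_le_of_lt (Finset.le_sup ?_) hm)
    simpa using Nat.lt_succ_iff.mp he
  rw [MvPowerSeries.order_mul, ho] at h1
  apply MvPowerSeries.coeff_of_lt_order
  by_contra h2
  push Not at h2
  have h3 := h1.trans (add_le_add le_rfl h2)
  norm_cast at h3
  omega

end Expand

/-! ## Transport of the action along `ι̂` -/

section Transport

variable {n : ℕ}

theorem sameSeries_iff {f : SymSeries (RepLoc n)} {F : BSym n} :
    SameSeries f F ↔ ∃ f' : SymSeries (RepRing n),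
      SymSeries.map (algebraMap (RepRing n) (RepLoc n)) f' = f ∧
        MvPowerSeries.map expandRep f'.1 = swapSeries F := by
  refine exists_congr fun f' => and_congr Iff.rfl ?_
  exact ⟨fun h => MvPowerSeries.ext fun m => MvPowerSeries.ext fun d => h m d, fun h m d =>
    congrArg (fun G => MvPowerSeries.coeff d (MvPowerSeries.coeff m G)) h⟩

/-- `ι̂` maps the expansion of `f` to that of `g`. -/
def MapsRep (f g : SymSeries (RepRing n)) : Prop :=
  ∃ F : BSym n, MvPowerSeries.map expandRep f.1 = swapSeries F ∧
    MvPowerSeries.map expandRep g.1 = swapSeries (iotaHatHom n F)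

theorem maps_iff {f g : SymSeries (RepLoc n)} : Maps (iotaHat n) f g ↔
    ∃ f' g', SymSeries.map (algebraMap (RepRing n) (RepLoc n)) f' = f ∧
      SymSeries.map (algebraMap (RepRing n) (RepLoc n)) g' = g ∧ MapsRep f' g' := by
  constructor
  · rintro ⟨F, hf, hg⟩
    obtain ⟨f', h1, h2⟩ := sameSeries_iff.mp hf
    obtain ⟨g', h3, h4⟩ := sameSeries_iff.mp hg
    exact ⟨f', g', h1, h3, F, h2, h4⟩
  · rintro ⟨f', g', h1, h3, F, h2, h4⟩
    exact ⟨F, sameSeries_iff.mpr ⟨f', h1, h2⟩, sameSeries_iff.mpr ⟨g', h3, h4⟩⟩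

theorem MapsRep.mul {f g f' g' : SymSeries (RepRing n)} (h : MapsRep f g) (h' : MapsRep f' g') :
    MapsRep (f * f') (g * g') := by
  obtain ⟨F, h1, h2⟩ := h
  obtain ⟨F', h3, h4⟩ := h'
  refine ⟨F * F', ?_, ?_⟩
  · rw [MulMemClass.coe_mul, map_mul, map_mul, h1, h3]
  · rw [MulMemClass.coe_mul, map_mul, map_mul, map_mul, h2, h4]

theorem MapsRep.add {f g f' g' : SymSeries (RepRing n)} (h : MapsRep f g) (h' : MapsRep f' g') :
    MapsRep (f + f') (g + g') := by
  obtain ⟨F, h1, h2⟩ := h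
  obtain ⟨F', h3, h4⟩ := h'
  refine ⟨F + F', ?_, ?_⟩
  · rw [AddMemClass.coe_add, map_add, map_add, h1, h3]
  · rw [AddMemClass.coe_add, map_add, map_add, map_add, h2, h4]

theorem mapsRep_algebraMap (r : RepRing n) :
    MapsRep (algebraMap _ (SymSeries (RepRing n)) r) (algebraMap _ _ (iotaRep r)) := by
  refine ⟨expandSym r, ?_, ?_⟩
  · rw [swapSeries_expandSym]
    exact MvPowerSeries.map_C _ _
  · rw [iotaHatHom_expandSym, swapSeries_expandSym]
    exact MvPowerSeries.map_C _ _

theorem MapsRep.smul {f g : SymSeries (RepRing n)} (h : MapsRep f g) (r : RepRing n) :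
    MapsRep (r • f) (iotaRep r • g) := by
  rw [Algebra.smul_def, Algebra.smul_def]
  exact (mapsRep_algebraMap r).mul h

theorem mapsRep_zero : MapsRep (0 : SymSeries (RepRing n)) 0 := by
  simpa using mapsRep_algebraMap (0 : RepRing n)

theorem mapsRep_one : MapsRep (1 : SymSeries (RepRing n)) 1 := by
  simpa using mapsRep_algebraMap (1 : RepRing n)

theorem MapsRep.neg {f g : SymSeries (RepRing n)} (h : MapsRep f g) : MapsRep (-f) (-g) := by
  simpa using h.smul (-1)

theorem MapsRep.sub {f g f' g' : SymSeries (RepRing n)} (h : MapsRep f g) (h' : MapsRep f' g') :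
    MapsRep (f - f') (g - g') := by
  rw [sub_eq_add_neg, sub_eq_add_neg]
  exact h.add h'.neg

theorem map_expandRep_permRep (u : Equiv.Perm (Fin n)) {f : SymSeries (RepRing n)} {F : BSym n}
    (h : MvPowerSeries.map expandRep f.1 = swapSeries F) :
    MvPowerSeries.map expandRep (SymSeries.map (permRep u) f).1 =
      swapSeries (MvPowerSeries.rename u F) := by
  rw [swapSeries_rename, ← h]
  exact MvPowerSeries.ext fun m => expandRep_permRep u _

theorem MapsRep.perm {f g : SymSeries (RepRing n)} (h : MapsRep f g) (u : Equiv.Perm (Fin n)) :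
    MapsRep (SymSeries.map (permRep u) f)
      (SymSeries.map (permRep (Fin.revPerm * u * Fin.revPerm)) g) := by
  obtain ⟨F, h1, h2⟩ := h
  refine ⟨MvPowerSeries.rename u F, map_expandRep_permRep u h1, ?_⟩
  rw [iotaHatHom_rename]
  exact map_expandRep_permRep _ h2

theorem map_expandRep_Omega (i : Fin n) :
    MvPowerSeries.map expandRep (Omega (bb i)).val.1 =
      swapSeries (substVar SymFun i hSeries) := by
  rw [swapSeries_substVar_hSeries, ← expandRep_bb]
  exact congrArg Subtype.val (map_omegaSeries expandRep (bb i))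

theorem map_expandRep_Omega_inv (i : Fin n) :
    MvPowerSeries.map expandRep ((Omega (bb i))⁻¹ : (SymSeries (RepRing n))ˣ).val.1 =
      swapSeries (substVar SymFun i eNegSeries) := by
  rw [swapSeries_substVar_eNegSeries, Omega_inv_val, map_eSeries, expandRep_bb]

theorem mapsRep_Omega (i : Fin n) :
    MapsRep (Omega (bb i)).val ((Omega (bb i.rev))⁻¹ : (SymSeries (RepRing n))ˣ).val :=
  ⟨_, map_expandRep_Omega i, by rw [iotaHat_substVar_hSeries, map_expandRep_Omega_inv]⟩

theorem mapsRep_Omega_inv (i : Fin n) :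
    MapsRep ((Omega (bb i))⁻¹ : (SymSeries (RepRing n))ˣ).val (Omega (bb i.rev)).val :=
  ⟨_, map_expandRep_Omega_inv i, by rw [iotaHat_substVar_eNegSeries, map_expandRep_Omega]⟩

/-- Modulo `c(a_i - a_j)` the elements `e^{-a_i}` and `e^{-a_j}` coincide, so the transposition acts
trivially on the quotient. -/
theorem cc_dvd_permRep_swap_sub (i j : Fin n) (r : RepRing n) :
    cc (chr i - chr j) ∣ permRep (Equiv.swap i j) r - r := by
  let φ := Ideal.Quotient.mk (Ideal.span {cc (chr i - chr j)})
  have h0 : φ (expo (chr i - chr j)) = 1 := by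
    have : φ (1 - expo (chr i - chr j)) = 0 :=
      Ideal.Quotient.eq_zero_iff_mem.mpr (Ideal.mem_span_singleton_self _)
    rw [map_sub, map_one, sub_eq_zero] at this
    exact this.symm
  have h1 : φ (expo (-chr i)) = φ (expo (-chr j)) := by
    have : expo (-chr j) = expo (-chr i) * expo (chr i - chr j) := by
      rw [← expo_add]
      congr 1
      abel
    rw [this, map_mul, h0, mul_one]
  have h2 : φ.comp (permRep (Equiv.swap i j)) = φ := by
    refine repRing_hom_ext fun k => ?_
    rw [RingHom.comp_apply, permRep_expo_neg_chr]
    rcases eq_or_ne k i with rfl | hi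
    · rw [Equiv.swap_apply_left, h1]
    rcases eq_or_ne k j with rfl | hj
    · rw [Equiv.swap_apply_right, h1]
    rw [Equiv.swap_apply_of_ne_of_ne hi hj]
  rw [← Ideal.mem_span_singleton, ← Ideal.Quotient.eq_zero_iff_mem, map_sub, sub_eq_zero]
  exact RingHom.congr_fun h2 r

/-- Divide coefficient by coefficient; cancelling the nonzero `c(a_i - a_j)` in the domain `R(T)`
shows that the quotients are again symmetric. Thus these divided differences do not leave the series
over `R(T)`. -/
theorem exists_divided_difference {i j : Fin n} (hij : i ≠ j) (f : SymSeries (RepRing n)) :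
    ∃ q : SymSeries (RepRing n),
      cc (chr i - chr j) • q = SymSeries.map (permRep (Equiv.swap i j)) f - f := by
  choose q hq using fun m : ℕ →₀ ℕ =>
    cc_dvd_permRep_swap_sub i j (MvPowerSeries.coeff m f.1)
  have hf : ∀ (e : Equiv.Perm ℕ) m,
      MvPowerSeries.coeff (m.equivMapDomain e) f.1 = MvPowerSeries.coeff m f.1 := by
    intro e m
    have := coeff_rename_perm e.symm f.1 m
    rw [f.2 e.symm] at this
    exact this.symm
  refine ⟨symOfCoeff q fun e m => ?_, Subtype.ext (MvPowerSeries.ext fun m => (hq m).symm)⟩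
  apply mul_left_cancel₀ (cc_ne_zero hij)
  rw [← hq, ← hq, hf]

theorem expandRep_cc_ne_zero {i j : Fin n} (hij : i ≠ j) :
    expandRep (cc (chr i - chr j)) ≠ 0 := by
  intro h
  rw [cc, map_sub, map_one, sub_eq_zero] at h
  have h2 : expandRep (expo (-chr j)) = expandRep (expo (-chr i)) := by
    have : expo (-chr j) = expo (-chr i) * expo (chr i - chr j) := by
      rw [← expo_add]
      congr 1
      abel
    rw [this, map_mul, ← h, mul_one]
  rw [expandRep_expo_neg_chr, expandRep_expo_neg_chr] at h2
  have h3 := congrArg (MvPowerSeries.coeff (Finsupp.single i 1)) (sub_right_injective h2)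
  classical
  rw [MvPowerSeries.coeff_X, MvPowerSeries.coeff_X] at h3
  simp [Finsupp.single_left_inj, hij] at h3

/-- The first nonvanishing is used to show that the quotient `f` expands in `Λ[[b]]`, the second to
cancel `ι(c)` on the image side. -/
theorem MapsRep.of_smul {f g : SymSeries (RepRing n)} {c : RepRing n} (hc : expandRep c ≠ 0)
    (hc' : expandRep (iotaRep c) ≠ 0) (h : MapsRep (c • f) (iotaRep c • g)) : MapsRep f g := by
  obtain ⟨F, h1, h2⟩ := h
  have e : ∀ (c : RepRing n) (f : SymSeries (RepRing n)), MvPowerSeries.map expandRep (c • f).1 =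
      MvPowerSeries.C (expandRep c) * MvPowerSeries.map expandRep f.1 := by
    intro c f
    rw [Algebra.smul_def, MulMemClass.coe_mul, map_mul]
    exact congrArg (· * _) (MvPowerSeries.map_C _ _)
  rw [e] at h1 h2
  obtain ⟨G, hG⟩ := exists_swapSeries_of_mul hc (SymSeries.map expandRep f) F h1
  have hG : swapSeries G = MvPowerSeries.map expandRep f.1 := hG
  refine ⟨G, hG.symm, ?_⟩
  have h3 : F = expandSym c * G := by
    apply swapSeries_injective
    rw [map_mul, swapSeries_expandSym, hG, h1]
  rw [h3, map_mul, iotaHatHom_expandSym, map_mul, swapSeries_expandSym] at h2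
  refine MvPowerSeries.ext fun _ => mul_left_cancel₀ hc' ?_
  rw [← MvPowerSeries.coeff_C_mul, h2, MvPowerSeries.coeff_C_mul]

theorem map_permLoc_map (u : Equiv.Perm (Fin n)) (f : SymSeries (RepRing n)) :
    SymSeries.map (permLoc u) (SymSeries.map (algebraMap (RepRing n) (RepLoc n)) f) =
      SymSeries.map (algebraMap (RepRing n) (RepLoc n)) (SymSeries.map (permRep u) f) :=
  Subtype.ext (MvPowerSeries.ext fun _ => permLoc_algebraMap u _)

theorem act_grp_perm (u : Equiv.Perm (Fin n)) (f : SymSeries (RepLoc n)) :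
    act (grp (perm u)) f = SymSeries.map (permLoc u) f := by
  rw [act_grp, weylAct_apply]
  simp [OmegaPow]

theorem act_grp_transl_single (i : Fin n) (c : ℤ) (f : SymSeries (RepLoc n)) :
    act (grp (transl (Pi.single i c))) f =
      (Omega (algebraMap (RepRing n) (RepLoc n) (bb i)) ^ c : (SymSeries (RepLoc n))ˣ) * f := by
  rw [act_grp, weylAct_of_right_eq_one (transl_right _), OmegaPow, Finset.prod_eq_single i]
  · simp
  · intro j _ hj
    simp [hj]
  · simp

theorem map_Omega {A B : Type*} [CommRing A] [CommRing B] (φ : A →+* B) (b : A) :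
    Units.map (SymSeries.map φ).toMonoidHom (Omega b) = Omega (φ b) :=
  Units.ext (map_omegaSeries φ b)

theorem smul_eq_of_isUnit {c : RepRing n} {x : RepLoc n}
    (hc : algebraMap (RepRing n) (RepLoc n) c * x = 1) (q : SymSeries (RepRing n)) :
    x • SymSeries.map (algebraMap (RepRing n) (RepLoc n)) (c • q) =
      SymSeries.map (algebraMap (RepRing n) (RepLoc n)) q := by
  rw [SymSeries.map_smul, smul_smul, mul_comm, hc, one_smul]

theorem starAut_perm (u : Equiv.Perm (Fin n)) :
    starAut (perm u) = perm (Fin.revPerm * u * Fin.revPerm) :=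
  extWeyl_ext (fun _ => by simp [starAut]) fun _ => rfl

theorem starAut_transl_single (i : Fin n) (c : ℤ) :
    starAut (transl (Pi.single i c)) = transl (Pi.single i.rev (-c)) := by
  refine extWeyl_ext (fun j => ?_) fun j => by simp [starAut]
  apply Multiplicative.toAdd.injective
  simp [starAut, Pi.single_apply, Fin.rev_eq_iff]
  split_ifs <;> simp

variable [NeZero n]

theorem act_demT (hn : 2 ≤ n) {i : Fin n} (hi : i ≠ 0) {f q : SymSeries (RepRing n)}
    (h : cc (simpleRoot i) • q = SymSeries.map (permRep (Equiv.swap (i - 1) i)) f - f) :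
    act (demT i) (SymSeries.map (algebraMap (RepRing n) (RepLoc n)) f) =
      SymSeries.map (algebraMap (RepRing n) (RepLoc n)) q := by
  rw [demT_eq, act_mul, act_sub, act_one, simpleRefl_eq_perm hi, act_grp_perm, map_permLoc_map,
    ← map_sub, ← h, act_scal]
  exact smul_eq_of_isUnit (cc_mul_rootInv (sub_one_ne hn i)) q

/-- The elements of `K^Δ` whose action is compatible with `ι̂`. -/
def compatibleSubring : Subring (KDelta n) where
  carrier := {a | ∀ f g, Maps (iotaHat n) f g → Maps (iotaHat n) (act a f) (act (iotaK a) g)}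
  mul_mem' ha hb f g h := by
    rw [map_mul, act_mul, act_mul]
    exact ha _ _ (hb _ _ h)
  one_mem' f g h := by rwa [map_one, act_one, act_one]
  add_mem' ha hb f g h := by
    obtain ⟨f1, g1, h1, h2, h3⟩ := maps_iff.mp (ha _ _ h)
    obtain ⟨f2, g2, h4, h5, h6⟩ := maps_iff.mp (hb _ _ h)
    rw [map_add, act_add, act_add, ← h1, ← h2, ← h4, ← h5, ← map_add, ← map_add]
    exact maps_iff.mpr ⟨_, _, rfl, rfl, h3.add h6⟩
  zero_mem' f g h := by
    rw [map_zero, act_zero, act_zero]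
    exact maps_iff.mpr ⟨0, 0, map_zero _, map_zero _, mapsRep_zero⟩
  neg_mem' ha f g h := by
    obtain ⟨f1, g1, h1, h2, h3⟩ := maps_iff.mp (ha _ _ h)
    rw [map_neg, act_neg, act_neg, ← h1, ← h2, ← map_neg, ← map_neg]
    exact maps_iff.mpr ⟨_, _, rfl, rfl, h3.neg⟩

theorem scalRep_mem_compatibleSubring (r : RepRing n) : scalRep r ∈ compatibleSubring := by
  intro f g h
  obtain ⟨f', g', rfl, rfl, h3⟩ := maps_iff.mp h
  refine maps_iff.mpr ⟨_, _, ?_, ?_, h3.smul r⟩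
  · exact (SymSeries.map_smul _ _ _).trans (act_scal _ _).symm
  · rw [iotaK_scalRep]
    exact (SymSeries.map_smul _ _ _).trans (act_scal _ _).symm

theorem grp_perm_mem_compatibleSubring (u : Equiv.Perm (Fin n)) :
    grp (perm u) ∈ compatibleSubring := by
  intro f g h
  obtain ⟨f', g', rfl, rfl, h3⟩ := maps_iff.mp h
  rw [iotaK_grp, starAut_perm, act_grp_perm, act_grp_perm, map_permLoc_map, map_permLoc_map]
  exact maps_iff.mpr ⟨_, _, rfl, rfl, h3.perm u⟩

/-- The star involution sends the translation by `ε_i` to that by `-ε_{n-1-i}`, just as `ι̂` sends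
`Ω(b_i | y)` to `Ω(b_{n-1-i} | y)⁻¹`. -/
theorem grp_transl_mem_compatibleSubring (i : Fin n) :
    grp (transl (Pi.single i 1)) ∈ compatibleSubring ∧
      grp (transl (Pi.single i (-1))) ∈ compatibleSubring := by
  constructor <;> intro f g h <;> obtain ⟨f', g', rfl, rfl, h3⟩ := maps_iff.mp h <;>
    rw [iotaK_grp, starAut_transl_single, act_grp_transl_single, act_grp_transl_single,
      ← map_Omega, ← map_Omega]
  · rw [zpow_one, zpow_neg_one, ← map_inv]
    exact maps_iff.mpr ⟨_, _, map_mul _ _ _, map_mul _ _ _, (mapsRep_Omega i).mul h3⟩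
  · rw [neg_neg, zpow_one, zpow_neg_one, ← map_inv]
    exact maps_iff.mpr ⟨_, _, map_mul _ _ _, map_mul _ _ _, (mapsRep_Omega_inv i).mul h3⟩

theorem grp_mem_compatibleSubring (w : ExtWeyl n) : grp w ∈ compatibleSubring := by
  let G : Submonoid (ExtWeyl n) := compatibleSubring.toSubmonoid.comap grp
  have h1 : ∀ i (c : ℤ), transl (Pi.single i c) ∈ G := by
    have key : ∀ i (c : ℤ) (k : ℕ), transl (Pi.single i c) ∈ G →
        transl (Pi.single i (k * c)) ∈ G := by
      intro i c k h
      convert G.pow_mem h k using 1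
      rw [transl, transl, ← map_pow]
      congr 1
      funext j
      by_cases hj : j = i
      · subst hj
        simp [← ofAdd_nsmul]
      · simp [hj]
    intro i c
    obtain ⟨k, rfl | rfl⟩ := c.eq_nat_or_neg
    · simpa using key i 1 k (grp_transl_mem_compatibleSubring i).1
    · simpa using key i (-1) k (grp_transl_mem_compatibleSubring i).2
  have h2 : w = SemidirectProduct.inl w.left * perm w.right :=
    (SemidirectProduct.inl_left_mul_inr_right w).symm
  have h3 : w ∈ G := by
    rw [h2]
    refine G.mul_mem ?_ (grp_perm_mem_compatibleSubring _)
    rw [← Finset.univ_prod_mulSingle w.left]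
    refine (G.comap (SemidirectProduct.inl : (Fin n → Multiplicative ℤ) →* ExtWeyl n)).prod_mem
      fun i _ => ?_
    rw [Submonoid.mem_comap]
    convert h1 i (w.left i).toAdd using 1
    refine congrArg SemidirectProduct.inl (funext fun k => ?_)
    by_cases hk : k = i
    · subst hk; simp
    · simp [hk]
  exact h3

/-- For a nonzero node `s_i` acts only on coefficients, so `c(α_i) T_i f = s_i f - f` is compatible
with `ι̂` by the case of permutations. Then `c(α_i)` is cancelled, its image under `ι` being
`c(α_{-i})`. -/
theorem demT_mem_compatibleSubring (hn : 2 ≤ n) {i : Fin n} (hi : i ≠ 0) :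
    demT i ∈ compatibleSubring := by
  intro f g h
  obtain ⟨f', g', rfl, rfl, h3⟩ := maps_iff.mp h
  obtain ⟨q, hq⟩ := exists_divided_difference (sub_one_ne hn i) f'
  obtain ⟨p, hp⟩ := exists_divided_difference (sub_one_ne hn (-i)) g'
  rw [iotaK_demT hn, act_demT hn hi hq, act_demT hn (neg_ne_zero.mpr hi) hp]
  have hrev : i.rev = -i - 1 ∧ (i - 1).rev = -i := by
    rw [rev_eq_sub, rev_eq_sub]
    exact ⟨rfl, by abel⟩
  have e : iotaRep (cc (chr (i - 1) - chr i)) = cc (chr (-i - 1) - chr (-i)) := by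
    rw [iotaRep_cc, map_sub, iotaChar_chr, iotaChar_chr, hrev.1, hrev.2]
    congr 1
    abel
  have e2 : Fin.revPerm * Equiv.swap (i - 1) i * Fin.revPerm = Equiv.swap (-i - 1) (-i) := by
    have h4 : (Fin.revPerm : Equiv.Perm (Fin n)) = Fin.revPerm⁻¹ := rfl
    conv_lhs => enter [2]; rw [h4]
    rw [← Equiv.swap_apply_apply, Fin.revPerm_apply, Fin.revPerm_apply, hrev.1, hrev.2,
      Equiv.swap_comm]
  refine maps_iff.mpr ⟨_, _, rfl, rfl, MapsRep.of_smul (c := cc (chr (i - 1) - chr i))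
    (expandRep_cc_ne_zero (sub_one_ne hn i)) ?_ ?_⟩
  · rw [e]
    exact expandRep_cc_ne_zero (sub_one_ne hn (-i))
  · rw [e, hq, hp, ← e2]
    exact (h3.perm _).sub h3

theorem nilHecke_le_compatibleSubring (hn : 2 ≤ n) : nilHecke n ≤ compatibleSubring := by
  have h1 : (1 : Fin n) ≠ 0 := by
    intro h
    exact sub_one_ne hn 0 (by rw [h, sub_zero])
  exact nilHecke_induction hn 1 _ scalRep_mem_compatibleSubring grp_mem_compatibleSubring
    (demT_mem_compatibleSubring hn h1)

/-- `ι̂ (a · 1) = ι(a) · 1` for all `a ∈ K`. -/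
theorem maps_act_one (hn : 2 ≤ n) {a : KDelta n} (ha : a ∈ nilHecke n) :
    Maps (iotaHat n) (act a 1) (act (iotaK a) 1) :=
  nilHecke_le_compatibleSubring hn ha 1 1
    (maps_iff.mpr ⟨1, 1, map_one _, map_one _, mapsRep_one⟩)

end Transport

end KDoubleSchur

end

theorem mainTheorem9 (n : ℕ) [NeZero n] (hn : 2 ≤ n) :
    ∃ ω : SymFun ≃+* SymFun, (IsMorse ω ∧ ∀ ω' : SymFun ≃+* SymFun, IsMorse ω' → ω' = ω) ∧
    ∃ ι : BSym n ≃+* BSym n,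
      (IsIotaHat ω ι ∧ ∀ ι' : BSym n ≃+* BSym n, IsIotaHat ω ι' → ι' = ι) ∧
      (∀ F : BSym n, ι (ι F) = F) ∧
      -- the isomorphism `x ↦ x · 1` from the Peterson subalgebra onto `Λ̂_{(n)}`
      Set.BijOn (fun x => act x 1) (peterson n : Set (KDelta n)) (hatLambdaN n) ∧
      (∀ x ∈ peterson n, ∀ y ∈ peterson n, act (x * y) 1 = act x 1 * act y 1) ∧
      -- the involution of the Peterson subalgebra is transported to `ι̂`
      (∀ x ∈ peterson n, iotaK x ∈ peterson n ∧ Maps ι (act x 1) (act (iotaK x) 1)) ∧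
      -- and `ι̂` maps the double `k`-Schur functions of `w` to those of `w*`
      (∀ w : ExtWeyl n, IsGrassmannian w → IsGrassmannian (starAut w) ∧
        Maps ι (gClosed w) (gClosed (starAut w)) ∧
        Maps ι (gFun w) (gFun (starAut w))) := by
  refine ⟨morse, ⟨isMorse_morse, fun _ => isMorse_morse.eq⟩, iotaHat n,
    ⟨isIotaHat_iotaHat, fun _ => isIotaHat_iotaHat.eq⟩, iotaHatHom_iotaHatHom, bijOn_peterson hn,
    fun x hx y _ => act_mul_one_of_centralizes hx.2 y,
    fun x hx => ⟨iotaK_mem_peterson hn hx, maps_act_one hn hx.1⟩, fun w hw => ⟨hw.star, ?_, ?_⟩⟩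
  · rw [gClosed, gClosed, ← iotaK_bigD hn]
    exact maps_act_one hn (bigD_mem w)
  · rw [gFun, gFun, ← iotaK_bigT hn]
    exact maps_act_one hn (bigT_mem w)
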